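/- Let $\sigma$ be a finite relational signature $R_1,\dots,R_j$ with arities $a_1,\dots,a_j$. First-order formulas over $\sigma$ are words over the alphabet $\{\neg,\wedge,\vee,\exists,\forall,=\}\cup\{(,),R,v,0,1\}$: the atomic formulas are $R_i(v_{j_1}\cdots v_{j_{a_i}})$ and $v_{j_1}=v_{j_2}$, where $R_i$ is written as $R$ followed by $i$ in binary and the variable $v_j$ ($j\in\mathbb{N}$) as $v$ followed by $j$ in binary; compound formulas are $(\neg\varphi)$, $(\varphi\wedge\psi)$, $(\varphi\vee\psi)$ and, provided that $v_j$ is free in $\varphi$, $(\exists v_j\varphi)$ and $(\forall v_j\varphi)$. A sentence is a formula without free variables. For $\Gamma\subseteq\{\neg,\wedge,\vee,\exists,\forall,=\}$ and a $\sigma$-structure $A$, the model checking problem $\Gamma\text{-}\mathrm{MC}(A)$ is the language of all words that are sentences $\varphi$ over $\sigma$ whose logical symbols all belong to $\Gamma$ and that satisfy $A\models\varphi$. Proposition. Let $\Gamma$ be one of $\{\vee,\exists\}$, $\{\vee,\exists,=\}$, $\{\wedge,\forall\}$, $\{\wedge,\forall,=\}$. Then for every finite relational signature $\sigma$ and every finite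 non-empty $\sigma$-structure $A$, the problem $\Gamma\text{-}\mathrm{MC}(A)$ is in Logspace, i.e. it is decided by a deterministic Turing machine with a read-only input tape that uses $O(\log n)$ work-tape cells on inputs of length $n$. -/

import Mathlib

namespace FOModelChecking

/-! ### Relational signatures and structures -/

/-- A relational signature: a finite sequence of relation symbols with their arities.
The symbol with index `i : Fin card` is the one written `R_{i+1}`. -/
structure Signature where
  card : ℕ
  arity : Fin card → ℕ

/-- A structure over `σ` with domain `D`. (That `D` is finite and non-empty is stated where
structures are used.) -/
structure Signature.Struct (σ : Signature) (D : Type*) where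
  rel : (i : Fin σ.card) → Set (Fin (σ.arity i) → D)

/-! ### The alphabet -/

/-- The logical symbols `¬, ∧, ∨, ∃, ∀, =`. -/
inductive LogSym
  | neg | and | or | ex | all | eq
  deriving DecidableEq

/-- The remaining symbols `(`, `)`, `R`, `v`, `0`, `1`. -/
inductive AuxSym
  | lpar | rpar | R | v | zero | one
  deriving DecidableEq

instance : Fintype LogSym :=
  ⟨{.neg, .and, .or, .ex, .all, .eq}, fun x => by cases x <;> simp⟩

instance : Fintype AuxSym :=
  ⟨{.lpar, .rpar, .R, .v, .zero, .one}, fun x => by cases x <;> simp⟩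

/-- The alphabet over which formulas are written. -/
abbrev Sym : Type := LogSym ⊕ AuxSym

/-! ### First-order formulas -/

/-- First-order formulas over `σ`, with variables `v_0, v_1, v_2, …`. -/
inductive Formula (σ : Signature) : Type
  | rel (i : Fin σ.card) (t : Fin (σ.arity i) → ℕ) : Formula σ
  | eq (j k : ℕ) : Formula σ
  | neg (φ : Formula σ) : Formula σ
  | and (φ ψ : Formula σ) : Formula σ
  | or (φ ψ : Formula σ) : Formula σ
  | ex (j : ℕ) (φ : Formula σ) : Formula σ
  | all (j : ℕ) (φ : Formula σ) : Formula σ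

namespace Formula

variable {σ : Signature}

/-- The set of (indices of) free variables. -/
def freeVars : Formula σ → Set ℕ
  | rel _ t => Set.range t
  | eq j k => {j, k}
  | neg φ => φ.freeVars
  | and φ ψ => φ.freeVars ∪ ψ.freeVars
  | or φ ψ => φ.freeVars ∪ ψ.freeVars
  | ex j φ => φ.freeVars \ {j}
  | all j φ => φ.freeVars \ {j}

/-- Formation rule for quantifiers: `∃ v_j φ` and `∀ v_j φ` are formulas only if `v_j` is free
in `φ`. -/
def WellFormed : Formula σ → Prop
  | rel _ _ => True
  | eq _ _ => True
  | neg φ => φ.WellFormed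
  | and φ ψ => φ.WellFormed ∧ ψ.WellFormed
  | or φ ψ => φ.WellFormed ∧ ψ.WellFormed
  | ex j φ => j ∈ φ.freeVars ∧ φ.WellFormed
  | all j φ => j ∈ φ.freeVars ∧ φ.WellFormed

/-- A sentence is a well-formed formula without free variables. -/
def IsSentence (φ : Formula σ) : Prop :=
  φ.WellFormed ∧ φ.freeVars = ∅

/-- The logical symbols that occur in a formula. -/
def logSyms : Formula σ → Set LogSym
  | rel _ _ => ∅
  | eq _ _ => {LogSym.eq}
  | neg φ => {LogSym.neg} ∪ φ.logSyms
  | and φ ψ => {LogSym.and} ∪ φ.logSyms ∪ ψ.logSyms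
  | or φ ψ => {LogSym.or} ∪ φ.logSyms ∪ ψ.logSyms
  | ex _ φ => {LogSym.ex} ∪ φ.logSyms
  | all _ φ => {LogSym.all} ∪ φ.logSyms

/-- Tarski satisfaction in the structure `A` under the assignment `s` of the variables. -/
def Sat {D : Type*} (A : σ.Struct D) : Formula σ → (ℕ → D) → Prop
  | rel i t, s => (fun m => s (t m)) ∈ A.rel i
  | eq j k, s => s j = s k
  | neg φ, s => ¬ φ.Sat A s
  | and φ ψ, s => φ.Sat A s ∧ ψ.Sat A s
  | or φ ψ, s => φ.Sat A s ∨ ψ.Sat A s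
  | ex j φ, s => ∃ x : D, φ.Sat A (Function.update s j x)
  | all j φ, s => ∀ x : D, φ.Sat A (Function.update s j x)

/-- `A ⊨ φ`: the formula holds in `A` under every assignment. (For a sentence the assignment does
not matter.) -/
def Holds {D : Type*} (A : σ.Struct D) (φ : Formula σ) : Prop :=
  ∀ s : ℕ → D, φ.Sat A s

end Formula

/-! ### Formulas as words -/

/-- The binary representation of a natural number, most significant digit first and without
leading zeros; zero is written `0`. -/
def bin (n : ℕ) : List Sym :=
  if n = 0 then [Sum.inr AuxSym.zero]
  else n.bits.reverse.map fun b => Sum.inr (if b then AuxSym.one else AuxSym.zero)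

/-- The word for the variable `v_j`. -/
def varWord (j : ℕ) : List Sym :=
  Sum.inr AuxSym.v :: bin j

/-- Enclose a word in parentheses. -/
def paren (w : List Sym) : List Sym :=
  [Sum.inr AuxSym.lpar] ++ w ++ [Sum.inr AuxSym.rpar]

/-- The word that is the written form of a formula. -/
def Formula.word {σ : Signature} : Formula σ → List Sym
  | rel i t =>
      [Sum.inr AuxSym.R] ++ bin (i + 1) ++ paren ((List.ofFn t).flatMap varWord)
  | eq j k => varWord j ++ [Sum.inl LogSym.eq] ++ varWord k
  | neg φ => paren ([Sum.inl LogSym.neg] ++ φ.word)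
  | and φ ψ => paren (φ.word ++ [Sum.inl LogSym.and] ++ ψ.word)
  | or φ ψ => paren (φ.word ++ [Sum.inl LogSym.or] ++ ψ.word)
  | ex j φ => paren ([Sum.inl LogSym.ex] ++ varWord j ++ φ.word)
  | all j φ => paren ([Sum.inl LogSym.all] ++ varWord j ++ φ.word)

/-- The model checking problem `Γ-MC(A)` as a language: the words that are (the written form of)
a sentence that uses no logical symbols outside `Γ` and is true in `A`. -/
def MC {σ : Signature} {D : Type*} (Γ : Set LogSym) (A : σ.Struct D) : Language Sym :=
  {w | ∃ φ : Formula σ, φ.IsSentence ∧ φ.logSyms ⊆ Γ ∧ φ.Holds A ∧ φ.word = w}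

/-- The four logics of Class I. -/
def ClassI : Set (Set LogSym) :=
  {{LogSym.or, LogSym.ex}, {LogSym.or, LogSym.ex, LogSym.eq},
    {LogSym.and, LogSym.all}, {LogSym.and, LogSym.all, LogSym.eq}}

/-! ### Logarithmic space -/

/-- Head movements. -/
inductive Move
  | left | stay | right

/-- The new head position on a tape with cells `0, 1, 2, …`; moving left from cell `0` has no
effect. -/
def Move.apply : Move → ℕ → ℕ
  | left, p => p - 1
  | stay, p => p
  | right, p => p + 1

/-- What the input head may see: the left end marker, a letter of the input, or the right end
marker. -/
inductive InputCell (α : Type)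
  | leftEnd
  | letter (a : α)
  | rightEnd

/-- The content of cell `p` of the input tape: cell `0` holds the left end marker, the cells
`1, …, |w|` the letters of `w`, and cell `|w| + 1` the right end marker. -/
def inputCell {α : Type} (w : List α) (p : ℕ) : InputCell α :=
  if p = 0 then InputCell.leftEnd
  else match w[p - 1]? with
    | some a => InputCell.letter a
    | none => InputCell.rightEnd

/-- A deterministic Turing machine with a two-way read-only input tape over the alphabet `α` and
`k` read-write work tapes over a finite alphabet `B` with a blank. If `δ` is `none` the machine
halts; otherwise `δ` gives the next state, the movement of the input head, and, for each work tape,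
the letter to be written and the movement of its head. -/
structure Machine (α : Type) where
  Q : Type
  finQ : Finite Q
  B : Type
  finB : Finite B
  blank : B
  k : ℕ
  start : Q
  accept : Set Q
  δ : Q → InputCell α → (Fin k → B) → Option (Q × Move × (Fin k → B × Move))

namespace Machine

variable {α : Type} (M : Machine α)

/-- Configurations: state, position of the input head, contents of the work tapes, positions of
the work heads. -/
structure Cfg where
  state : M.Q
  inPos : ℕ
  tape : Fin M.k → ℕ → M.B
  pos : Fin M.k → ℕ

/-- The initial configuration: the input head is on the left end marker, the work tapes are blank. -/
def init : M.Cfg where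
  state := M.start
  inPos := 0
  tape := fun _ _ => M.blank
  pos := fun _ => 0

/-- One step of the computation on input `w`; `none` if the machine has halted. The input head
does not move beyond the end markers. -/
def step (w : List α) (c : M.Cfg) : Option M.Cfg :=
  (M.δ c.state (inputCell w c.inPos) fun i => c.tape i (c.pos i)).map fun r =>
    { state := r.1
      inPos := min (r.2.1.apply c.inPos) (w.length + 1)
      tape := fun i => Function.update (c.tape i) (c.pos i) (r.2.2 i).1
      pos := fun i => (r.2.2 i).2.apply (c.pos i) }

/-- `M` decides `L`: on every input it halts, and it halts in an accepting state exactly if the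
input belongs to `L`. -/
def Decides (L : Language α) : Prop :=
  ∀ w : List α, ∃ c : M.Cfg, StateTransition.Reaches (M.step w) M.init c ∧
    M.step w c = none ∧ (c.state ∈ M.accept ↔ w ∈ L)

/-- On input `w` the machine visits at most the first `s` cells of each work tape. -/
def UsesSpaceAtMost (w : List α) (s : ℕ) : Prop :=
  ∀ c : M.Cfg, StateTransition.Reaches (M.step w) M.init c → ∀ i, c.pos i < s

end Machine

/-- The class Logspace: languages over a finite alphabet that are decided by a deterministic Turing
machine whose work space on inputs of length `n` is `O(log n)`. (The summand `1` only serves inputs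
of length `0` and `1`.) -/
def InLogspace {α : Type} [Finite α] (L : Language α) : Prop :=
  ∃ M : Machine α, M.Decides L ∧
    ∃ C : ℕ, ∀ w : List α, M.UsesSpaceAtMost w (C * (Nat.log 2 w.length + 1))

end FOModelChecking

/-! The semantic part is easy. A formula built with ∨ and ∃ is satisfied by some assignment iff one
of its atoms is: a disjunction is satisfiable iff a disjunct is, and ∃ adds nothing, since the
assignment is already existentially quantified (`PosForm.exists_sat`). For a sentence over a
non-empty domain, satisfiability is truth. Dually, a sentence with ∧ and ∀ is false iff one of its
atoms can be falsified (`PosForm.exists_not_sat`). An atom `R_i(t)` is satisfiable iff some tuple of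
the relation gives equal values to equal variables (`forall_eq_iff_exists_comp`); the structure is
fixed, so finitely many tuples have to be tried, and each trial only compares variables as words.

The main work is to recognise sentences without building a parse tree. A word with the outer form of
a formula is a formula iff every parenthesised factor that contains a logical symbol has the right
form one level deep (`PosForm.not_cur_badAt_word`, `PosForm.exists_word_eq`). Matching parentheses
needs only a depth counter. An occurrence of a variable is free iff it does not directly follow a
quantifier and no earlier quantifier on the same variable has its parenthesis still open (`Bd`,
`PosForm.freeIn_word`).

All these conditions quantify over positions of the input, with comparison of letters and the depth
counter as basic tests. They are evaluated with a fixed number of registers that hold numbers up to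
`n + 1` in binary, one per work tape; quantifiers become loops (`Comp.loop`, `CompP.exists_le`). A
factor of the input is given by two positions, and `CompW` collects the relations between factors
that are decidable in this way. It is closed under Boolean operations and under quantification over
splits (`CompW.split`), so the syntactic definitions can be transcribed clause by clause. -/

namespace FOModelChecking

/-! ### Machine fragments with several exits -/

/-- The letters on the work tapes. -/
inductive Cell
  | blank | mark | digit (b : Bool)
  deriving DecidableEq

instance : Finite Cell :=
  Finite.of_injective (β := Option (Option Bool))
    (fun c => match c with | .blank => none | .mark => some none | .digit b => some (some b))
    (by intro a b; cases a <;> cases b <;> simp)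

/-- The bit shown by a cell. -/
def Cell.bit : Cell → Bool
  | digit b => b
  | _ => false

/-- A piece of a Turing machine with `k` work tapes: instead of halting it leaves through one of
the exits `E`. -/
structure Frag (α : Type) (k : ℕ) (E : Type) where
  Q : Type
  finQ : Finite Q
  start : Q
  δ : Q → InputCell α → (Fin k → Cell) → (Q ⊕ E) × Move × (Fin k → Cell × Move)

/-- Configurations without the state. -/
@[ext] structure Conf (k : ℕ) where
  inPos : ℕ
  tape : Fin k → ℕ → Cell
  pos : Fin k → ℕ

variable {α : Type} {k : ℕ} {E E' : Type}

/-- The cells under the work heads. -/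
def Conf.read (c : Conf k) : Fin k → Cell := fun i => c.tape i (c.pos i)

/-- The configuration after an action. -/
def Conf.next (w : List α) (c : Conf k) (a : Move × (Fin k → Cell × Move)) : Conf k where
  inPos := min (a.1.apply c.inPos) (w.length + 1)
  tape := fun i => Function.update (c.tape i) (c.pos i) (a.2 i).1
  pos := fun i => (a.2 i).2.apply (c.pos i)

namespace Frag

/-- `F.Runs w s q c e d`: started in state `q` and configuration `c` the fragment leaves through
the exit `e` in the configuration `d`, and before that visits only the first `s` cells. -/
inductive Runs (F : Frag α k E) (w : List α) (s : ℕ) : F.Q → Conf k → E → Conf k → Prop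
  | exit {q c e a} : (∀ i, c.pos i < s) →
      F.δ q (inputCell w c.inPos) c.read = (Sum.inr e, a) → Runs F w s q c e (c.next w a)
  | next {q c q' a e d} : (∀ i, c.pos i < s) →
      F.δ q (inputCell w c.inPos) c.read = (Sum.inl q', a) →
      Runs F w s q' (c.next w a) e d → Runs F w s q c e d

/-- Run `F`, then the fragment chosen by the exit of `F`. -/
def bind [Finite E] (F : Frag α k E) (G : E → Frag α k E') : Frag α k E' where
  Q := F.Q ⊕ Σ e, (G e).Q
  finQ := by
    have := F.finQ
    have := fun e => (G e).finQ
    infer_instance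
  start := Sum.inl F.start
  δ := fun q x v => match q with
    | .inl q => match F.δ q x v with
      | (.inl q', a) => (.inl (.inl q'), a)
      | (.inr e, a) => (.inl (.inr ⟨e, (G e).start⟩), a)
    | .inr ⟨e, q⟩ => match (G e).δ q x v with
      | (.inl q', a) => (.inl (.inr ⟨e, q'⟩), a)
      | (.inr e', a) => (.inr e', a)

/-- Run `F e`; depending on its exit start again with another `e`, or leave. -/
def iter [Finite E] (F : E → Frag α k (E ⊕ E')) (e : E) : Frag α k E' where
  Q := Σ e, (F e).Q
  finQ := by
    have := fun e => (F e).finQ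
    infer_instance
  start := ⟨e, (F e).start⟩
  δ := fun q x v => match (F q.1).δ q.2 x v with
    | (.inl q', a) => (.inl ⟨q.1, q'⟩, a)
    | (.inr (.inl e'), a) => (.inl ⟨e', (F e').start⟩, a)
    | (.inr (.inr e'), a) => (.inr e', a)

variable {w : List α} {s : ℕ}

theorem Runs.bind_right [Finite E] {F : Frag α k E} {G : E → Frag α k E'} {e : E}
    {q : (G e).Q} {c d : Conf k} {e' : E'} (h : (G e).Runs w s q c e' d) :
    (F.bind G).Runs w s (Sum.inr ⟨e, q⟩) c e' d := by
  induction h with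
  | exit hb hd => exact .exit hb (by simp only [Frag.bind]; rw [hd])
  | next hb hd _ ih => exact .next hb (by simp only [Frag.bind]; rw [hd]) ih

theorem Runs.bind_left [Finite E] {F : Frag α k E} {G : E → Frag α k E'} {e : E}
    {q : F.Q} {c d d' : Conf k} {e' : E'} (h : F.Runs w s q c e d)
    (h' : (G e).Runs w s (G e).start d e' d') :
    (F.bind G).Runs w s (Sum.inl q) c e' d' := by
  induction h with
  | exit hb hd => exact .next hb (by simp only [Frag.bind]; rw [hd]) h'.bind_right
  | next hb hd _ ih => exact .next hb (by simp only [Frag.bind]; rw [hd]) (ih h')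

theorem Runs.iter_exit [Finite E] {F : E → Frag α k (E ⊕ E')} {e : E} {q : (F e).Q}
    {c d : Conf k} {e' : E'} (e₀ : E) (h : (F e).Runs w s q c (Sum.inr e') d) :
    (iter F e₀).Runs w s ⟨e, q⟩ c e' d := by
  generalize hx : (Sum.inr e' : E ⊕ E') = x at h
  induction h with
  | exit hb hd => subst hx; exact .exit hb (by simp only [Frag.iter]; rw [hd])
  | next hb hd _ ih => exact .next hb (by simp only [Frag.iter]; rw [hd]) (ih hx)

theorem Runs.iter_again [Finite E] {F : E → Frag α k (E ⊕ E')} {e e₁ : E} {q : (F e).Q}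
    {c d d' : Conf k} {e' : E'} (e₀ : E) (h : (F e).Runs w s q c (Sum.inl e₁) d)
    (h' : (iter F e₁).Runs w s (iter F e₁).start d e' d') :
    (iter F e₀).Runs w s ⟨e, q⟩ c e' d' := by
  -- `iter F e₁` and `iter F e₀` differ only in their start states, so they have the same runs from
  -- any given state.
  have key : ∀ {q c e' d}, (iter F e₁).Runs w s q c e' d → (iter F e₀).Runs w s q c e' d := by
    intro q c e' d h
    induction h with
    | exit hb hd => exact .exit hb hd
    | next hb hd _ ih => exact .next hb hd ih
  generalize hx : (Sum.inl e₁ : E ⊕ E') = x at h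
  induction h with
  | exit hb hd => subst hx; exact .next hb (by simp only [Frag.iter]; rw [hd]) (key h')
  | next hb hd _ ih => exact .next hb (by simp only [Frag.iter]; rw [hd]) (ih h' hx)

/-- The machine that runs a fragment with two exits and accepts if it leaves through `true`. -/
def toMachine (F : Frag α k Bool) : Machine α where
  Q := F.Q ⊕ Bool
  finQ := by
    have := F.finQ
    infer_instance
  B := Cell
  finB := inferInstance
  blank := Cell.blank
  k := k
  start := Sum.inl F.start
  accept := {Sum.inr true}
  δ := fun q x v => match q with
    | .inl q => some (F.δ q x v)
    | .inr _ => none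

/-- The initial configuration. -/
def _root_.FOModelChecking.Conf.blank (k : ℕ) : Conf k := ⟨0, fun _ _ => Cell.blank, fun _ => 0⟩

/-- `Runs` bounds the head positions before each step, so only the final configuration needs a
separate hypothesis. Since the step function is deterministic, every reachable configuration lies on
the run. -/
theorem Runs.toMachine {F : Frag α k Bool} {q : F.Q} {c d : Conf k} {e : Bool}
    (h : F.Runs w s q c e d) :
    StateTransition.Reaches (F.toMachine.step w) ⟨Sum.inl q, c.inPos, c.tape, c.pos⟩
      ⟨Sum.inr e, d.inPos, d.tape, d.pos⟩ ∧
    ((∀ i, d.pos i < s) → ∀ x, StateTransition.Reaches (F.toMachine.step w)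
      ⟨Sum.inl q, c.inPos, c.tape, c.pos⟩ x → ∀ i, x.pos i < s) := by
  induction h with
  | @exit q c e a hb hd =>
    have hs : F.toMachine.step w ⟨Sum.inl q, c.inPos, c.tape, c.pos⟩ =
        some ⟨Sum.inr e, (c.next w a).inPos, (c.next w a).tape, (c.next w a).pos⟩ := by
      have hd' : F.δ q (inputCell w c.inPos) (fun i => c.tape i (c.pos i)) = (Sum.inr e, a) := hd
      simp only [Machine.step, Frag.toMachine]
      rw [hd']
      rfl
    refine ⟨Relation.ReflTransGen.single hs, fun hd x hx => ?_⟩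
    rcases Relation.ReflTransGen.cases_head hx with rfl | ⟨y, hy, hyx⟩
    · exact hb
    · have : y = _ := Option.some.inj ((Option.mem_def.1 hy).symm.trans hs)
      subst this
      rcases Relation.ReflTransGen.cases_head hyx with rfl | ⟨z, hz, -⟩
      · exact hd
      · exact absurd hz (Option.not_mem_none z)
  | @next q c q' a e d hb hd _ ih =>
    have hs : F.toMachine.step w ⟨Sum.inl q, c.inPos, c.tape, c.pos⟩ =
        some ⟨Sum.inl q', (c.next w a).inPos, (c.next w a).tape, (c.next w a).pos⟩ := by
      have hd' : F.δ q (inputCell w c.inPos) (fun i => c.tape i (c.pos i)) = (Sum.inl q', a) := hd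
      simp only [Machine.step, Frag.toMachine]
      rw [hd']
      rfl
    refine ⟨Relation.ReflTransGen.head hs ih.1, fun hd x hx => ?_⟩
    rcases Relation.ReflTransGen.cases_head hx with rfl | ⟨y, hy, hyx⟩
    · exact hb
    · have : y = _ := Option.some.inj ((Option.mem_def.1 hy).symm.trans hs)
      subst this
      exact ih.2 hd x hyx

end Frag

/-! ### Numbers on the work tapes -/

/-- The tape contents: a mark, then the digits of the columns, least significant first. -/
def tapeOf (cols : List (Fin k → Bool)) (i : Fin k) : ℕ → Cell
  | 0 => Cell.mark
  | c + 1 => match cols[c]? with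
    | some v => Cell.digit (v i)
    | none => Cell.blank

theorem tapeOf_append_cons (pre suf : List (Fin k → Bool)) (v : Fin k → Bool) (i : Fin k) :
    tapeOf (pre ++ v :: suf) i (pre.length + 1) = Cell.digit (v i) := by
  simp [tapeOf]

theorem tapeOf_end (cols : List (Fin k → Bool)) (i : Fin k) :
    tapeOf cols i (cols.length + 1) = Cell.blank := by
  simp [tapeOf]

theorem update_tapeOf (pre suf : List (Fin k → Bool)) (v o : Fin k → Bool) (i : Fin k) :
    Function.update (tapeOf (pre ++ v :: suf) i) (pre.length + 1) (Cell.digit (o i)) =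
      tapeOf (pre ++ o :: suf) i := by
  funext c
  rcases eq_or_ne c (pre.length + 1) with rfl | h
  · simp [tapeOf]
  · rw [Function.update_of_ne h]
    cases c with
    | zero => rfl
    | succ c =>
      have : c ≠ pre.length := by omega
      simp only [tapeOf]
      rcases lt_or_gt_of_ne this with h | h
      · rw [List.getElem?_append_left h, List.getElem?_append_left h]
      · rw [List.getElem?_append_right h.le, List.getElem?_append_right h.le]
        obtain ⟨d, hd⟩ : ∃ d, c - pre.length = d + 1 := ⟨c - pre.length - 1, by omega⟩
        simp [hd]

theorem update_tapeOf_end (pre : List (Fin k → Bool)) (o : Fin k → Bool) (i : Fin k) :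
    Function.update (tapeOf pre i) (pre.length + 1) (Cell.digit (o i)) =
      tapeOf (pre ++ [o]) i := by
  funext c
  rcases eq_or_ne c (pre.length + 1) with rfl | h
  · simp [tapeOf]
  · rw [Function.update_of_ne h]
    cases c with
    | zero => rfl
    | succ c =>
      have : c ≠ pre.length := by omega
      simp only [tapeOf]
      rcases lt_or_gt_of_ne this with h | h
      · rw [List.getElem?_append_left h]
      · rw [List.getElem?_eq_none h.le, List.getElem?_eq_none (by simp; omega)]

/-- A transducer that reads the digit columns from the least significant one. -/
structure Sweep (k : ℕ) (E : Type) where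
  S : Type
  finS : Finite S
  start : S
  step : S → (Fin k → Bool) → S × (Fin k → Bool)
  out : S → E
  ext : S → Option (Fin k → Bool)

namespace Sweep

/-- The final state and the list of columns written. -/
def run (T : Sweep k E) : T.S → List (Fin k → Bool) → T.S × List (Fin k → Bool)
  | s, [] => (s, [])
  | s, v :: l => ((T.run (T.step s v).1 l).1, (T.step s v).2 :: (T.run (T.step s v).1 l).2)

/-- The columns after the sweep. -/
def result (T : Sweep k E) (cols : List (Fin k → Bool)) : List (Fin k → Bool) :=
  (T.run T.start cols).2 ++ (T.ext (T.run T.start cols).1).toList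

theorem length_run (T : Sweep k E) (s : T.S) (l : List (Fin k → Bool)) :
    (T.run s l).2.length = l.length := by
  induction l generalizing s with
  | nil => rfl
  | cons v l ih => simp [run, ih]

variable (α) in
/-- The fragment that performs a sweep. -/
def frag [NeZero k] [Finite E] (T : Sweep k E) : Frag α k E where
  Q := Option (T.S ⊕ E)
  finQ := by
    have := T.finS
    infer_instance
  start := none
  δ := fun q _ v => match q with
    | none => (.inl (some (.inl T.start)), .stay, fun i => (v i, .right))
    | some (.inl s) =>
      -- All heads move in lockstep over rows of equal length, so tape 0 alone shows where the
      -- digits end, and likewise where the mark is on the way back.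
      if v 0 = Cell.blank then
        match T.ext s with
        | none => (.inl (some (.inr (T.out s))), .stay, fun i => (v i, .left))
        | some o => (.inl (some (.inr (T.out s))), .stay, fun i => (Cell.digit (o i), .left))
      else
        let r := T.step s fun i => (v i).bit
        (.inl (some (.inl r.1)), .stay, fun i => (Cell.digit (r.2 i), .right))
    | some (.inr e) =>
      if v 0 = Cell.mark then (.inr e, .stay, fun i => (v i, .stay))
      else (.inl (some (.inr e)), .stay, fun i => (v i, .left))

variable [NeZero k] [Finite E] (T : Sweep k E) {w : List α} {s p : ℕ}

theorem runs_back (hp : p ≤ w.length + 1) (cols : List (Fin k → Bool)) (e : E) (c : ℕ)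
    (hc : c ≤ cols.length) (hs : c < s) :
    (T.frag α).Runs w s (some (.inr e)) ⟨p, tapeOf cols, fun _ => c⟩ e
      ⟨p, tapeOf cols, fun _ => 0⟩ := by
  induction c with
  | zero =>
    have := Frag.Runs.exit (F := T.frag α) (w := w) (s := s) (q := some (.inr e))
      (c := ⟨p, tapeOf cols, fun _ => 0⟩) (e := e) (a := (.stay, fun i => (.mark, .stay)))
      (fun _ => hs) (by simp [frag, Conf.read, tapeOf])
    convert this using 1
    ext1
    · simp [Conf.next, Move.apply, hp]
    · funext i
      exact (Function.update_eq_self 0 (tapeOf cols i)).symm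
    · simp [Conf.next, Move.apply]
  | succ c ih =>
    refine .next (q' := some (.inr e)) (a := (.stay, fun i => (tapeOf cols i (c + 1), .left)))
      (fun _ => hs) ?_ ?_
    · have : tapeOf cols 0 (c + 1) ≠ Cell.mark := by
        simp only [tapeOf]
        split <;> simp
      simp [frag, Conf.read, this]
    · convert ih (by omega) (by omega) using 1
      ext1
      · simp [Conf.next, Move.apply, hp]
      · funext i
        exact Function.update_eq_self _ _
      · simp [Conf.next, Move.apply]

/-- The induction moves columns from the unread part `suf` to the rewritten part `pre`. The heads
get as far as the cell after the last column, whence the `+ 1` in the space bound. -/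
theorem runs_fwd (hp : p ≤ w.length + 1) (suf : List (Fin k → Bool)) :
    ∀ (pre : List (Fin k → Bool)) (σ : T.S), pre.length + suf.length + 1 < s →
    (T.frag α).Runs w s (some (.inl σ))
      ⟨p, tapeOf (pre ++ suf), fun _ => pre.length + 1⟩ (T.out (T.run σ suf).1)
      ⟨p, tapeOf (pre ++ (T.run σ suf).2 ++ (T.ext (T.run σ suf).1).toList), fun _ => 0⟩ := by
  induction suf with
  | nil =>
    intro pre σ hs
    simp only [run, List.append_nil]
    simp only [List.length_nil, Nat.add_zero] at hs
    rcases hx : T.ext σ with _ | o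
    · refine .next (q' := some (.inr (T.out σ)))
        (a := (.stay, fun i => (tapeOf pre i (pre.length + 1), .left))) (fun _ => hs) ?_ ?_
      · simp [frag, Conf.read, tapeOf_end, hx]
      · convert T.runs_back (w := w) (s := s) hp pre (T.out σ) pre.length le_rfl (by omega) using 1
        · ext1
          · simp [Conf.next, Move.apply, hp]
          · funext i
            exact Function.update_eq_self _ _
          · simp [Conf.next, Move.apply]
        · simp
    · refine .next (q' := some (.inr (T.out σ)))
        (a := (.stay, fun i => (Cell.digit (o i), .left))) (fun _ => hs) ?_ ?_
      · simp [frag, Conf.read, tapeOf_end, hx]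
      · convert T.runs_back (w := w) (s := s) hp (pre ++ [o]) (T.out σ) pre.length (by simp)
          (by omega) using 1
        · ext1
          · simp [Conf.next, Move.apply, hp]
          · funext i
            exact update_tapeOf_end _ _ _
          · simp [Conf.next, Move.apply]
        · simp
  | cons v suf ih =>
    intro pre σ hs
    simp only [List.length_cons] at hs
    refine .next (q' := some (.inl (T.step σ v).1))
        (a := (.stay, fun i => (Cell.digit ((T.step σ v).2 i), .right))) (fun _ => ?_) ?_ ?_
    · show pre.length + 1 < s
      omega
    · simp [frag, Conf.read, tapeOf_append_cons, Cell.bit]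
    · convert ih (pre ++ [(T.step σ v).2]) (T.step σ v).1 (by simp; omega) using 1
      · ext1
        · simp [Conf.next, Move.apply, hp]
        · funext i
          simpa [Conf.next] using update_tapeOf pre suf v (T.step σ v).2 i
        · simp [Conf.next, Move.apply]
      · simp only [run]
      · simp [run]

theorem runs (hp : p ≤ w.length + 1) (cols : List (Fin k → Bool)) (hs : cols.length + 1 < s) :
    (T.frag α).Runs w s (T.frag α).start ⟨p, tapeOf cols, fun _ => 0⟩
      (T.out (T.run T.start cols).1) ⟨p, tapeOf (T.result cols), fun _ => 0⟩ := by
  refine .next (q' := some (.inl T.start)) (a := (.stay, fun i => (.mark, .right)))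
    (fun _ => ?_) ?_ ?_
  · show 0 < s
    omega
  · simp [frag, Conf.read, tapeOf]
  · convert T.runs_fwd hp cols [] T.start (by simpa using hs) using 1
    · ext1
      · simp [Conf.next, Move.apply, hp]
      · funext i
        exact Function.update_eq_self 0 (tapeOf cols i)
      · simp [Conf.next, Move.apply]
    · rfl

end Sweep

end FOModelChecking

/-! ### Registers and specifications of fragments -/

namespace FOModelChecking

variable {α : Type} {k : ℕ} {E E' : Type}

/-- The number whose binary digits are in row `i`. -/
def val (i : Fin k) : List (Fin k → Bool) → ℕ
  | [] => 0
  | v :: l => 2 * val i l + (v i).toNat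

theorem val_append_singleton (i : Fin k) (l : List (Fin k → Bool)) (v : Fin k → Bool) :
    val i (l ++ [v]) = val i l + 2 ^ l.length * (v i).toNat := by
  induction l with
  | nil => simp [val]
  | cons u l ih => simp only [List.cons_append, val, ih, List.length_cons, pow_succ]; ring

/-- The configuration `c` has the input head on cell `p` and the number `r i` on tape `i`. -/
def Repr (w : List α) (p : ℕ) (r : ℕ → ℕ) (c : Conf k) : Prop :=
  p ≤ w.length + 1 ∧ ∃ cols : List (Fin k → Bool),
    -- The number of binary digits of `|w| + 1`, the largest value that is ever stored.
    cols.length ≤ Nat.log 2 (w.length + 1) + 1 ∧ (∀ i, val i cols = r i) ∧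
      c = ⟨p, tapeOf cols, fun _ => 0⟩

namespace Frag

/-- Started with input head position `p` and registers `r`, the fragment leaves through `e` with
input head position `p'` and registers `r'`. -/
def Spec (F : Frag α k E) (w : List α) (p : ℕ) (r : ℕ → ℕ) (e : E) (p' : ℕ) (r' : ℕ → ℕ) : Prop :=
  -- Two cells more than the digits need: cell 0 with the mark, and the blank cell where a sweep
  -- notices the end.
  ∀ c, Repr w p r c → ∃ d, F.Runs w (Nat.log 2 (w.length + 1) + 3) F.start c e d ∧ Repr w p' r' d

variable {w : List α} {p p' p'' : ℕ} {r r' r'' : ℕ → ℕ} {e : E} {e' : E'}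

theorem Spec.bind [Finite E] {F : Frag α k E} {G : E → Frag α k E'} (h : F.Spec w p r e p' r')
    (h' : (G e).Spec w p' r' e' p'' r'') : (F.bind G).Spec w p r e' p'' r'' := by
  intro c hc
  obtain ⟨d, hd, hd'⟩ := h c hc
  obtain ⟨x, hx, hx'⟩ := h' d hd'
  exact ⟨x, hd.bind_left hx, hx'⟩

theorem Spec.iter_exit [Finite E] {F : E → Frag α k (E ⊕ E')}
    (h : (F e).Spec w p r (Sum.inr e') p' r') : (iter F e).Spec w p r e' p' r' := by
  intro c hc
  obtain ⟨d, hd, hd'⟩ := h c hc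
  exact ⟨d, hd.iter_exit e, hd'⟩

theorem Spec.iter_again [Finite E] {F : E → Frag α k (E ⊕ E')} {e₁ : E}
    (h : (F e).Spec w p r (Sum.inl e₁) p' r') (h' : (iter F e₁).Spec w p' r' e' p'' r'') :
    (iter F e).Spec w p r e' p'' r'' := by
  intro c hc
  obtain ⟨d, hd, hd'⟩ := h c hc
  obtain ⟨x, hx, hx'⟩ := h' d hd'
  exact ⟨x, hd.iter_again e hx, hx'⟩

/-- A single step that reads the input and moves the input head. -/
def inStep (g : InputCell α → E × Move) : Frag α k E where
  Q := Unit
  finQ := inferInstance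
  start := ()
  δ := fun _ x v => (.inr (g x).1, (g x).2, fun i => (v i, .stay))

theorem inStep_spec (g : InputCell α → E × Move) (w : List α) (p : ℕ) (r : ℕ → ℕ) :
    (inStep g : Frag α k E).Spec w p r (g (inputCell w p)).1
      (min ((g (inputCell w p)).2.apply p) (w.length + 1)) r := by
  rintro c ⟨hp, cols, hl, hv, rfl⟩
  refine ⟨_, Runs.exit (fun _ => ?_) rfl, min_le_right _ _, cols, hl, hv, ?_⟩
  · show 0 < _
    omega
  · ext1
    · rfl
    · funext i
      exact Function.update_eq_self _ _
    · rfl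

theorem inStep_spec_of_eq {g : InputCell α → E × Move} {m : Move}
    (hg : g (inputCell w p) = (e, m)) (hm : min (m.apply p) (w.length + 1) = p') :
    (inStep g : Frag α k E).Spec w p r e p' r := by
  have := inStep_spec (k := k) g w p r
  rwa [hg, hm] at this

/-- Leave through `e` without doing anything. -/
def pure (e : E) : Frag α k E := inStep fun _ => (e, .stay)

theorem pure_spec (e : E) (hp : p ≤ w.length + 1) : (pure e : Frag α k E).Spec w p r e p r := by
  have := inStep_spec (k := k) (fun _ : InputCell α => (e, Move.stay)) w p r
  rwa [show min (Move.stay.apply p) (w.length + 1) = p from min_eq_left hp] at this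

end Frag

/-! ### Elementary operations on registers -/

section Ops

variable {w : List α} {p : ℕ} {r r' : ℕ → ℕ}

/-- The hypothesis concerns every list of columns with the given row values, because leading zeros
give a number several representations. -/
theorem Sweep.spec [NeZero k] [Finite E] (T : Sweep k E) {e : E}
    (h : ∀ cols : List (Fin k → Bool), cols.length ≤ Nat.log 2 (w.length + 1) + 1 →
      (∀ i, val i cols = r i) → T.out (T.run T.start cols).1 = e ∧
        (T.result cols).length ≤ Nat.log 2 (w.length + 1) + 1 ∧
        ∀ i, val i (T.result cols) = r' i) :
    (T.frag α).Spec w p r e p r' := by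
  rintro c ⟨hp, cols, hl, hv, rfl⟩
  obtain ⟨rfl, hl', hv'⟩ := h cols hl hv
  exact ⟨_, T.runs hp cols (by omega), hp, _, hl', hv', rfl⟩

/-- A sweep that replaces row `d` by a function of the columns. -/
def mapSweep (d : Fin k) (g : (Fin k → Bool) → Bool) : Sweep k Unit where
  S := Unit
  finS := inferInstance
  start := ()
  step := fun _ v => ((), Function.update v d (g v))
  out := fun _ => ()
  ext := fun _ => none

theorem run_mapSweep (d : Fin k) (g : (Fin k → Bool) → Bool) (s : (mapSweep d g).S)
    (cols : List (Fin k → Bool)) :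
    ((mapSweep d g).run s cols).2 = cols.map fun v => Function.update v d (g v) := by
  induction cols generalizing s with
  | nil => rfl
  | cons v l ih => exact congrArg₂ List.cons rfl (ih _)

theorem mapSweep_spec [NeZero k] (d : Fin k) (g : (Fin k → Bool) → Bool) (x : ℕ)
    (hx : ∀ cols : List (Fin k → Bool), (∀ i, val i cols = r i) →
      val d (cols.map fun v => Function.update v d (g v)) = x) :
    ((mapSweep d g).frag α).Spec w p r () p (Function.update r d x) := by
  refine Sweep.spec _ fun cols hl hv => ⟨rfl, ?_, fun i => ?_⟩
  · simp only [Sweep.result, run_mapSweep]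
    simpa [mapSweep] using hl
  · simp only [Sweep.result, run_mapSweep]
    simp only [mapSweep, Option.toList_none, List.append_nil]
    rcases eq_or_ne i d with rfl | hi
    · simpa using hx cols hv
    · rw [Function.update_of_ne (by simpa [Fin.val_inj] using hi), ← hv i]
      clear hl hv
      induction cols with
      | nil => rfl
      | cons v l ih => simp [val, ih, Function.update_of_ne hi]

variable (α) in
/-- Set register `d` to zero. -/
def zeroReg [NeZero k] (d : Fin k) : Frag α k Unit := (mapSweep d fun _ => false).frag α

variable (α) in
/-- Copy register `s` to register `d`. -/
def copyReg [NeZero k] (d s : Fin k) : Frag α k Unit := (mapSweep d fun v => v s).frag α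

theorem zeroReg_spec [NeZero k] (d : Fin k) :
    (zeroReg α d).Spec w p r () p (Function.update r d 0) := by
  refine mapSweep_spec _ _ _ fun cols hv => ?_
  clear hv
  induction cols with
  | nil => rfl
  | cons v l ih => simp_all [val]

theorem copyReg_spec [NeZero k] (d s : Fin k) :
    (copyReg α d s).Spec w p r () p (Function.update r d (r s)) := by
  refine mapSweep_spec _ _ _ fun cols hv => ?_
  rw [← hv s]
  clear hv
  induction cols with
  | nil => rfl
  | cons v l ih => simp_all [val]

/-- The sweep that increments register `d`. -/
def incSweep (d : Fin k) : Sweep k Unit where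
  S := Bool
  finS := inferInstance
  start := true
  step := fun c v => (c && v d, Function.update v d (xor c (v d)))
  out := fun _ => ()
  -- The state is the carry. If it survives the last column, a new column is opened, with digit 1 in
  -- row `d` and 0 in all other rows.
  ext := fun c => if c then some fun i => decide (i = d) else none

variable (α) in
/-- Increment register `d`. -/
def incReg [NeZero k] (d : Fin k) : Frag α k Unit := (incSweep d).frag α

/-- The invariant of ripple-carry addition: the carry that leaves the columns counts with weight `2
^ cols.length`. -/
theorem val_run_incSweep (d : Fin k) (cols : List (Fin k → Bool)) : ∀ c : Bool,
    val d ((incSweep d).run c cols).2 +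
      2 ^ cols.length * (show Bool from ((incSweep d).run c cols).1).toNat =
        val d cols + c.toNat := by
  induction cols with
  | nil => intro c; simp [Sweep.run, val]
  | cons v l ih =>
    intro c
    have := ih (c && v d)
    simp only [Sweep.run, val, List.length_cons, pow_succ] at this ⊢
    have h2 : ((incSweep d).step c v).1 = (c && v d) := rfl
    have h3 : ((incSweep d).step c v).2 = Function.update v d (xor c (v d)) := rfl
    rw [h2, h3, Function.update_self]
    have h4 : 2 * (c && v d).toNat + (xor c (v d)).toNat = (v d).toNat + c.toNat := by
      cases c <;> cases v d <;> rfl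
    linarith

theorem val_run_incSweep_of_ne {i d : Fin k} (hi : i ≠ d) (cols : List (Fin k → Bool)) :
    ∀ c, val i ((incSweep d).run c cols).2 = val i cols := by
  induction cols with
  | nil => intro c; rfl
  | cons v l ih =>
    intro c
    simp only [Sweep.run, val]
    rw [ih]
    simp [incSweep, Function.update_of_ne hi]

theorem incReg_spec [NeZero k] (d : Fin k) (hd : r d + 1 ≤ w.length + 1) :
    (incReg α d).Spec w p r () p (Function.update r d (r d + 1)) := by
  refine Sweep.spec _ fun cols hl hv => ⟨rfl, ?_⟩
  have h1 := val_run_incSweep d cols true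
  have h2 := fun i (hi : i ≠ d) => val_run_incSweep_of_ne hi cols true
  have h3 := (incSweep d).length_run true cols
  simp only [Sweep.result]
  rw [show (incSweep d).start = true from rfl]
  rw [hv d] at h1
  generalize (incSweep d).run true cols = x at *
  obtain ⟨c, l⟩ := x
  rcases c with _ | _
  · simp only [incSweep, Bool.false_eq_true, if_false, Option.toList_none, List.append_nil] at *
    refine ⟨by omega, fun i => ?_⟩
    rcases eq_or_ne i d with rfl | hi
    · simpa using h1
    · rw [Function.update_of_ne (by simpa [Fin.val_inj] using hi), ← hv i, h2 i hi]
  · simp only [incSweep, if_true, Option.toList_some, List.length_append, List.length_singleton,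
      Bool.toNat_true, mul_one, val_append_singleton] at *
    refine ⟨?_, fun i => ?_⟩
    -- An outgoing carry shows `2 ^ cols.length ≤ r d + 1 ≤ |w| + 1`, so there is room for one more
    -- column.
    · have : 2 ^ cols.length ≤ w.length + 1 := by omega
      have := Nat.le_log_of_pow_le (by norm_num) this
      omega
    · rcases eq_or_ne i d with rfl | hi
      · simp [h3, h1]
      · rw [Function.update_of_ne (by simpa [Fin.val_inj] using hi), ← hv i, h2 i hi]
        simp [hi]

/-- The sweep that compares two registers. -/
def leSweep (a b : Fin k) : Sweep k Bool where
  S := Bool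
  finS := inferInstance
  start := true
  -- Digits arrive least significant first, so a later column overrules the verdict so far whenever
  -- its two digits differ; the comparison then holds iff row `b` has the digit 1.
  step := fun c v => (if v a = v b then c else v b, v)
  out := fun c => c
  ext := fun _ => none

variable (α) in
/-- Is register `a` at most register `b`? -/
def leReg [NeZero k] (a b : Fin k) : Frag α k Bool := (leSweep a b).frag α

theorem le_two_mul_add_toNat (x y : ℕ) (a b c : Bool) :
    (if x = y then (if a = b then c else b) else decide (x ≤ y)) =
      if 2 * x + a.toNat = 2 * y + b.toNat then c
      else decide (2 * x + a.toNat ≤ 2 * y + b.toNat) := by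
  rcases lt_trichotomy x y with h | h | h <;> cases a <;> cases b <;> simp <;> grind

/-- `c` is the verdict on the columns already read; it counts only if the remaining, more
significant columns tie. -/
theorem run_leSweep (a b : Fin k) (cols : List (Fin k → Bool)) : ∀ c : Bool,
    (leSweep a b).run c cols = ((if val a cols = val b cols then c else
      decide (val a cols ≤ val b cols) : Bool), cols) := by
  induction cols with
  | nil => intro c; rfl
  | cons v l ih =>
    intro c
    have h : (leSweep a b).step c v = ((if v a = v b then c else v b : Bool), v) := rfl
    simp only [Sweep.run, h]
    rw [ih]
    refine congrArg (fun c : Bool => (c, v :: l)) ?_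
    exact le_two_mul_add_toNat _ _ _ _ _

theorem leReg_spec [NeZero k] (a b : Fin k) :
    (leReg α a b).Spec w p r (decide (r a ≤ r b)) p r := by
  refine Sweep.spec _ fun cols hl hv => ?_
  have h := run_leSweep a b cols true
  have hs : (leSweep a b).start = true := rfl
  simp only [Sweep.result, hs, h]
  refine ⟨?_, by simpa [leSweep] using hl, by simpa [leSweep] using hv⟩
  simp only [leSweep, hv]
  grind

end Ops

namespace Frag

variable {w : List α} {p : ℕ} {r : ℕ → ℕ}

/-- Move the input head to the left end marker. -/
def rewind : Frag α k Unit :=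
  iter (fun _ : Unit => inStep fun x => match x with
    | .leftEnd => (.inr (), .stay)
    | _ => (.inl (), .left)) ()

theorem inputCell_succ (w : List α) (p : ℕ) : inputCell w (p + 1) =
    match w[p]? with
    | some a => InputCell.letter a
    | none => InputCell.rightEnd := rfl

theorem rewind_spec (hp : p ≤ w.length + 1) : (rewind : Frag α k Unit).Spec w p r () 0 r := by
  induction p with
  | zero => exact Spec.iter_exit (inStep_spec_of_eq rfl rfl)
  | succ p ih =>
    refine Spec.iter_again (e₁ := ()) (p' := p) (r' := r) ?_ (ih (by omega))
    refine inStep_spec_of_eq (m := .left) ?_ ?_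
    · rw [inputCell_succ]
      rcases w[p]? with _ | a <;> rfl
    · show min (p + 1 - 1) _ = p
      omega

end Frag

end FOModelChecking

/-! ### Functions computed with boundedly many registers -/

namespace FOModelChecking

variable {α : Type} {k m : ℕ} {E E' : Type}

/-- `f` is computed by machine fragments that use a bounded number of registers. The arguments of
`f` may be in arbitrary registers below `b`, and all registers below `b` are preserved. The first
component of the value of `f` determines the exit, the second one is left in register `b`. -/
def Comp (f : List α → (Fin m → ℕ) → E × ℕ) : Prop :=
  ∃ c, ∀ (k : ℕ) [NeZero k] (a : Fin m → ℕ) (b : ℕ), (∀ i, a i < b) → b + c < k →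
    ∃ F : Frag α k E, ∀ (w : List α) (r : ℕ → ℕ), (∀ i, r i ≤ w.length + 1) →
      ∃ r' : ℕ → ℕ, F.Spec w 0 r (f w (r ∘ a)).1 0 r' ∧ (∀ i, r' i ≤ w.length + 1) ∧
        (∀ i < b, r' i = r i) ∧ r' b = (f w (r ∘ a)).2

theorem update_le {r : ℕ → ℕ} {n x : ℕ} (h : ∀ i, r i ≤ n) (hx : x ≤ n) (b : ℕ) :
    ∀ i, Function.update r b x i ≤ n := by
  intro i
  rcases eq_or_ne i b with rfl | hi
  · simpa using hx
  · simpa [hi] using h i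

theorem comp_cons (r : ℕ → ℕ) (x : ℕ) (a : Fin m → ℕ) :
    r ∘ (Fin.cons x a : Fin (m + 1) → ℕ) = (Fin.cons (r x) (r ∘ a) : Fin (m + 1) → ℕ) := by
  funext i
  refine Fin.cases rfl (fun i => rfl) i

theorem comp_eq {r r' : ℕ → ℕ} {a : Fin m → ℕ} {b : ℕ} (ha : ∀ i, a i < b)
    (h : ∀ i < b, r' i = r i) : r' ∘ a = r ∘ a :=
  funext fun i => h _ (ha i)

section
variable [NeZero k] {w : List α} {p : ℕ} {r : ℕ → ℕ}

theorem leReg_spec_true {a b : Fin k} (h : r a ≤ r b) : (leReg α a b).Spec w p r true p r := by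
  simpa [h] using leReg_spec (w := w) (p := p) (r := r) a b

theorem leReg_spec_false {a b : Fin k} (h : r b < r a) : (leReg α a b).Spec w p r false p r := by
  simpa [h.not_ge] using leReg_spec (w := w) (p := p) (r := r) a b

end

instance [Finite α] : Finite (InputCell α) :=
  Finite.of_injective (β := Option (Option α))
    (fun c => match c with
      | .leftEnd => none
      | .rightEnd => some none
      | .letter a => some (some a))
    (by intro a b; cases a <;> cases b <;> simp)

namespace Comp

theorem ret (e : E) : Comp fun (_ : List α) (_ : Fin m → ℕ) => (e, 0) := by
  refine ⟨0, fun k _ a b _ hk => ⟨(zeroReg α ⟨b, hk⟩).bind fun _ => .pure e, fun w r hr => ?_⟩⟩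
  refine ⟨Function.update r b 0, ?_, update_le hr (Nat.zero_le _) b, fun i hi => ?_, by simp⟩
  · exact (zeroReg_spec ⟨b, hk⟩).bind (Frag.pure_spec e (Nat.zero_le _))
  · simp [hi.ne]

theorem proj (e : E) (i : Fin m) : Comp fun (_ : List α) (ρ : Fin m → ℕ) => (e, ρ i) := by
  refine ⟨0, fun k _ a b ha hk => ⟨(copyReg α ⟨b, hk⟩ ⟨a i, (ha i).trans hk⟩).bind
    fun _ => .pure e, fun w r hr => ?_⟩⟩
  refine ⟨Function.update r b (r (a i)), ?_, update_le hr (hr _) b, fun i hi => ?_, by simp⟩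
  · exact (copyReg_spec ⟨b, hk⟩ _).bind (Frag.pure_spec e (Nat.zero_le _))
  · simp [hi.ne]

theorem rename {n : ℕ} {f : List α → (Fin n → ℕ) → E × ℕ} (hf : Comp f) (σ : Fin n → Fin m) :
    Comp fun w (ρ : Fin m → ℕ) => f w (ρ ∘ σ) := by
  obtain ⟨c, hc⟩ := hf
  exact ⟨c, fun k _ a b ha hk => hc k (a ∘ σ) b (fun i => ha _) hk⟩

/-- `f` leaves its value in register `b`; `g` takes this as an additional argument and leaves its
own value in `b + 1`, from where it is copied down to `b`. -/
theorem bind [Finite E] [Finite E'] {f : List α → (Fin m → ℕ) → E × ℕ}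
    {g : E → List α → (Fin (m + 1) → ℕ) → E' × ℕ} (hf : Comp f) (hg : ∀ e, Comp (g e)) :
    Comp fun w ρ => g (f w ρ).1 w (Fin.cons (f w ρ).2 ρ) := by
  obtain ⟨c, hc⟩ := hf
  choose d hd using hg
  -- The continuations may need different numbers of registers; since `E` is finite, one bound
  -- serves them all.
  obtain ⟨D, hD⟩ := Set.finite_range d |>.bddAbove
  have hD : ∀ e, d e ≤ D := fun e => hD ⟨e, rfl⟩
  refine ⟨c + D + 1, fun k _ a b ha hk => ?_⟩
  obtain ⟨F, hF⟩ := hc k a b ha (by omega)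
  have ha' : ∀ i, (Fin.cons b a : Fin (m + 1) → ℕ) i < b + 1 := by
    refine Fin.cases (by simp) fun i => ?_
    have := ha i
    simp only [Fin.cons_succ]
    omega
  have : ∀ e, b + 1 + d e < k := fun e => by have := hD e; omega
  choose G hG using fun e => hd e k (Fin.cons b a) (b + 1) ha' (this e)
  refine ⟨F.bind fun e => (G e).bind fun e' =>
    (copyReg α ⟨b, by omega⟩ ⟨b + 1, by omega⟩).bind fun _ => .pure e', fun w r hr => ?_⟩
  obtain ⟨r', hr', hv', hb', hx'⟩ := hF w r hr
  obtain ⟨r'', hr'', hv'', hb'', hx''⟩ := hG (f w (r ∘ a)).1 w r' hv'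
  rw [comp_cons, comp_eq ha hb', hx'] at hr'' hx''
  refine ⟨_, hr'.bind (hr''.bind ((copyReg_spec _ _).bind (Frag.pure_spec _ (Nat.zero_le _)))),
    update_le hv'' (hv'' _) b, fun i hi => ?_, ?_⟩
  · rw [Function.update_of_ne hi.ne, hb'' i (by omega), hb' i hi]
  · simp only [Function.update_self]
    exact hx''

/-- Random access to the input: the head walks to the right while register `b` counts the moves,
until the address is reached. The content found there is remembered in the exit, and the head is
rewound. -/
theorem inputCell [Finite α] :
    Comp fun (w : List α) (ρ : Fin 1 → ℕ) => (inputCell w (ρ 0), 0) := by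
  refine ⟨0, fun k _ a b ha hk => ?_⟩
  let body : Unit → Frag α k (Unit ⊕ InputCell α) := fun _ =>
    (leReg α ⟨a 0, (ha 0).trans hk⟩ ⟨b, hk⟩).bind fun c => match c with
      | true => (Frag.inStep fun x => (x, .stay)).bind fun x => Frag.rewind.bind fun _ =>
          .pure (.inr x)
      | false => (incReg α ⟨b, hk⟩).bind fun _ => Frag.inStep fun _ => (.inl (), .right)
  refine ⟨(zeroReg α ⟨b, hk⟩).bind fun _ => (Frag.iter body ()).bind fun x =>
    (zeroReg α ⟨b, hk⟩).bind fun _ => .pure x, fun w r hr => ?_⟩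
  -- `t` is both the head position and the counter, `d` the number of moves still to be made.
  have key : ∀ d t, t + d = r (a 0) →
      (Frag.iter body ()).Spec w t (Function.update r b t)
        (FOModelChecking.inputCell w (r (a 0))) 0 (Function.update r b (r (a 0))) := by
    intro d
    induction d with
    | zero =>
      rintro t rfl
      apply Frag.Spec.iter_exit
      refine Frag.Spec.bind (e := true) (leReg_spec_true ?_) ?_
      · simp [(ha 0).ne]
      · refine Frag.Spec.bind (Frag.inStep_spec_of_eq (m := .stay) (p' := r (a 0)) rfl ?_)
          ((Frag.rewind_spec (hr _)).bind (Frag.pure_spec _ (Nat.zero_le _)))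
        exact min_eq_left (hr _)
    | succ d ih =>
      intro t ht
      have hN := hr (a 0)
      refine Frag.Spec.iter_again (e₁ := ()) (p' := t + 1) ?_ (ih (t + 1) (by omega))
      refine Frag.Spec.bind (e := false) (leReg_spec_false ?_) ?_
      · simp only [Function.update_self]
        rw [Function.update_of_ne (ha 0).ne]
        omega
      · refine (incReg_spec ⟨b, hk⟩ ?_).bind ?_
        · simp only [Function.update_self]
          omega
        · simp only [Function.update_self, Function.update_idem]
          exact Frag.inStep_spec_of_eq (m := .right) rfl
            (min_eq_left (show t + 1 ≤ _ by omega))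
  refine ⟨Function.update r b 0, ?_, update_le hr (Nat.zero_le _) b, fun i hi => ?_, by simp⟩
  · have h0 : Function.update r b 0 =
        Function.update (Function.update r b (r (a 0))) b 0 := by simp
    rw [h0]
    exact (zeroReg_spec ⟨b, hk⟩).bind ((key _ 0 (Nat.zero_add _)).bind
      ((zeroReg_spec ⟨b, hk⟩).bind (Frag.pure_spec _ (Nat.zero_le _))))
  · simp [hi.ne]

/-- The position of the right end marker. -/
theorem lengthSucc :
    Comp fun (w : List α) (_ : Fin m → ℕ) => ((), w.length + 1) := by
  refine ⟨0, fun k _ a b ha hk => ?_⟩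
  let body : Unit → Frag α k (Unit ⊕ Unit) := fun _ =>
    (Frag.inStep fun x => match x with
      | .rightEnd => (true, .stay)
      | _ => (false, .right)).bind fun c => match c with
      | true => .pure (.inr ())
      | false => (incReg α ⟨b, hk⟩).bind fun _ => .pure (.inl ())
  refine ⟨(zeroReg α ⟨b, hk⟩).bind fun _ => (Frag.iter body ()).bind fun _ => Frag.rewind,
    fun w r hr => ?_⟩
  have key : ∀ d t, t + d = w.length + 1 →
      (Frag.iter body ()).Spec w t (Function.update r b t) () (w.length + 1)
        (Function.update r b (w.length + 1)) := by
    intro d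
    induction d with
    | zero =>
      rintro t rfl
      apply Frag.Spec.iter_exit
      refine Frag.Spec.bind (e := true) (Frag.inStep_spec_of_eq (m := .stay) ?_ (min_eq_left ?_))
        (Frag.pure_spec _ le_rfl)
      · simp [Frag.inputCell_succ]
      · exact le_rfl
    | succ d ih =>
      intro t ht
      refine Frag.Spec.iter_again (e₁ := ()) (p' := t + 1) ?_ (ih (t + 1) (by omega))
      refine Frag.Spec.bind (e := false)
        (Frag.inStep_spec_of_eq (m := .right) ?_ (min_eq_left (show t + 1 ≤ _ by omega))) ?_
      · cases t with
        | zero => rfl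
        | succ t =>
          have : t < w.length := by omega
          simp [Frag.inputCell_succ, this]
      · have h := (incReg_spec (α := α) (w := w) (p := t + 1) (r := Function.update r b t)
          ⟨b, hk⟩ (by simp only [Function.update_self]; omega)).bind
          (G := fun _ => Frag.pure (Sum.inl () : Unit ⊕ Unit)) (Frag.pure_spec _ (by omega))
        simp only [Function.update_self, Function.update_idem] at h
        exact h
  refine ⟨Function.update r b (w.length + 1), ?_, update_le hr le_rfl b, fun i hi => ?_, by simp⟩
  · exact (zeroReg_spec ⟨b, hk⟩).bind ((key _ 0 (Nat.zero_add _)).bind (Frag.rewind_spec le_rfl))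
  · simp [hi.ne]

theorem le : Comp fun (_ : List α) (ρ : Fin 2 → ℕ) => (decide (ρ 0 ≤ ρ 1), 0) := by
  refine ⟨0, fun k _ a b ha hk => ?_⟩
  refine ⟨(zeroReg α ⟨b, hk⟩).bind fun _ =>
    leReg α ⟨a 0, (ha 0).trans hk⟩ ⟨a 1, (ha 1).trans hk⟩, fun w r hr => ?_⟩
  refine ⟨Function.update r b 0, ?_, update_le hr (Nat.zero_le _) b, fun i hi => ?_, by simp⟩
  · have h := (zeroReg_spec (α := α) (w := w) (p := 0) (r := r) ⟨b, hk⟩).bind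
      (G := fun _ => leReg α ⟨a 0, (ha 0).trans hk⟩ ⟨a 1, (ha 1).trans hk⟩) (leReg_spec _ _)
    simpa [(ha 0).ne, (ha 1).ne] using h
  · simp [hi.ne]

theorem ite [Finite E] {f : List α → (Fin m → ℕ) → Bool × ℕ}
    {g h : List α → (Fin m → ℕ) → E × ℕ} (hf : Comp f) (hg : Comp g) (hh : Comp h) :
    Comp fun w ρ => if (f w ρ).1 then g w ρ else h w ρ := by
  have := hf.bind (g := fun c w ρ => if c then g w (ρ ∘ Fin.succ) else h w (ρ ∘ Fin.succ)) (by
    intro c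
    cases c
    · exact hh.rename _
    · exact hg.rename _)
  convert this using 3
  rfl

/-- The successor of a position, which does not go beyond the right end marker. -/
theorem succ :
    Comp fun (w : List α) (ρ : Fin 1 → ℕ) => ((), min (ρ 0 + 1) (w.length + 1)) := by
  -- The cap has to be tested before incrementing, since `incReg` works only for results up to `|w|
  -- + 1`.
  have h1 : Comp fun (w : List α) (ρ : Fin 1 → ℕ) => (decide (w.length + 1 ≤ ρ 0), 0) :=
    lengthSucc.bind fun _ => le.rename ![0, 1]
  obtain ⟨c, hc⟩ := h1
  refine ⟨c, fun k _ a b ha hk => ?_⟩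
  obtain ⟨F, hF⟩ := hc k a b ha hk
  have hb : b < k := by omega
  refine ⟨F.bind fun c => (copyReg α ⟨b, hb⟩ ⟨a 0, (ha 0).trans hb⟩).bind fun _ => match c with
    | true => .pure ()
    | false => incReg α ⟨b, hb⟩, fun w r hr => ?_⟩
  obtain ⟨r', hr', hv', hb', hx'⟩ := hF w r hr
  have ha0 : r' (a 0) = r (a 0) := hb' _ (ha 0)
  refine ⟨Function.update r' b (min (r (a 0) + 1) (w.length + 1)), hr'.bind ?_,
    update_le hv' (by omega) b, fun i hi => ?_, by simp⟩
  · refine (copyReg_spec ⟨b, hb⟩ ⟨a 0, (ha 0).trans hb⟩).bind ?_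
    have hle := hr (a 0)
    by_cases h : w.length + 1 ≤ r (a 0)
    · have : min (r (a 0) + 1) (w.length + 1) = r (a 0) := by omega
      simp only [Function.comp_apply, h, decide_true, this, ha0]
      exact Frag.pure_spec _ (Nat.zero_le _)
    · have : min (r (a 0) + 1) (w.length + 1) = r (a 0) + 1 := by omega
      simp only [Function.comp_apply, h, decide_false, this, ha0]
      have := incReg_spec (α := α) (w := w) (p := 0) (r := Function.update r' b (r (a 0))) ⟨b, hb⟩
        (by simp only [Function.update_self]; omega)
      simpa using this
  · rw [Function.update_of_ne hi.ne, hb' i hi]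

/-- Iteration of `h` with a counter. -/
def loopFn (h : E → List α → (Fin (m + 2) → ℕ) → E × ℕ) (w : List α) (ρ : Fin m → ℕ) (e : E)
    (x : ℕ) : ℕ → E × ℕ
  | 0 => (e, x)
  | t + 1 => h (loopFn h w ρ e x t).1 w (Fin.cons t (Fin.cons (loopFn h w ρ e x t).2 ρ))

/-- Register `b` holds the accumulator, `b + 1` the counter, and the body leaves its value in `b +
2`. The finite component of the accumulator is kept in the control of `Frag.iter`. -/
theorem loop [Finite E] {h : E → List α → (Fin (m + 2) → ℕ) → E × ℕ} (hh : ∀ e, Comp (h e))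
    (e₀ : E) (i j : Fin m) : Comp fun w ρ => loopFn h w ρ e₀ (ρ i) (ρ j) := by
  choose d hd using hh
  obtain ⟨D, hD⟩ := Set.finite_range d |>.bddAbove
  have hD : ∀ e, d e ≤ D := fun e => hD ⟨e, rfl⟩
  refine ⟨D + 2, fun k _ a b ha hk => ?_⟩
  have ha' : ∀ i, (Fin.cons (b + 1) (Fin.cons b a : Fin (m + 1) → ℕ) : Fin (m + 2) → ℕ) i
      < b + 2 := by
    refine Fin.cases (by simp) (Fin.cases (by simp) fun i => ?_)
    have := ha i
    simp only [Fin.cons_succ]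
    omega
  have hk' : ∀ e, b + 2 + d e < k := fun e => by have := hD e; omega
  choose H hH using fun e => hd e k _ (b + 2) ha' (hk' e)
  have hb : b < k := by omega
  have hb1 : b + 1 < k := by omega
  have hb2 : b + 2 < k := by omega
  let body : E → Frag α k (E ⊕ E) := fun e =>
    (leReg α ⟨a j, (ha j).trans hb⟩ ⟨b + 1, hb1⟩).bind fun c => match c with
      | true => .pure (.inr e)
      | false => (H e).bind fun e' => (copyReg α ⟨b, hb⟩ ⟨b + 2, hb2⟩).bind fun _ =>
          (incReg α ⟨b + 1, hb1⟩).bind fun _ => .pure (.inl e')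
  refine ⟨(copyReg α ⟨b, hb⟩ ⟨a i, (ha i).trans hb⟩).bind fun _ =>
    (zeroReg α ⟨b + 1, hb1⟩).bind fun _ => Frag.iter body e₀, fun w r hr => ?_⟩
  set L := loopFn h w (r ∘ a) e₀ (r (a i)) with hL
  have key : ∀ d t, t + d = r (a j) → ∀ r₁ : ℕ → ℕ, (∀ i, r₁ i ≤ w.length + 1) →
      (∀ i < b, r₁ i = r i) → r₁ b = (L t).2 → r₁ (b + 1) = t →
      ∃ r' : ℕ → ℕ, (Frag.iter body (L t).1).Spec w 0 r₁ (L (r (a j))).1 0 r' ∧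
        (∀ i, r' i ≤ w.length + 1) ∧ (∀ i < b, r' i = r i) ∧ r' b = (L (r (a j))).2 := by
    intro d
    induction d with
    | zero =>
      rintro t rfl r₁ hv₁ h₁ hx₁ ht₁
      refine ⟨r₁, Frag.Spec.iter_exit (Frag.Spec.bind (e := true) (leReg_spec_true ?_)
        (Frag.pure_spec _ (Nat.zero_le _))), hv₁, h₁, hx₁⟩
      simp only [ht₁, h₁ _ (ha j)]
      exact le_rfl
    | succ d ih =>
      intro t ht r₁ hv₁ h₁ hx₁ ht₁
      obtain ⟨r₂, hr₂, hv₂, hb₂, hx₂⟩ := hH (L t).1 w r₁ hv₁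
      rw [comp_cons, comp_cons, comp_eq ha h₁, hx₁, ht₁] at hr₂ hx₂
      change (H (L t).1).Spec w 0 r₁ (L (t + 1)).1 0 r₂ at hr₂
      change r₂ (b + 2) = (L (t + 1)).2 at hx₂
      have ht₂ : r₂ (b + 1) = t := by rw [hb₂ _ (by omega), ht₁]
      have hN := hr (a j)
      obtain ⟨r', hr', h'⟩ := ih (t + 1) (by omega)
        (Function.update (Function.update r₂ b (L (t + 1)).2) (b + 1) (t + 1))
        (update_le (update_le hv₂ (hx₂ ▸ hv₂ _) b) (by omega) _)
        (fun i hi => by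
          rw [Function.update_of_ne (by omega), Function.update_of_ne (by omega),
            hb₂ i (by omega), h₁ i hi])
        (by rw [Function.update_of_ne (by omega), Function.update_self])
        (by rw [Function.update_self])
      refine ⟨r', Frag.Spec.iter_again (Frag.Spec.bind (e := false) (leReg_spec_false ?_)
        (hr₂.bind ?_)) hr', h'⟩
      · simp only [ht₁, h₁ _ (ha j)]
        omega
      · have hc := copyReg_spec (α := α) (w := w) (p := 0) (r := r₂) ⟨b, hb⟩ ⟨b + 2, hb2⟩
        simp only [hx₂] at hc
        refine hc.bind ?_
        have hi := incReg_spec (α := α) (w := w) (p := 0)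
          (r := Function.update r₂ b (L (t + 1)).2) ⟨b + 1, hb1⟩ (by
            simp only
            rw [Function.update_of_ne (by omega)]
            omega)
        simp only at hi
        rw [Function.update_of_ne (by omega), ht₂] at hi
        exact hi.bind (Frag.pure_spec _ (Nat.zero_le _))
  obtain ⟨r', hr', h'⟩ := key (r (a j)) 0 (Nat.zero_add _)
    (Function.update (Function.update r b (r (a i))) (b + 1) 0)
    (update_le (update_le hr (hr _) b) (Nat.zero_le _) _)
    (fun i hi => by
      rw [Function.update_of_ne (by omega), Function.update_of_ne (by omega)])
    (by rw [Function.update_of_ne (by omega), Function.update_self]; rfl)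
    (by rw [Function.update_self])
  exact ⟨r', (copyReg_spec _ _).bind ((zeroReg_spec _).bind hr'), h'⟩

/-- A language is in Logspace if membership is computed by a fragment. -/
theorem inLogspace [Finite α] {P : List α → Bool} {L : Language α}
    (h : Comp fun w (_ : Fin 0 → ℕ) => (P w, 0)) (hL : ∀ w, P w = true ↔ w ∈ L) :
    InLogspace L := by
  obtain ⟨c, hc⟩ := h
  obtain ⟨F, hF⟩ := hc (c + 1) Fin.elim0 0 (fun i => i.elim0) (by omega)
  -- The work tapes are blank at the start. One step writes the marks, after which the empty list of
  -- columns represents zero in every register.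
  let initFrag : Frag α (c + 1) Unit := ⟨Unit, inferInstance, (),
    fun _ _ _ => (.inr (), .stay, fun _ => (.mark, .stay))⟩
  have key : ∀ w : List α, ∃ d, (initFrag.bind fun _ => F).Runs w (Nat.log 2 (w.length + 1) + 3)
      (initFrag.bind fun _ => F).start (Conf.blank _) (P w) d ∧ ∀ i, d.pos i = 0 := by
    intro w
    obtain ⟨r', hr', -⟩ := hF w (fun _ => 0) (fun _ => Nat.zero_le _)
    have h0 : initFrag.Runs w (Nat.log 2 (w.length + 1) + 3) () (Conf.blank _) ()
        ((Conf.blank _).next w (.stay, fun _ => (.mark, .stay))) :=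
      .exit (fun _ => by simp [Conf.blank]) rfl
    obtain ⟨d, hd, -, cols, -, -, rfl⟩ := hr' _
      (show Repr w 0 _ ((Conf.blank _).next w (.stay, fun _ => (.mark, .stay))) from by
        refine ⟨Nat.zero_le _, [], Nat.zero_le _, fun _ => rfl, ?_⟩
        ext1
        · simp [Conf.next, Conf.blank, Move.apply]
        · funext i n
          cases n <;> simp [Conf.next, Conf.blank, tapeOf, Function.update]
        · simp [Conf.next, Conf.blank, Move.apply])
    exact ⟨_, h0.bind_left hd, fun _ => rfl⟩
  -- The constant comes from `log (n + 1) + 3 ≤ log n + 4 ≤ 4 * (log n + 1)`.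
  refine ⟨(initFrag.bind fun _ => F).toMachine, fun w => ?_, 4, fun w => ?_⟩
  · obtain ⟨d, hd, -⟩ := key w
    refine ⟨_, hd.toMachine.1, rfl, ?_⟩
    rw [← hL w]
    exact ⟨fun h => Sum.inr.inj h, fun h => congrArg Sum.inr h⟩
  · obtain ⟨d, hd, hd0⟩ := key w
    intro x hx i
    have h1 := hd.toMachine.2 (fun i => by rw [hd0]; omega) x hx i
    refine h1.trans_le ?_
    have : Nat.log 2 (w.length + 1) ≤ Nat.log 2 w.length + 1 := by
      rcases Nat.eq_zero_or_pos w.length with h | h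
      · simp [h]
      · rw [← Nat.log_mul_base (by norm_num) h.ne']
        exact Nat.log_mono_right (by omega)
    omega

end Comp

end FOModelChecking

/-! ### Decidable predicates, bounded quantifiers and factors of the input -/

namespace FOModelChecking

variable {α : Type} {k m n : ℕ} {E E' : Type}

namespace Comp

theorem congr {f g : List α → (Fin m → ℕ) → E × ℕ} (hf : Comp f)
    (h : ∀ w ρ, (∀ i, ρ i ≤ w.length + 1) → f w ρ = g w ρ) : Comp g := by
  obtain ⟨c, hc⟩ := hf
  refine ⟨c, fun k _ a b ha hk => ?_⟩
  obtain ⟨F, hF⟩ := hc k a b ha hk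
  refine ⟨F, fun w r hr => ?_⟩
  rw [← h w (r ∘ a) fun i => hr _]
  exact hF w r hr

/-- Change the exits depending on a finite value. -/
theorem map_fst [Finite E] [Finite E'] {f : List α → (Fin m → ℕ) → E × ℕ} (hf : Comp f)
    (g : E → E') : Comp fun w ρ => (g (f w ρ).1, 0) :=
  hf.bind (g := fun e _ _ => (g e, 0)) fun e => ret (g e)

theorem subst [Finite E] {f : List α → (Fin m → ℕ) → ℕ} {g : List α → (Fin (m + 1) → ℕ) → E × ℕ}
    (hf : Comp fun w ρ => ((), f w ρ)) (hg : Comp g) :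
    Comp fun w ρ => g w (Fin.cons (f w ρ) ρ) :=
  hf.bind (g := fun _ => g) fun _ => hg

/-- A loop that returns its own counter ends with the last counter value, which is the predecessor.
The initial value 0 covers the case of no rounds. -/
theorem pred : Comp fun (_ : List α) (ρ : Fin 1 → ℕ) => ((), ρ 0 - 1) := by
  have h1 : Comp fun (w : List α) (ρ : Fin 2 → ℕ) =>
      loopFn (fun _ _ ρ => ((), ρ 0)) w ρ () (ρ 0) (ρ 1) := loop (fun _ => proj () 0) () 0 1
  have h2 := (ret (m := 1) ()).bind fun _ => h1
  refine h2.congr fun w ρ _ => ?_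
  show loopFn _ w _ () 0 (ρ 0) = _
  cases ρ 0 <;> rfl

theorem add :
    Comp fun (w : List α) (ρ : Fin 2 → ℕ) => ((), min (ρ 0 + ρ 1) (w.length + 1)) := by
  have h1 : Comp fun (w : List α) (ρ : Fin 2 → ℕ) =>
      loopFn (fun _ w ρ => ((), min (ρ 1 + 1) (w.length + 1))) w ρ () (ρ 0) (ρ 1) :=
    loop (fun _ => succ.rename ![1]) () 0 1
  refine h1.congr fun w ρ hρ => ?_
  induction ρ 1 with
  | zero => simpa [loopFn] using hρ 0
  | succ t ih =>
    simp only [loopFn, ih]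
    simp only [Prod.mk.injEq, true_and]
    show min (min (ρ 0 + t) (w.length + 1) + 1) (w.length + 1) = _
    omega

/-- The letter at a position. -/
theorem getElem? [Finite α] : Comp fun (w : List α) (ρ : Fin 1 → ℕ) => (w[ρ 0]?, 0) := by
  -- The letter with index `p` stands in cell `p + 1` of the tape. The cap in `succ` is harmless
  -- because cell `|w| + 1` already shows the right end marker.
  have h := (succ (α := α)).subst (inputCell.rename ![0])
  refine (h.map_fst fun c => match c with
    | .letter a => some a
    | _ => none).congr fun w ρ _ => ?_
  show ((match FOModelChecking.inputCell w (min (ρ 0 + 1) (w.length + 1)) with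
    | .letter a => some a
    | _ => none), 0) = (w[ρ 0]?, 0)
  rw [min_add_add_right, Frag.inputCell_succ]
  rcases lt_or_ge (ρ 0) w.length with h | h
  · simp [min_eq_left h.le, h]
  · simp [h]

end Comp

open Classical in
/-- A predicate that is decided by machine fragments. -/
def CompP (P : List α → (Fin m → ℕ) → Prop) : Prop :=
  Comp fun w ρ => (decide (P w ρ), 0)

namespace CompP

open Classical

variable {P Q : List α → (Fin m → ℕ) → Prop}

theorem congr (hP : CompP P) (h : ∀ w ρ, (∀ i, ρ i ≤ w.length + 1) → (P w ρ ↔ Q w ρ)) :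
    CompP Q :=
  Comp.congr hP fun w ρ hρ => by simp [h w ρ hρ]

theorem rename {P : List α → (Fin n → ℕ) → Prop} (hP : CompP P) (σ : Fin n → Fin m) :
    CompP fun w (ρ : Fin m → ℕ) => P w (ρ ∘ σ) :=
  Comp.rename hP σ

/-- A predicate that depends on the finite component of a computed function. -/
theorem ofFst [Finite E] {f : List α → (Fin m → ℕ) → E × ℕ} (hf : Comp f) (q : E → Prop) :
    CompP fun w ρ => q (f w ρ).1 :=
  hf.map_fst fun e => decide (q e)

theorem subst {f : List α → (Fin m → ℕ) → ℕ} {P : List α → (Fin (m + 1) → ℕ) → Prop}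
    (hf : Comp fun w ρ => ((), f w ρ)) (hP : CompP P) :
    CompP fun w ρ => P w (Fin.cons (f w ρ) ρ) :=
  Comp.subst hf hP

/-- A predicate that depends on the finite component of a computed function and on the
arguments. -/
theorem bindFst [Finite E] {f : List α → (Fin m → ℕ) → E × ℕ} (hf : Comp f)
    {P : E → List α → (Fin m → ℕ) → Prop} (hP : ∀ e, CompP (P e)) :
    CompP fun w ρ => P (f w ρ).1 w ρ :=
  hf.bind (g := fun e w ρ => (decide (P e w (ρ ∘ Fin.succ)), 0)) fun e => (hP e).rename Fin.succ

theorem const (p : Prop) : CompP fun (_ : List α) (_ : Fin m → ℕ) => p :=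
  Comp.ret (decide p)

theorem not (hP : CompP P) : CompP fun w ρ => ¬ P w ρ := by
  refine (ofFst hP fun b => ¬ b = true).congr fun w ρ _ => ?_
  simp

theorem and (hP : CompP P) (hQ : CompP Q) : CompP fun w ρ => P w ρ ∧ Q w ρ := by
  refine (bindFst hP (P := fun b w ρ => b = true ∧ Q w ρ) ?_).congr fun w ρ _ => ?_
  · intro b
    cases b
    · simpa using const False
    · simpa using hQ
  · simp

theorem or (hP : CompP P) (hQ : CompP Q) : CompP fun w ρ => P w ρ ∨ Q w ρ :=
  (hP.not.and hQ.not).not.congr fun w ρ _ => by tauto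

theorem imp (hP : CompP P) (hQ : CompP Q) : CompP fun w ρ => P w ρ → Q w ρ :=
  (hP.and hQ.not).not.congr fun w ρ _ => by tauto

theorem le (i j : Fin m) : CompP fun (_ : List α) (ρ : Fin m → ℕ) => ρ i ≤ ρ j := by
  have := Comp.le (α := α) |>.rename ![i, j]
  exact Comp.congr this fun w ρ _ => by simp

theorem lt (i j : Fin m) : CompP fun (_ : List α) (ρ : Fin m → ℕ) => ρ i < ρ j :=
  (le j i).not.congr fun _ _ _ => not_le

/-- A search loop: the counter is the candidate `x`, and the exit remembers whether a witness has
been found. -/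
theorem exists_le {P : List α → (Fin (m + 1) → ℕ) → Prop} (hP : CompP P) :
    CompP fun w (ρ : Fin m → ℕ) => ∃ x ≤ w.length, P w (Fin.cons x ρ) := by
  let σ : Fin (m + 1) → Fin (m + 3) := Fin.cons 0 fun i => i.succ.succ.succ
  let h : Bool → List α → (Fin (m + 3) → ℕ) → Bool × ℕ := fun b w ρ =>
    (decide (b = true ∨ P w (ρ ∘ σ)), 0)
  have hh : ∀ b, Comp (h b) := fun b =>
    Comp.congr ((const (b = true)).or (hP.rename σ)) fun w ρ _ => by simp [h]
  -- `|w| + 1` rounds test all `x ≤ |w|`. The same register also provides the initial accumulator, a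
  -- number that `σ` ignores.
  have := (Comp.lengthSucc (m := m)).bind fun _ => Comp.loop hh false 0 0
  refine (ofFst this fun b => b = true).congr fun w ρ _ => ?_
  simp only [Fin.cons_zero]
  have key : ∀ t, (Comp.loopFn h w (Fin.cons (w.length + 1) ρ : Fin (m + 1) → ℕ) false
      (w.length + 1) t).1 = true ↔ ∃ x < t, P w (Fin.cons x ρ) := by
    intro t
    induction t with
    | zero => simp [Comp.loopFn]
    | succ t ih =>
      simp only [Comp.loopFn, h, decide_eq_true_eq, ih]
      have hσ : ∀ x y z : ℕ, (Fin.cons x (Fin.cons y (Fin.cons z ρ : Fin (m + 1) → ℕ) :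
          Fin (m + 2) → ℕ) : Fin (m + 3) → ℕ) ∘ σ = Fin.cons x ρ := by
        intro x y z
        funext i
        refine Fin.cases rfl (fun i => rfl) i
      rw [hσ]
      constructor
      · rintro (⟨x, hx, hp⟩ | hp)
        exacts [⟨x, by omega, hp⟩, ⟨t, by omega, hp⟩]
      · rintro ⟨x, hx, hp⟩
        rcases eq_or_ne x t with rfl | hne
        exacts [.inr hp, .inl ⟨x, by omega, hp⟩]
  rw [key]
  simp

theorem forall_le {P : List α → (Fin (m + 1) → ℕ) → Prop} (hP : CompP P) :
    CompP fun w (ρ : Fin m → ℕ) => ∀ x ≤ w.length, P w (Fin.cons x ρ) :=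
  hP.not.exists_le.not.congr fun _ _ _ => by simp

end CompP

/-- The factor of `w` between two positions. -/
def slice (w : List α) (p q : ℕ) : List α := (w.take q).drop p

theorem length_slice (w : List α) (p q : ℕ) : (slice w p q).length = min q w.length - p := by
  simp [slice]

theorem getElem?_slice (w : List α) (p q t : ℕ) :
    (slice w p q)[t]? = if p + t < q then w[p + t]? else none := by
  simp [slice, List.getElem?_take]

theorem Comp.getElem?_slice [Finite α] :
    Comp fun (w : List α) (ρ : Fin 3 → ℕ) => ((slice w (ρ 0) (ρ 1))[ρ 2]?, 0) := by
  have h1 : Comp fun (w : List α) (ρ : Fin 4 → ℕ) =>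
      if decide (¬ ρ 2 ≤ ρ 0) then (w[ρ 0]?, 0) else (none, 0) :=
    (Comp.ite (CompP.le (α := α) 2 0).not (Comp.getElem?.rename ![0]) (.ret none)).congr
      fun w ρ _ => by simp
  have h2 := ((Comp.add (α := α)).rename (m := 3) ![0, 2]).subst h1
  refine h2.congr fun w ρ hρ => ?_
  show (if decide (¬ ρ 1 ≤ min (ρ 0 + ρ 2) (w.length + 1)) = true then
    (w[min (ρ 0 + ρ 2) (w.length + 1)]?, 0) else (none, 0)) = _
  rw [FOModelChecking.getElem?_slice]
  have := hρ 1
  rcases le_or_gt (ρ 0 + ρ 2) (w.length + 1) with h | h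
  · rw [min_eq_left h]
    by_cases h' : ρ 0 + ρ 2 < ρ 1 <;> simp [h', not_le.2, not_lt.1]
  -- The capped sum is `|w| + 1`. This is not below the right end of the factor, so the cap does not
  -- falsify the answer.
  · rw [min_eq_right h.le, if_neg, if_neg]
    · omega
    · simpa using this

theorem CompP.getElem?_slice [Finite α] (p q t : Fin m) (P : Option α → Prop) :
    CompP fun (w : List α) (ρ : Fin m → ℕ) => P (slice w (ρ p) (ρ q))[ρ t]? :=
  CompP.ofFst (Comp.getElem?_slice.rename ![p, q, t]) P

theorem eq_iff_forall_getElem? {N : ℕ} {l l' : List α} (h : l.length ≤ N) (h' : l'.length ≤ N) :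
    l = l' ↔ ∀ t ≤ N, l[t]? = l'[t]? := by
  refine ⟨fun h _ _ => by rw [h], fun H => List.ext_getElem? fun t => ?_⟩
  rcases le_or_gt t N with ht | ht
  · exact H t ht
  · rw [List.getElem?_eq_none (by omega), List.getElem?_eq_none (by omega)]

theorem CompP.slice_eq_slice [Finite α] (p q p' q' : Fin m) :
    CompP fun (w : List α) (ρ : Fin m → ℕ) => slice w (ρ p) (ρ q) = slice w (ρ p') (ρ q') := by
  have h : CompP fun (w : List α) (ρ : Fin (m + 1) → ℕ) =>
      (slice w (ρ p.succ) (ρ q.succ))[ρ 0]? = (slice w (ρ p'.succ) (ρ q'.succ))[ρ 0]? :=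
    CompP.bindFst (Comp.getElem?_slice.rename ![p.succ, q.succ, 0])
      (P := fun x w ρ => x = (slice w (ρ p'.succ) (ρ q'.succ))[ρ 0]?)
      fun x => CompP.getElem?_slice p'.succ q'.succ 0 (x = ·)
  refine h.forall_le.congr fun w ρ _ => ?_
  rw [eq_iff_forall_getElem? (N := w.length)]
  · rfl
  all_goals rw [length_slice]; omega

/-- Only position 0 has to be told apart from the others, and this is a comparison with a register
holding zero. Longer constants are later taken apart letter by letter. -/
theorem CompP.slice_eq_const [Finite α] (p q : Fin m) (l : List α) (hl : l.length ≤ 1) :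
    CompP fun (w : List α) (ρ : Fin m → ℕ) => slice w (ρ p) (ρ q) = l := by
  have h : CompP fun (w : List α) (ρ : Fin (m + 1) → ℕ) =>
      (slice w (ρ p.succ) (ρ q.succ))[ρ 0]? = if ρ 0 = 0 then l[0]? else none := by
    have h0 : CompP fun (_ : List α) (ρ : Fin (m + 1) → ℕ) => ρ 0 = 0 := by
      have := (Comp.ret (α := α) (m := m + 1) ()).subst (CompP.le (α := α) (m := m + 2) 1 0)
      refine CompP.congr this fun w ρ _ => ?_
      exact Nat.le_zero
    refine ((h0.imp (CompP.getElem?_slice p.succ q.succ 0 (· = l[0]?))).and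
      (h0.not.imp (CompP.getElem?_slice p.succ q.succ 0 (· = none)))).congr fun w ρ _ => ?_
    split_ifs <;> simp_all
  refine h.forall_le.congr fun w ρ _ => ?_
  -- `l` may be a letter while `w` is empty, hence the bound `|w| + 1`; at that position itself both
  -- words have ended.
  rw [eq_iff_forall_getElem? (N := w.length + 1)]
  · show (∀ x ≤ w.length, (slice w (ρ p) (ρ q))[x]? = if x = 0 then l[0]? else none) ↔ _
    constructor
    · intro H x hx
      rcases eq_or_ne x 0 with rfl | hx0
      · simpa using H 0 (Nat.zero_le _)
      · rw [List.getElem?_eq_none (l := l) (by omega)]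
        rcases eq_or_ne x (w.length + 1) with rfl | hx1
        · exact List.getElem?_eq_none (by rw [length_slice]; omega)
        · simpa [hx0] using H x (by omega)
    · intro H x hx
      rw [H x (by omega)]
      split_ifs with h0
      · rw [h0]
      · exact List.getElem?_eq_none (by omega)
  · rw [length_slice]; omega
  · omega

/-! ### Predicates on factors -/

/-- A relation between words that, applied to factors of the input, is decided by machine
fragments. -/
def CompW (R : (Fin m → List α) → Prop) : Prop :=
  ∀ (n : ℕ) (p q : Fin m → Fin n),
    CompP fun (w : List α) (ρ : Fin n → ℕ) => R fun i => slice w (ρ (p i)) (ρ (q i))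

namespace CompW

variable {R S : (Fin m → List α) → Prop}

theorem const (p : Prop) : CompW fun _ : Fin m → List α => p := fun _ _ _ => CompP.const p
theorem not (hR : CompW R) : CompW fun s => ¬ R s := fun _ p q => (hR _ p q).not
theorem and (hR : CompW R) (hS : CompW S) : CompW fun s => R s ∧ S s :=
  fun _ p q => (hR _ p q).and (hS _ p q)
theorem or (hR : CompW R) (hS : CompW S) : CompW fun s => R s ∨ S s :=
  fun _ p q => (hR _ p q).or (hS _ p q)
theorem imp (hR : CompW R) (hS : CompW S) : CompW fun s => R s → S s :=
  fun _ p q => (hR _ p q).imp (hS _ p q)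

theorem congr (hR : CompW R) (h : ∀ s, R s ↔ S s) : CompW S := by
  have : R = S := funext fun s => propext (h s)
  rwa [← this]

theorem rename {R : (Fin n → List α) → Prop} (hR : CompW R) (σ : Fin n → Fin m) :
    CompW fun s : Fin m → List α => R (s ∘ σ) :=
  fun _ p q => hR _ (p ∘ σ) (q ∘ σ)

theorem eq [Finite α] (i j : Fin m) : CompW fun s : Fin m → List α => s i = s j :=
  fun _ p q => CompP.slice_eq_slice (p i) (q i) (p j) (q j)

theorem nil [Finite α] (i : Fin m) : CompW fun s : Fin m → List α => s i = [] :=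
  fun _ p q => CompP.slice_eq_const (p i) (q i) [] (by simp)

theorem singleton [Finite α] (i : Fin m) (c : α) : CompW fun s : Fin m → List α => s i = [c] :=
  fun _ p q => CompP.slice_eq_const (p i) (q i) [c] (by simp)

theorem slice_append {w : List α} {p x q : ℕ} (h : p ≤ x) (h' : x ≤ q) :
    slice w p x ++ slice w x q = slice w p q := by
  obtain ⟨q, rfl⟩ := Nat.exists_eq_add_of_le h'
  obtain ⟨x, rfl⟩ := Nat.exists_eq_add_of_le h
  apply List.ext_getElem?
  intro t
  rw [List.getElem?_append, length_slice]
  simp only [FOModelChecking.getElem?_slice]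
  by_cases h1 : p + t < w.length
  · split_ifs <;> first | rfl | omega | (congr 1; omega)
  · have : w[p + t]? = none := List.getElem?_eq_none (by omega)
    have h2 : w[p + x + (t - (min (p + x) w.length - p))]? = none :=
      List.getElem?_eq_none (by omega)
    split_ifs <;> simp [this, h2]

/-- Quantification over the ways to split a factor. -/
theorem split [Finite α] {R : (Fin (m + 2) → List α) → Prop} (hR : CompW R) (i : Fin m) :
    CompW fun s : Fin m → List α =>
      ∃ l₁ l₂, s i = l₁ ++ l₂ ∧ R (Fin.cons l₁ (Fin.cons l₂ s : Fin (m + 1) → List α)) := by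
  intro n p q
  have h1 : CompP fun (w : List α) (ρ : Fin (n + 1) → ℕ) =>
      -- The second alternative is the trivial split of an empty factor, needed when no position `x
      -- ≤ |w|` lies between its two ends.
      ((ρ (p i).succ ≤ ρ 0 ∧ ρ 0 ≤ ρ (q i).succ) ∨ (slice w (ρ (p i).succ) (ρ (q i).succ) = [] ∧
        slice w (ρ (p i).succ) (ρ 0) = [] ∧ slice w (ρ 0) (ρ (q i).succ) = [])) ∧
      R (Fin.cons (slice w (ρ (p i).succ) (ρ 0)) (Fin.cons (slice w (ρ 0) (ρ (q i).succ))
        (fun j => slice w (ρ (p j).succ) (ρ (q j).succ)) : Fin (m + 1) → List α)) := by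
    refine (((CompP.le _ _).and (CompP.le _ _)).or ((CompP.slice_eq_const _ _ [] (by simp)).and
      ((CompP.slice_eq_const _ _ [] (by simp)).and
        (CompP.slice_eq_const _ _ [] (by simp))))).and ?_
    refine (hR _ (Fin.cons (p i).succ (Fin.cons 0 fun j => (p j).succ : Fin (m + 1) → Fin (n + 1)))
      (Fin.cons 0 (Fin.cons (q i).succ fun j => (q j).succ : Fin (m + 1) → Fin (n + 1)))).congr
      fun w ρ _ => ?_
    refine iff_of_eq (congrArg R (funext ?_))
    exact Fin.cases rfl (Fin.cases rfl fun j => rfl)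
  refine h1.exists_le.congr fun w ρ hρ => ?_
  simp only [Fin.cons_succ, Fin.cons_zero]
  constructor
  · rintro ⟨x, hx, h, hr⟩
    refine ⟨_, _, ?_, hr⟩
    rcases h with ⟨h, h'⟩ | ⟨h1, h2, h3⟩
    · rw [slice_append h h']
    · rw [h1, h2, h3]; rfl
  · rintro ⟨l₁, l₂, h, hr⟩
    have hp := hρ (p i)
    generalize ρ (p i) = P at *
    generalize ρ (q i) = Q at *
    rcases Nat.lt_or_ge P (min Q w.length) with hlt | hge
    · have hlen := congrArg List.length h
      rw [length_slice, List.length_append] at hlen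
      have happ := slice_append (w := w) (p := P) (x := P + l₁.length) (q := Q) (by omega)
        (by omega)
      rw [h] at happ
      have h2 := List.append_inj happ (by rw [length_slice]; omega)
      refine ⟨P + l₁.length, by omega, .inl ⟨by omega, by omega⟩, ?_⟩
      rwa [h2.1, h2.2]
    · have hnil : slice w P Q = [] := List.length_eq_zero_iff.1 (by rw [length_slice]; omega)
      rw [hnil] at h
      obtain ⟨rfl, rfl⟩ := List.nil_eq_append_iff.1 h
      have h1 : slice w P (min P w.length) = [] :=
        List.length_eq_zero_iff.1 (by rw [length_slice]; omega)
      have h2 : slice w (min P w.length) Q = [] :=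
        List.length_eq_zero_iff.1 (by rw [length_slice]; omega)
      refine ⟨min P w.length, min_le_right _ _, .inr ⟨hnil, h1, h2⟩, ?_⟩
      rwa [h1, h2]

theorem inLogspace [Finite α] {R : (Fin 1 → List α) → Prop} (hR : CompW R) {L : Language α}
    (h : ∀ w, R ![w] ↔ w ∈ L) : InLogspace L := by
  have h1 : CompP fun (w : List α) (ρ : Fin 2 → ℕ) => R fun _ => slice w (ρ 1) (ρ 0) :=
    hR _ (fun _ => 1) (fun _ => 0)
  have h2 := CompP.subst (Comp.ret (α := α) (m := 0) ())
    (CompP.subst (Comp.lengthSucc (α := α) (m := 1)) h1)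
  classical
  have h3 : CompP fun (w : List α) (_ : Fin 0 → ℕ) => w ∈ L := h2.congr fun w ρ _ => by
    rw [← h]
    refine iff_of_eq (congrArg R (funext fun i => ?_))
    fin_cases i
    -- The right end `|w| + 1` lies beyond the last letter, so nothing is cut off.
    show slice w 0 (w.length + 1) = w
    simp [slice]
  exact Comp.inLogspace h3 fun w => by simp

end CompW

end FOModelChecking

/-! ### Nesting depth of parentheses -/

namespace FOModelChecking

variable {m n : ℕ}

/-- The left parenthesis. -/
abbrev lp : Sym := Sum.inr AuxSym.lpar
/-- The right parenthesis. -/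
abbrev rp : Sym := Sum.inr AuxSym.rpar

/-- The effect of a letter on the nesting depth; `none` if a parenthesis is closed that was not
opened. -/
def scanStep (c : Sym) (d : ℕ) : Option ℕ :=
  if c = lp then some (d + 1) else if c = rp then (if d = 0 then none else some (d - 1)) else some d

/-- The nesting depth after a word, starting from depth `d`. -/
def scan : List Sym → ℕ → Option ℕ
  | [], d => some d
  | c :: l, d => (scanStep c d).bind (scan l)

theorem scan_append (l l' : List Sym) (d : ℕ) : scan (l ++ l') d = (scan l d).bind (scan l') := by
  induction l generalizing d with
  | nil => rfl
  | cons c l ih =>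
    simp only [List.cons_append, scan, Option.bind_assoc]
    exact congrArg _ (funext ih)

/-- A letter raises the depth by at most one. Hence the depth within the input fits into a register.
-/
theorem scan_le {l : List Sym} {d e : ℕ} (h : scan l d = some e) : e ≤ d + l.length := by
  induction l generalizing d with
  | nil => simp [scan] at h; omega
  | cons c l ih =>
    simp only [scan, Option.bind_eq_some_iff] at h
    obtain ⟨x, hx, h⟩ := h
    have := ih h
    have : x ≤ d + 1 := by
      simp only [scanStep] at hx
      split_ifs at hx <;> simp at hx <;> omega
    simp only [List.length_cons]
    omega

/-- Encode an optional number for a fragment with two exits. -/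
def encodeOption : Option ℕ → Bool × ℕ
  | none => (false, 0)
  | some d => (true, d)

/-- Lets a loop over all positions of the input scan a factor: in rounds outside the factor nothing
is appended. -/
theorem slice_succ (w : List Sym) (p q t : ℕ) :
    slice w p (min (t + 1) q) = slice w p (min t q) ++
      (if p ≤ t ∧ t < q then w[t]? else none).toList := by
  rcases lt_or_ge t q with h | h
  · rw [min_eq_left (Nat.succ_le_of_lt h), min_eq_left h.le]
    simp only [slice, List.take_add_one, List.drop_append, List.length_take, h, and_true]
    congr 1
    rcases hx : w[t]? with _ | c
    · simp
    · obtain ⟨ht, -⟩ := List.getElem?_eq_some_iff.1 hx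
      rw [min_eq_left ht.le]
      split_ifs with hp
      · simp [Nat.sub_eq_zero_of_le hp]
      · exact List.drop_eq_nil_of_le (by simp; omega)
  · simp [min_eq_right h, min_eq_right (h.trans (Nat.le_succ t)), h.not_gt]

/-- The depth is the accumulator of a loop over the input. An illegal closing parenthesis switches
the finite component to `false`, where it stays. -/
theorem Comp.scan_slice :
    Comp fun (w : List Sym) (ρ : Fin 2 → ℕ) => encodeOption (scan (slice w (ρ 0) (ρ 1)) 0) := by
  -- context of the body: counter, depth, `n + 1`, `p`, `q`
  let cell : List Sym → (Fin 5 → ℕ) → Option Sym := fun w ρ =>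
    if ρ 3 ≤ ρ 0 ∧ ρ 0 < ρ 4 then w[ρ 0]? else none
  have hcell : Comp fun w ρ => (cell w ρ, 0) :=
    (Comp.ite ((CompP.le (α := Sym) 3 0).and (CompP.lt 0 4)) (Comp.getElem?.rename ![0])
      (.ret none)).congr fun w ρ _ => by
        simp only [cell, decide_eq_true_eq]
        split_ifs <;> rfl
  let body : Bool → List Sym → (Fin 5 → ℕ) → Bool × ℕ := fun b w ρ =>
    if b then
      match cell w ρ with
      | none => (true, ρ 1)
      | some c =>
        if c = lp then (true, min (ρ 1 + 1) (w.length + 1))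
        else if c = rp then (if ρ 1 ≤ 0 then (false, 0) else (true, ρ 1 - 1))
        else (true, ρ 1)
    else (false, 0)
  have hbody : ∀ b, Comp (body b) := by
    intro b
    cases b
    · exact Comp.ret false
    · refine (hcell.bind (g := fun c w ρ => match c with
        | none => (true, ρ 2)
        | some c =>
          if c = lp then (true, min (ρ 2 + 1) (w.length + 1))
          else if c = rp then (if ρ 2 ≤ 0 then (false, 0) else (true, ρ 2 - 1))
          else (true, ρ 2)) fun c => ?_)
      rcases c with _ | c
      · exact Comp.proj true 2
      · dsimp only
        split_ifs
        · exact (Comp.succ.rename ![2]).bind (g := fun _ _ ρ => (true, ρ 0)) fun _ => .proj true 0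
        · have h0 : CompP fun (_ : List Sym) (ρ : Fin 6 → ℕ) => ρ 2 ≤ 0 :=
            CompP.subst (Comp.ret ()) (CompP.le 3 0)
          refine (Comp.ite h0 (.ret false) ((Comp.pred.rename ![2]).bind
            (g := fun _ _ ρ => (true, ρ 0)) fun _ => .proj true 0)).congr fun w ρ _ => ?_
          simp only [decide_eq_true_eq]
          rfl
        · exact Comp.proj true 2
  have hloop := (Comp.lengthSucc (α := Sym) (m := 2)).bind fun _ =>
    (Comp.ret (m := 3) ()).bind fun _ =>
      -- The omitted index 2 belongs to the register that supplies the initial depth 0.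
      (Comp.loop (m := 4) (h := fun b w ρ => body b w (ρ ∘ ![0, 1, 3, 4, 5]))
        (fun b => (hbody b).rename _) true 0 1)
  refine hloop.congr fun w ρ hρ => ?_
  show Comp.loopFn _ w _ true 0 (w.length + 1) = _
  have key : ∀ t, Comp.loopFn (fun b w ρ => body b w (ρ ∘ ![0, 1, 3, 4, 5])) w
      (Fin.cons 0 (Fin.cons (w.length + 1) ρ : Fin 3 → ℕ) : Fin 4 → ℕ) true 0 t =
        encodeOption (scan (slice w (ρ 0) (min t (ρ 1))) 0) := by
    intro t
    induction t with
    | zero => simp [Comp.loopFn, slice, scan, encodeOption]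
    | succ t ih =>
      rw [Comp.loopFn, ih, slice_succ, scan_append]
      rcases hs : scan (slice w (ρ 0) (min t (ρ 1))) 0 with _ | d
      · rfl
      -- Because of this bound the capped increment is a true increment.
      · have hd : d ≤ w.length := by
          have := scan_le hs
          rw [length_slice] at this
          omega
        show (match (if ρ 0 ≤ t ∧ t < ρ 1 then w[t]? else none) with
          | none => (true, d)
          | some c =>
            if c = lp then (true, min (d + 1) (w.length + 1))
            else if c = rp then (if d ≤ 0 then (false, 0) else (true, d - 1))
            else (true, d)) = _
        rcases (if ρ 0 ≤ t ∧ t < ρ 1 then w[t]? else none) with _ | c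
        · rfl
        · simp only [Option.toList_some, Option.bind_some, scan, scanStep, Nat.le_zero]
          split_ifs <;> simp [encodeOption, hd]
  rw [key]
  rw [min_eq_right (hρ 1)]

/-- The factor opens as many parentheses as it closes. -/
def Balanced (l : List Sym) : Prop := scan l 0 = some 0

theorem CompW.balanced (i : Fin m) : CompW fun s : Fin m → List Sym => Balanced (s i) := by
  intro n p q
  have h := (Comp.scan_slice.rename ![p i, q i]).bind
    (g := fun b _ ρ => (decide (b = true ∧ ρ 0 ≤ 0), 0)) fun b => by
      have h0 : CompP fun (_ : List Sym) (ρ : Fin (n + 1) → ℕ) => ρ 0 ≤ 0 :=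
        CompP.subst (Comp.ret ()) (CompP.le 1 0)
      exact Comp.congr ((CompP.const (b = true)).and h0) fun w ρ _ => by simp
  refine (CompP.ofFst h (· = true)).congr fun w ρ _ => ?_
  show decide ((encodeOption (scan (slice w (ρ (p i)) (ρ (q i))) 0)).1 = true ∧
    (encodeOption (scan (slice w (ρ (p i)) (ρ (q i))) 0)).2 ≤ 0) = true ↔
      scan (slice w (ρ (p i)) (ρ (q i))) 0 = some 0
  rw [decide_eq_true_iff]
  rcases scan (slice w (ρ (p i)) (ρ (q i))) 0 with _ | d <;> simp [encodeOption]

/-- The factor closes only parentheses that it opens. -/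
def Alive (l : List Sym) : Prop := scan l 0 ≠ none

theorem CompW.alive (i : Fin m) : CompW fun s : Fin m → List Sym => Alive (s i) := by
  intro n p q
  refine (CompP.ofFst (Comp.scan_slice.rename ![p i, q i]) (· = true)).congr fun w ρ _ => ?_
  show (encodeOption (scan (slice w (ρ (p i)) (ρ (q i))) 0)).1 = true ↔ _
  simp only [Alive]
  rcases scan (slice w (ρ (p i)) (ρ (q i))) 0 with _ | d <;> simp [encodeOption]

end FOModelChecking

namespace FOModelChecking

/-! ### Numerals and variables as words -/

/-- The binary digits. -/
def IsDigit (c : Sym) : Prop := c = Sum.inr AuxSym.zero ∨ c = Sum.inr AuxSym.one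

/-- The word does not start with a digit. -/
def Delim (l : List Sym) : Prop := ∀ c l', l = c :: l' → ¬ IsDigit c

theorem delim_nil : Delim [] := by intro c l' h; simp at h

theorem delim_cons {c : Sym} {l : List Sym} : Delim (c :: l) ↔ ¬ IsDigit c := by
  refine ⟨fun h => h c l rfl, ?_⟩
  rintro h c' l' hl
  rw [List.cons_eq_cons] at hl
  rwa [← hl.1]

theorem Delim.append_left {l l' : List Sym} (h : Delim (l ++ l')) : Delim l := by
  cases l with
  | nil => exact delim_nil
  | cons c l => exact delim_cons.2 (delim_cons.1 h)

theorem Delim.append {l l' : List Sym} (h : Delim l) (h' : Delim l') : Delim (l ++ l') := by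
  cases l with
  | nil => exact h'
  | cons c l => exact delim_cons.2 (delim_cons.1 h)

/-- Binary representations. -/
def IsBin (l : List Sym) : Prop :=
  l = [Sum.inr AuxSym.zero] ∨ ∃ l', l = Sum.inr AuxSym.one :: l' ∧ ∀ c ∈ l', IsDigit c

theorem IsBin.isDigit {l : List Sym} (h : IsBin l) : ∀ c ∈ l, IsDigit c := by
  rcases h with rfl | ⟨l', rfl, h⟩
  · simp [IsDigit]
  · simpa [IsDigit] using h

theorem bin_bit (b : Bool) {n : ℕ} (hn : n ≠ 0) :
    bin (Nat.bit b n) = bin n ++ [Sum.inr (if b then AuxSym.one else AuxSym.zero)] := by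
  have : Nat.bit b n ≠ 0 := by simp [hn]
  simp [bin, hn, this, Nat.bits_append_bit n b (fun h => absurd h hn)]

theorem bin_one : bin 1 = [Sum.inr AuxSym.one] := by simp [bin]

theorem isBin_bin (n : ℕ) : IsBin (bin n) := by
  rcases eq_or_ne n 0 with rfl | hn
  · left; simp [bin]
  · right
    induction n using Nat.binaryRec' with
    | zero => exact absurd rfl hn
    | bit b n h ih =>
      rcases eq_or_ne n 0 with rfl | hn
      · simp only [h rfl]
        exact ⟨[], by simp [bin_one], by simp⟩
      · obtain ⟨l, hl, hd⟩ := ih hn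
        rw [bin_bit b hn, hl]
        refine ⟨_, rfl, fun c hc => ?_⟩
        rcases List.mem_append.1 hc with hc | hc
        · exact hd c hc
        · cases b <;> simp_all [IsDigit]

theorem exists_bin_eq {l : List Sym} (h : IsBin l) : ∃ n, bin n = l := by
  rcases h with rfl | ⟨l', rfl, h⟩
  · exact ⟨0, by simp [bin]⟩
  · suffices ∃ n ≠ 0, bin n = Sum.inr AuxSym.one :: l' by
      obtain ⟨n, -, hn⟩ := this
      exact ⟨n, hn⟩
    induction l' using List.reverseRecOn with
    | nil => exact ⟨1, one_ne_zero, bin_one⟩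
    | append_singleton l' c ih =>
      obtain ⟨n, hn, hb⟩ := ih fun c hc => h c (by simp [hc])
      obtain ⟨b, hb'⟩ : ∃ b : Bool, c = Sum.inr (if b then AuxSym.one else AuxSym.zero) := by
        rcases h c (by simp) with rfl | rfl
        exacts [⟨false, rfl⟩, ⟨true, rfl⟩]
      exact ⟨Nat.bit b n, by simp [hn], by rw [bin_bit b hn, hb, hb']; rfl⟩

/-- Horner's rule gives a left inverse of `bin`, which makes `bin` injective. -/
theorem foldl_bin (n : ℕ) :
    (bin n).foldl (fun a c => 2 * a + if c = Sum.inr AuxSym.one then 1 else 0) 0 = n := by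
  induction n using Nat.binaryRec' with
  | zero => simp [bin]
  | bit b n h ih =>
    rcases eq_or_ne n 0 with rfl | hn
    · simp [h rfl, bin_one]
    · rw [bin_bit b hn, List.foldl_append, ih]
      cases b <;> simp [Nat.bit]

theorem bin_injective : Function.Injective bin := fun m n h => by
  rw [← foldl_bin m, h, foldl_bin]

/-- The letter `v`. -/
abbrev vSym : Sym := Sum.inr AuxSym.v

/-- The words for variables. -/
def IsVar (l : List Sym) : Prop := ∃ l', l = vSym :: l' ∧ IsBin l'

theorem isVar_iff {l : List Sym} : IsVar l ↔ ∃ j, l = varWord j := by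
  constructor
  · rintro ⟨l', rfl, h⟩
    obtain ⟨n, rfl⟩ := exists_bin_eq h
    exact ⟨n, rfl⟩
  · rintro ⟨j, rfl⟩
    exact ⟨_, rfl, isBin_bin j⟩

/-- A block of digits ends at the first non-digit, so both decompositions are cut at the same place.
Unique readability of numerals and variables rests on this. -/
theorem digits_append_inj {l l' y y' : List Sym} (hl : ∀ c ∈ l, IsDigit c)
    (hl' : ∀ c ∈ l', IsDigit c) (hy : Delim y) (hy' : Delim y') (h : l ++ y = l' ++ y') :
    l = l' ∧ y = y' := by
  induction l generalizing l' with
  | nil =>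
    cases l' with
    | nil => exact ⟨rfl, h⟩
    | cons c l' => exact absurd (hl' c (by simp)) (hy c _ h)
  | cons c l ih =>
    cases l' with
    | nil => exact absurd (hl c (by simp)) (hy' c _ h.symm)
    | cons c' l' =>
      simp only [List.cons_append, List.cons.injEq] at h
      obtain ⟨rfl, h⟩ := h
      obtain ⟨rfl, rfl⟩ := ih (fun c hc => hl c (by simp [hc])) (fun c hc => hl' c (by simp [hc])) h
      exact ⟨rfl, rfl⟩

theorem bin_append_inj {m n : ℕ} {y y' : List Sym} (hy : Delim y) (hy' : Delim y')
    (h : bin m ++ y = bin n ++ y') : m = n ∧ y = y' := by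
  obtain ⟨h1, h2⟩ := digits_append_inj (isBin_bin m).isDigit (isBin_bin n).isDigit hy hy' h
  exact ⟨bin_injective h1, h2⟩

theorem varWord_append_inj {m n : ℕ} {y y' : List Sym} (hy : Delim y) (hy' : Delim y')
    (h : varWord m ++ y = varWord n ++ y') : m = n ∧ y = y' :=
  bin_append_inj hy hy' (List.cons.inj h).2

theorem varWord_injective : Function.Injective varWord := fun _ _ h =>
  (varWord_append_inj delim_nil delim_nil (congrArg (· ++ []) h)).1

/-! ### Positions in a word -/

/-- `P` holds at some position in the middle part of `u ++ l ++ z`, where `P` is applied to the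
parts of the word before and after the position. -/
def Cur (P : List Sym → List Sym → Prop) : List Sym → List Sym → List Sym → Prop
  | _, [], _ => False
  | u, c :: l, z => P u (c :: l ++ z) ∨ Cur P (u ++ [c]) l z

variable {P : List Sym → List Sym → Prop}

/-- This is why `Cur` carries a context on both sides: a search for positions splits along the parts
from which the word of a formula is composed. -/
theorem cur_append (u l l' z : List Sym) :
    Cur P u (l ++ l') z ↔ Cur P u l (l' ++ z) ∨ Cur P (u ++ l) l' z := by
  induction l generalizing u with
  | nil => simp [Cur]
  | cons c l ih =>
    simp only [List.cons_append, Cur, ih, or_assoc]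
    simp

theorem cur_iff (u l z : List Sym) :
    Cur P u l z ↔ ∃ x y, l = x ++ y ∧ y ≠ [] ∧ P (u ++ x) (y ++ z) := by
  induction l generalizing u with
  | nil => simp [Cur]
  | cons c l ih =>
    simp only [Cur, ih]
    constructor
    · rintro (h | ⟨x, y, rfl, hy, h⟩)
      · exact ⟨[], c :: l, rfl, by simp, by simpa using h⟩
      · exact ⟨c :: x, y, rfl, hy, by simpa using h⟩
    · rintro ⟨x, y, h, hy, hp⟩
      cases x with
      | nil =>
        left
        simp only [List.nil_append] at h
        simpa [h] using hp
      | cons c' x =>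
        simp only [List.cons_append, List.cons.injEq] at h
        obtain ⟨rfl, rfl⟩ := h
        exact .inr ⟨x, y, rfl, hy, by simpa using hp⟩

theorem not_cur_of_forall {l : List Sym} (h : ∀ c ∈ l, ∀ u y, ¬ P u (c :: y)) (u z : List Sym) :
    ¬ Cur P u l z := by
  induction l generalizing u with
  | nil => simp [Cur]
  | cons c l ih =>
    simp only [Cur, not_or]
    exact ⟨h c (by simp) _ _, ih (fun c hc => h c (by simp [hc])) _⟩

/-! ### Parentheses -/

theorem scan_eq_self {l : List Sym} (h : ∀ c ∈ l, c ≠ lp ∧ c ≠ rp) (d : ℕ) :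
    scan l d = some d := by
  induction l with
  | nil => rfl
  | cons c l ih =>
    have := h c (by simp)
    simp only [scan, scanStep, this, if_false, Option.bind_some]
    exact ih fun c hc => h c (by simp [hc])

/-- A greater initial depth shifts all later depths and cannot make a closing parenthesis illegal.
-/
theorem scan_add {l : List Sym} {d e : ℕ} (h : scan l d = some e) (n : ℕ) :
    scan l (d + n) = some (e + n) := by
  induction l generalizing d with
  | nil => simp_all [scan]
  | cons c l ih =>
    simp only [scan, Option.bind_eq_some_iff] at h ⊢
    obtain ⟨x, hx, h⟩ := h
    refine ⟨x + n, ?_, ih h⟩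
    simp only [scanStep] at hx ⊢
    split_ifs at hx ⊢ <;> simp at hx ⊢ <;> omega

theorem Balanced.scan {l : List Sym} (h : Balanced l) (d : ℕ) :
    FOModelChecking.scan l d = some d := by
  simpa using scan_add h d

theorem Balanced.append {l l' : List Sym} (h : Balanced l) (h' : Balanced l') :
    Balanced (l ++ l') := by
  simp [Balanced, scan_append, h.scan, h'.scan]

theorem balanced_of_forall {l : List Sym} (h : ∀ c ∈ l, c ≠ lp ∧ c ≠ rp) : Balanced l :=
  scan_eq_self h 0

theorem Balanced.paren {l : List Sym} (h : Balanced l) : Balanced (paren l) := by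
  simp [Balanced, FOModelChecking.paren, FOModelChecking.scan, scan_append, scanStep, h.scan]

theorem Alive.append_balanced {l l' : List Sym} (h : Alive l) (h' : Alive l') :
    Alive (l ++ l') := by
  simp only [Alive, ne_eq, Option.eq_none_iff_forall_ne_some, not_forall, not_not] at *
  obtain ⟨d, hd⟩ := h
  obtain ⟨e, he⟩ := h'
  exact ⟨e + d, by simpa [scan_append, hd] using scan_add he d⟩

theorem Alive.append_left {l l' : List Sym} (h : Alive (l ++ l')) : Alive l := by
  intro hl
  exact h (by simp [scan_append, hl])

theorem Balanced.alive {l : List Sym} (h : Balanced l) : Alive l := by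
  simp [Alive, show FOModelChecking.scan l 0 = some 0 from h]

/-- A parenthesis that is opened in a balanced word is closed again. -/
theorem Balanced.not_alive {x y : List Sym} (h : Balanced (x ++ lp :: y)) : ¬ Alive y := by
  intro hy
  obtain ⟨e, he⟩ := Option.ne_none_iff_exists'.1 hy
  rw [Balanced, scan_append, Option.bind_eq_some_iff] at h
  obtain ⟨d, -, h⟩ := h
  have := scan_add he (d + 1)
  simp only [FOModelChecking.scan, scanStep, if_true, Option.bind_some] at h
  rw [zero_add, h] at this
  simp at this

/-- The closing parenthesis is determined by the opening one. -/
theorem Balanced.eq_of_append {l l' y y' : List Sym} (hl : Balanced l) (hl' : Balanced l')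
    (h : l ++ rp :: y = l' ++ rp :: y') : l = l' := by
  have key : ∀ {x a : List Sym}, Balanced x → ¬ Balanced (x ++ rp :: a) := by
    intro x a hx hx'
    rw [Balanced, scan_append, hx.scan] at hx'
    simp [FOModelChecking.scan, scanStep] at hx'
  rcases List.append_eq_append_iff.1 h with ⟨a, rfl, ha⟩ | ⟨a, rfl, ha⟩
  · cases a with
    | nil => simp
    | cons c a =>
      obtain ⟨rfl, -⟩ := List.cons.inj ha
      exact absurd hl' (key hl)
  · cases a with
    | nil => simp
    | cons c a =>
      obtain ⟨rfl, -⟩ := List.cons.inj ha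
      exact absurd hl (key hl')

end FOModelChecking

namespace FOModelChecking

/-! ### Formulas with one binary connective and one quantifier -/

/-- Formulas built with one binary connective and one quantifier. -/
inductive PosForm (σ : Signature) : Type
  | rel (i : Fin σ.card) (t : Fin (σ.arity i) → ℕ) : PosForm σ
  | eq (j k : ℕ) : PosForm σ
  | bin (φ ψ : PosForm σ) : PosForm σ
  | qu (j : ℕ) (φ : PosForm σ) : PosForm σ

/-- The connective: `∨` for `true` and `∧` for `false`. -/
def opLog (b : Bool) : LogSym := if b then .or else .and

/-- The quantifier: `∃` for `true` and `∀` for `false`. -/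
def quLog (b : Bool) : LogSym := if b then .ex else .all

/-- The connective as a letter. -/
def opSym (b : Bool) : Sym := Sum.inl (opLog b)

/-- The quantifier as a letter. -/
def quSym (b : Bool) : Sym := Sum.inl (quLog b)

/-- The equality sign. -/
abbrev eqSym : Sym := Sum.inl LogSym.eq

namespace PosForm

variable {σ : Signature}

/-- The first-order formula with `∨, ∃` or `∧, ∀`. -/
def toFormula (b : Bool) : PosForm σ → Formula σ
  | rel i t => .rel i t
  | eq j k => .eq j k
  | bin φ ψ => if b then .or (φ.toFormula b) (ψ.toFormula b) else
      .and (φ.toFormula b) (ψ.toFormula b)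
  | qu j φ => if b then .ex j (φ.toFormula b) else .all j (φ.toFormula b)

/-- The written form. -/
def word (b : Bool) : PosForm σ → List Sym
  | rel i t => (Formula.rel i t).word
  | eq j k => (Formula.eq j k : Formula σ).word
  | bin φ ψ => lp :: (φ.word b ++ opSym b :: (ψ.word b ++ [rp]))
  | qu j φ => lp :: quSym b :: (varWord j ++ (φ.word b ++ [rp]))

/-- The free variables. -/
def vars : PosForm σ → Set ℕ
  | rel _ t => Set.range t
  | eq j k => {j, k}
  | bin φ ψ => φ.vars ∪ ψ.vars
  | qu j φ => φ.vars \ {j}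

/-- Quantified variables are free in the scope of the quantifier. -/
def Wf : PosForm σ → Prop
  | rel _ _ => True
  | eq _ _ => True
  | bin φ ψ => φ.Wf ∧ ψ.Wf
  | qu j φ => j ∈ φ.vars ∧ φ.Wf

/-- Equality occurs only if `e` holds. -/
def EqOk (e : Prop) : PosForm σ → Prop
  | rel _ _ => True
  | eq _ _ => e
  | bin φ ψ => φ.EqOk e ∧ ψ.EqOk e
  | qu _ φ => φ.EqOk e

/-- Some atom has a given property. -/
def AtomEx (G : (i : Fin σ.card) → (Fin (σ.arity i) → ℕ) → Prop) (H : ℕ → ℕ → Prop) :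
    PosForm σ → Prop
  | rel i t => G i t
  | eq j k => H j k
  | bin φ ψ => φ.AtomEx G H ∨ ψ.AtomEx G H
  | qu _ φ => φ.AtomEx G H

theorem word_toFormula (b : Bool) (φ : PosForm σ) : (φ.toFormula b).word = φ.word b := by
  induction φ <;> cases b <;>
    simp_all [toFormula, word, Formula.word, paren, opSym, quSym, opLog, quLog]

theorem freeVars_toFormula (b : Bool) (φ : PosForm σ) : (φ.toFormula b).freeVars = φ.vars := by
  induction φ <;> cases b <;> simp_all [toFormula, vars, Formula.freeVars]

theorem wellFormed_toFormula (b : Bool) (φ : PosForm σ) :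
    (φ.toFormula b).WellFormed ↔ φ.Wf := by
  induction φ <;> cases b <;>
    simp_all [toFormula, Wf, Formula.WellFormed, freeVars_toFormula]

theorem logSyms_toFormula_subset {b : Bool} {Γ : Set LogSym} (ho : opLog b ∈ Γ)
    (hq : quLog b ∈ Γ) {φ : PosForm σ} (h : φ.EqOk (LogSym.eq ∈ Γ)) :
    (φ.toFormula b).logSyms ⊆ Γ := by
  induction φ <;> cases b <;>
    simp_all [toFormula, EqOk, Formula.logSyms, opLog, quLog, Set.insert_subset_iff]

theorem exists_toFormula_eq {b : Bool} {Γ : Set LogSym}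
    (hΓ : Γ ⊆ {opLog b, quLog b, LogSym.eq}) {φ : Formula σ} (h : φ.logSyms ⊆ Γ) :
    ∃ ψ : PosForm σ, ψ.toFormula b = φ ∧ ψ.EqOk (LogSym.eq ∈ Γ) := by
  induction φ with
  | rel i t => exact ⟨.rel i t, rfl, trivial⟩
  | eq j k => exact ⟨.eq j k, rfl, h rfl⟩
  | neg φ _ =>
    have := hΓ (h (show LogSym.neg ∈ _ from Or.inl rfl))
    cases b <;> simp [opLog, quLog] at this
  | and φ ψ ihφ ihψ =>
    have h1 := hΓ (h (show LogSym.and ∈ _ from Or.inl (Or.inl rfl)))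
    obtain ⟨φ, rfl, hφ⟩ := ihφ fun _ hx => h (Or.inl (Or.inr hx))
    obtain ⟨ψ, rfl, hψ⟩ := ihψ fun _ hx => h (Or.inr hx)
    refine ⟨.bin φ ψ, ?_, hφ, hψ⟩
    cases b <;> simp [opLog, quLog, toFormula] at h1 ⊢
  | or φ ψ ihφ ihψ =>
    have h1 := hΓ (h (show LogSym.or ∈ _ from Or.inl (Or.inl rfl)))
    obtain ⟨φ, rfl, hφ⟩ := ihφ fun _ hx => h (Or.inl (Or.inr hx))
    obtain ⟨ψ, rfl, hψ⟩ := ihψ fun _ hx => h (Or.inr hx)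
    refine ⟨.bin φ ψ, ?_, hφ, hψ⟩
    cases b <;> simp [opLog, quLog, toFormula] at h1 ⊢
  | ex j φ ih =>
    have h1 := hΓ (h (show LogSym.ex ∈ _ from Or.inl rfl))
    obtain ⟨φ, rfl, hφ⟩ := ih fun _ hx => h (Or.inr hx)
    refine ⟨.qu j φ, ?_, hφ⟩
    cases b <;> simp [opLog, quLog, toFormula] at h1 ⊢
  | all j φ ih =>
    have h1 := hΓ (h (show LogSym.all ∈ _ from Or.inl rfl))
    obtain ⟨φ, rfl, hφ⟩ := ih fun _ hx => h (Or.inr hx)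
    refine ⟨.qu j φ, ?_, hφ⟩
    cases b <;> simp [opLog, quLog, toFormula] at h1 ⊢

/-- A formula with `∨, ∃` is satisfiable exactly if one of its atoms is. -/
theorem exists_sat {D : Type*} (A : σ.Struct D) (φ : PosForm σ) :
    (∃ s, (φ.toFormula true).Sat A s) ↔ φ.AtomEx (fun i t => ∃ s : ℕ → D, (fun m => s (t m)) ∈ A.rel i)
      (fun j k => ∃ s : ℕ → D, s j = s k) := by
  induction φ with
  | rel i t => rfl
  | eq j k => rfl
  | bin φ ψ ihφ ihψ => simp [toFormula, Formula.Sat, AtomEx, ← ihφ, ← ihψ, exists_or]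
  | qu j φ ih =>
    simp only [toFormula, Formula.Sat, AtomEx, ← ih, if_true]
    constructor
    · rintro ⟨s, x, h⟩
      exact ⟨_, h⟩
    · rintro ⟨s, h⟩
      -- Updating `v_j` with its own value changes nothing.
      exact ⟨s, s j, by simpa using h⟩

/-- A formula with `∧, ∀` is falsifiable exactly if one of its atoms is. -/
theorem exists_not_sat {D : Type*} (A : σ.Struct D) (φ : PosForm σ) :
    (∃ s, ¬ (φ.toFormula false).Sat A s) ↔
      φ.AtomEx (fun i t => ∃ s : ℕ → D, (fun m => s (t m)) ∈ (A.rel i)ᶜ)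
        (fun j k => ∃ s : ℕ → D, s j ≠ s k) := by
  induction φ with
  | rel i t => rfl
  | eq j k => rfl
  | bin φ ψ ihφ ihψ =>
    simp only [toFormula, Formula.Sat, AtomEx, ← ihφ, ← ihψ, ← exists_or, Bool.false_eq_true,
      if_false, not_and_or]
  | qu j φ ih =>
    simp only [toFormula, Formula.Sat, AtomEx, ← ih, Bool.false_eq_true, if_false, not_forall]
    constructor
    · rintro ⟨s, x, h⟩
      exact ⟨_, h⟩
    · rintro ⟨s, h⟩
      exact ⟨s, s j, by simpa using h⟩

end PosForm

/-- For a sentence the assignment does not matter. -/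
theorem Formula.sat_congr {σ : Signature} {D : Type*} (A : σ.Struct D) (φ : Formula σ) :
    ∀ {s s' : ℕ → D}, (∀ j ∈ φ.freeVars, s j = s' j) → (φ.Sat A s ↔ φ.Sat A s') := by
  induction φ with
  | rel i t =>
    intro s s' h
    have : (fun m => s (t m)) = fun m => s' (t m) := funext fun m => h _ ⟨m, rfl⟩
    simp [Sat, this]
  | eq j k =>
    intro s s' h
    simp [Sat, h j (by simp [freeVars]), h k (by simp [freeVars])]
  | neg φ ih => exact fun h => not_congr (ih h)
  | and φ ψ ihφ ihψ =>
    exact fun h => and_congr (ihφ fun j hj => h j (.inl hj)) (ihψ fun j hj => h j (.inr hj))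
  | or φ ψ ihφ ihψ =>
    exact fun h => or_congr (ihφ fun j hj => h j (.inl hj)) (ihψ fun j hj => h j (.inr hj))
  | ex j φ ih =>
    refine fun h => exists_congr fun x => ih fun k hk => ?_
    rcases eq_or_ne k j with rfl | hkj
    · simp
    · simpa [hkj] using h k ⟨hk, hkj⟩
  | all j φ ih =>
    refine fun h => forall_congr' fun x => ih fun k hk => ?_
    rcases eq_or_ne k j with rfl | hkj
    · simp
    · simpa [hkj] using h k ⟨hk, hkj⟩

/-! ### Letters in words -/

theorem IsDigit.ne {c : Sym} (h : IsDigit c) : c ≠ lp ∧ c ≠ rp ∧ c ≠ vSym ∧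
    c ≠ Sum.inr AuxSym.R ∧ ∀ x, c ≠ Sum.inl x := by
  rcases h with rfl | rfl <;> simp

theorem mem_varWord {c : Sym} {j : ℕ} (h : c ∈ varWord j) : c = vSym ∨ IsDigit c := by
  rcases List.mem_cons.1 h with h | h
  · exact .inl h
  · exact .inr ((isBin_bin j).isDigit c h)

theorem balanced_varWord (j : ℕ) : Balanced (varWord j) :=
  balanced_of_forall fun c hc => by
    rcases mem_varWord hc with rfl | h
    · simp
    · exact ⟨h.ne.1, h.ne.2.1⟩

theorem not_isDigit_inl (x : LogSym) : ¬ IsDigit (Sum.inl x) := by simp [IsDigit]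
theorem not_isDigit_lp : ¬ IsDigit lp := by simp [IsDigit]
theorem not_isDigit_rp : ¬ IsDigit rp := by simp [IsDigit]
theorem not_isDigit_v : ¬ IsDigit vSym := by simp [IsDigit]
theorem not_isDigit_R : ¬ IsDigit (Sum.inr AuxSym.R) := by simp [IsDigit]

theorem quSym_notMem_varWord (b : Bool) (j : ℕ) : quSym b ∉ varWord j := by
  intro h
  rcases mem_varWord h with h | h
  · simp [quSym] at h
  · exact h.ne.2.2.2.2 _ rfl

theorem balanced_varWords (l : List ℕ) : Balanced (l.flatMap varWord) := by
  induction l with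
  | nil => rfl
  | cons j l ih => exact (balanced_varWord j).append ih

theorem delim_varWord_append (j : ℕ) (l : List Sym) : Delim (varWord j ++ l) :=
  delim_cons.2 not_isDigit_v

namespace PosForm

variable {σ : Signature} {b : Bool}

theorem rel_word (i : Fin σ.card) (t : Fin (σ.arity i) → ℕ) :
    (rel i t).word b = Sum.inr AuxSym.R :: (FOModelChecking.bin (i + 1) ++
      (lp :: ((List.ofFn t).flatMap varWord ++ [rp]))) := by
  simp [word, Formula.word, paren]

theorem eq_word (j k : ℕ) :
    (eq j k : PosForm σ).word b = varWord j ++ (eqSym :: varWord k) := by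
  simp [word, Formula.word]

theorem balanced_cons {c : Sym} {l : List Sym} (hc : c ≠ lp ∧ c ≠ rp) (h : Balanced l) :
    Balanced (c :: l) :=
  (balanced_of_forall (l := [c]) (by simpa using hc)).append h

theorem opSym_ne (b : Bool) : opSym b ≠ lp ∧ opSym b ≠ rp := by simp [opSym]
theorem quSym_ne (b : Bool) : quSym b ≠ lp ∧ quSym b ≠ rp := by simp [quSym]

theorem balanced_bin_body (φ ψ : PosForm σ) (hφ : Balanced (φ.word b))
    (hψ : Balanced (ψ.word b)) : Balanced (φ.word b ++ opSym b :: ψ.word b) :=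
  hφ.append (balanced_cons (opSym_ne b) hψ)

theorem balanced_qu_body (j : ℕ) (φ : PosForm σ) (hφ : Balanced (φ.word b)) :
    Balanced (quSym b :: (varWord j ++ φ.word b)) :=
  balanced_cons (quSym_ne b) ((balanced_varWord j).append hφ)

theorem balanced_word (φ : PosForm σ) : Balanced (φ.word b) := by
  induction φ with
  | rel i t =>
    rw [rel_word]
    refine balanced_cons (by simp) (Balanced.append (balanced_of_forall fun c hc => ?_) ?_)
    · have := ((isBin_bin _).isDigit c hc).ne
      exact ⟨this.1, this.2.1⟩
    · simpa [paren] using (balanced_varWords (List.ofFn t)).paren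
  | eq j k =>
    rw [eq_word]
    exact (balanced_varWord j).append (balanced_cons (by simp) (balanced_varWord k))
  | bin φ ψ ihφ ihψ => simpa [paren, word] using (balanced_bin_body φ ψ ihφ ihψ).paren
  | qu j φ ih => simpa [paren, word] using (balanced_qu_body j φ ih).paren

theorem word_eq_cons (b : Bool) (φ : PosForm σ) :
    ∃ c l, φ.word b = c :: l ∧ ¬ IsDigit c ∧ ∀ x, c ≠ Sum.inl x := by
  cases φ with
  | rel i t => exact ⟨_, _, rel_word i t, by simp [IsDigit], by simp⟩
  | eq j k => exact ⟨_, _, eq_word j k, by simp [IsDigit], by simp⟩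
  | bin φ ψ => exact ⟨_, _, rfl, by simp [IsDigit], by simp⟩
  | qu j φ => exact ⟨_, _, rfl, by simp [IsDigit], by simp⟩

theorem delim_word (φ : PosForm σ) : Delim (φ.word b) := by
  obtain ⟨c, l, h, hc, -⟩ := φ.word_eq_cons b
  rw [h]
  exact delim_cons.2 hc

end PosForm

/-! ### Bound and free occurrences of variables -/

/-- After the word `x` the variable `vw` is bound. -/
def Bd (b : Bool) (vw x : List Sym) : Prop :=
  ∃ x₁ x₂, x = x₁ ++ lp :: quSym b :: (vw ++ x₂) ∧ Delim x₂ ∧ Alive x₂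

/-- At the position between `x` and `y'` there is a free occurrence of the variable `vw`. -/
def FreeAt (b : Bool) (vw x y' : List Sym) : Prop :=
  ∃ y, y' = vw ++ y ∧ Delim y ∧ x.getLast? ≠ some (quSym b) ∧ ¬ Bd b vw x

/-- The variable `vw` occurs freely in `l`. -/
def FreeIn (b : Bool) (vw l : List Sym) : Prop :=
  ∃ x y, l = x ++ y ∧ FreeAt b vw x y

/-- Since `e` closes no parenthesis opened in `u`, binders in `u` stay in force. No binder arises
across the boundary: the cut cannot lie just before the quantifier (`he`), just after it (`hu`), or
inside the variable, because `e` does not begin with a digit (`hD`). -/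
theorem bd_append {b : Bool} {vw u e : List Sym} (hvw : IsVar vw) (hA : Alive e) (hD : Delim e)
    (he : ∀ l, e ≠ quSym b :: l) (hu : u.getLast? ≠ some (quSym b)) :
    Bd b vw (u ++ e) ↔ Bd b vw u ∨ Bd b vw e := by
  constructor
  · rintro ⟨x₁, x₂, h', hd, ha⟩
    rcases List.append_eq_append_iff.1 h' with ⟨a, -, h⟩ | ⟨a, hua, h⟩
    · exact .inr ⟨a, x₂, h, hd, ha⟩
    subst hua
    clear h'
    rcases a with _ | ⟨c, a⟩
    · exact .inr ⟨[], x₂, h.symm, hd, ha⟩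
    simp only [List.cons_append, List.cons.injEq] at h
    obtain ⟨rfl, h⟩ := h
    rcases a with _ | ⟨c, a⟩
    · exact absurd h.symm (he _)
    simp only [List.cons_append, List.cons.injEq] at h
    obtain ⟨rfl, h⟩ := h
    left
    rcases List.append_eq_append_iff.1 h with ⟨a', rfl, rfl⟩ | ⟨a', h', rfl⟩
    · exact ⟨x₁, a', rfl, hd.append_left, ha.append_left⟩
    · rcases a' with _ | ⟨c, a'⟩
      · refine ⟨x₁, [], ?_, delim_nil, by simp [Alive, scan]⟩
        simp only [List.append_nil] at h' ⊢
        rw [h']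
      · exfalso
        obtain ⟨l, rfl, hl⟩ := hvw
        rcases a with _ | ⟨c', a⟩
        · simp at hu
        · simp only [List.cons_append, List.cons.injEq] at h'
          obtain ⟨rfl, rfl⟩ := h'
          exact delim_cons.1 hD (hl.isDigit c (by simp))
  · rintro (⟨x₁, x₂, rfl, hd, ha⟩ | ⟨x₁, x₂, rfl, hd, ha⟩)
    · exact ⟨x₁, x₂ ++ e, by simp, hd.append hD, ha.append_balanced hA⟩
    · exact ⟨u ++ x₁, x₂, by simp, hd, ha⟩

/-- The parenthesis before the quantifier must be closed within a balanced word, whereas `Bd`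
requires it to be still open at the end. -/
theorem Balanced.not_bd {b : Bool} {vw e : List Sym} (h : Balanced e) (hvw : IsVar vw) :
    ¬ Bd b vw e := by
  rintro ⟨x₁, x₂, rfl, -, ha⟩
  obtain ⟨j, rfl⟩ := isVar_iff.1 hvw
  refine h.not_alive ?_
  have : Balanced (quSym b :: varWord j) :=
    PosForm.balanced_cons (PosForm.quSym_ne b) (balanced_varWord j)
  exact this.alive.append_balanced ha

theorem bd_append_balanced {b : Bool} {vw u e : List Sym} (hvw : IsVar vw) (h : Balanced e)
    (hD : Delim e) (he : ∀ l, e ≠ quSym b :: l) (hu : u.getLast? ≠ some (quSym b)) :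
    Bd b vw (u ++ e) ↔ Bd b vw u := by
  rw [bd_append hvw h.alive hD he hu, or_iff_left (h.not_bd hvw)]

theorem bd_append_lp {b : Bool} {vw u : List Sym} (hvw : IsVar vw)
    (hu : u.getLast? ≠ some (quSym b)) : Bd b vw (u ++ [lp]) ↔ Bd b vw u := by
  rw [bd_append hvw (by simp [Alive, scan, scanStep]) (delim_cons.2 not_isDigit_lp)
    (by simp [quSym]) hu, or_iff_left]
  rintro ⟨x₁, x₂, h, -⟩
  have := congrArg List.length h
  simp at this
  omega

theorem bd_quantifier {b : Bool} {i j : ℕ} {u : List Sym} (hu : u.getLast? ≠ some (quSym b)) :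
    Bd b (varWord j) (u ++ lp :: quSym b :: varWord i) ↔ Bd b (varWord j) u ∨ i = j := by
  have hvw : IsVar (varWord j) := isVar_iff.2 ⟨j, rfl⟩
  have hb : Balanced (quSym b :: varWord i) :=
    PosForm.balanced_cons (PosForm.quSym_ne b) (balanced_varWord i)
  rw [bd_append hvw _ (delim_cons.2 not_isDigit_lp) (by simp [quSym]) hu]
  · refine or_congr_right ⟨?_, ?_⟩
    · rintro ⟨x₁, x₂, h, hd, -⟩
      rcases x₁ with _ | ⟨c, x₁⟩
      · simp only [List.nil_append, List.cons.injEq, true_and] at h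
        exact (varWord_append_inj delim_nil hd (by simpa using h)).1
      · simp only [List.cons_append, List.cons.injEq] at h
        have : lp ∈ quSym b :: varWord i := by rw [h.2]; simp
        rcases List.mem_cons.1 this with h | h
        · simp [quSym] at h
        · rcases mem_varWord h with h | h
          · simp at h
          · exact absurd h not_isDigit_lp
    · rintro rfl
      exact ⟨[], [], by simp, delim_nil, by simp [Alive, scan]⟩
  · have h : ∀ l, scan (lp :: l) 0 = scan l 1 := fun l => by simp [scan, scanStep]
    rw [Alive, h, hb.scan]
    simp

theorem getLast?_append_ne {b : Bool} {u e : List Sym} (he : e ≠ []) (h : quSym b ∉ e) :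
    (u ++ e).getLast? ≠ some (quSym b) := by
  rw [List.getLast?_append_of_ne_nil _ he]
  exact fun h' => h (List.mem_of_getLast? h')

theorem not_freeAt_cons {b : Bool} {j : ℕ} {u y : List Sym} {c : Sym} (hc : c ≠ vSym) :
    ¬ FreeAt b (varWord j) u (c :: y) := by
  rintro ⟨y', h, -⟩
  exact hc (List.cons.inj h).1

theorem freeIn_iff {b : Bool} {j : ℕ} {l : List Sym} :
    FreeIn b (varWord j) l ↔ Cur (FreeAt b (varWord j)) [] l [] := by
  rw [cur_iff]
  constructor
  · rintro ⟨x, y, rfl, h⟩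
    refine ⟨x, y, rfl, ?_, by simpa using h⟩
    rintro rfl
    obtain ⟨y, h, -⟩ := h
    simp [varWord] at h
  · rintro ⟨x, y, rfl, -, h⟩
    exact ⟨x, y, rfl, by simpa using h⟩

/-- An occurrence begins with the letter `v`, which a variable word contains only in front. `hz`
prevents the numeral from continuing into `z`. -/
theorem cur_freeAt_varWord {b : Bool} {i j : ℕ} {u z : List Sym} (hz : Delim z) :
    Cur (FreeAt b (varWord j)) u (varWord i) z ↔
      i = j ∧ u.getLast? ≠ some (quSym b) ∧ ¬ Bd b (varWord j) u := by
  have h1 : ¬ Cur (FreeAt b (varWord j)) (u ++ [vSym]) (bin i) z :=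
    not_cur_of_forall (fun c hc u y => not_freeAt_cons ((isBin_bin i).isDigit c hc).ne.2.2.1) _ _
  show FreeAt b (varWord j) u (varWord i ++ z) ∨ Cur _ (u ++ [vSym]) (bin i) z ↔ _
  rw [or_iff_left h1]
  constructor
  · rintro ⟨y, h, hy, h'⟩
    exact ⟨(varWord_append_inj hz hy h).1, h'⟩
  · rintro ⟨rfl, h'⟩
    exact ⟨z, rfl, hz, h'⟩

theorem cur_freeAt_varWords {b : Bool} {j : ℕ} {z : List Sym} (hz : Delim z) (l : List ℕ) :
    ∀ {u : List Sym}, u.getLast? ≠ some (quSym b) →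
    (Cur (FreeAt b (varWord j)) u (l.flatMap varWord) z ↔ j ∈ l ∧ ¬ Bd b (varWord j) u) := by
  induction l with
  | nil => simp [Cur]
  | cons i l ih =>
    intro u hu
    have hD : Delim (l.flatMap varWord ++ z) := by
      cases l with
      | nil => simpa using hz
      | cons k l => simpa using delim_varWord_append _ _
    have hvw : IsVar (varWord j) := isVar_iff.2 ⟨j, rfl⟩
    rw [List.flatMap_cons, cur_append, cur_freeAt_varWord hD,
      ih (getLast?_append_ne (by simp [varWord]) (quSym_notMem_varWord b i)),
      bd_append_balanced hvw (balanced_varWord i)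
        (by simpa using delim_varWord_append i []) (by simp [varWord, quSym]) hu]
    simp only [List.mem_cons, eq_comm (a := j)]
    tauto

namespace PosForm

variable {σ : Signature} {b : Bool}

theorem getLast?_append_word (u : List Sym) (φ : PosForm σ) :
    (u ++ φ.word b).getLast? ≠ some (quSym b) := by
  have h : ∀ l, (l ++ [rp]).getLast? ≠ some (quSym b) := fun l => by simp [quSym]
  cases φ with
  | rel i t =>
    have := h (u ++ Sum.inr AuxSym.R :: (FOModelChecking.bin (i + 1) ++
      (lp :: (List.ofFn t).flatMap varWord)))
    simpa only [rel_word, List.append_assoc, List.cons_append] using this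
  | eq j k =>
    have := getLast?_append_ne (u := u ++ varWord j ++ [eqSym]) (by simp [varWord])
      (quSym_notMem_varWord b k)
    rw [eq_word]
    simpa only [List.append_assoc, List.singleton_append] using this
  | bin φ ψ =>
    have := h (u ++ lp :: (φ.word b ++ opSym b :: ψ.word b))
    simpa only [word, List.append_assoc, List.cons_append] using this
  | qu j φ =>
    have := h (u ++ lp :: quSym b :: (varWord j ++ φ.word b))
    simpa only [word, List.append_assoc, List.cons_append] using this

/-- The left context `u` is arbitrary because the binders of a subformula stand outside its own
word. Complete subformulas are balanced and so leave the set of bound variables unchanged, while the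
prefix of `qu i φ` adds `v_i`, in accordance with `vars`. The variable directly after the quantifier
is excluded by the last-letter condition in `FreeAt`. -/
theorem cur_freeAt_word {j : ℕ} (φ : PosForm σ) : ∀ {u z : List Sym}, Delim z →
    u.getLast? ≠ some (quSym b) →
    (Cur (FreeAt b (varWord j)) u (φ.word b) z ↔ j ∈ φ.vars ∧ ¬ Bd b (varWord j) u) := by
  have hvw : IsVar (varWord j) := isVar_iff.2 ⟨j, rfl⟩
  induction φ with
  | rel i t =>
    intro u z hz hu
    rw [rel_word]
    set e : List Sym := Sum.inr AuxSym.R :: FOModelChecking.bin (i + 1) with he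
    have h1 : Sum.inr AuxSym.R :: (FOModelChecking.bin (i + 1) ++
        (lp :: ((List.ofFn t).flatMap varWord ++ [rp]))) =
        e ++ ([lp] ++ ((List.ofFn t).flatMap varWord ++ [rp])) := by simp [he]
    have hd : ∀ c ∈ e, c ≠ lp ∧ c ≠ rp ∧ c ≠ vSym ∧ c ≠ quSym b := by
      intro c hc
      rcases List.mem_cons.1 hc with rfl | hc
      · simp [quSym]
      · have := ((isBin_bin _).isDigit c hc).ne
        exact ⟨this.1, this.2.1, this.2.2.1, this.2.2.2.2 _⟩
    have hbe : Balanced e := balanced_of_forall fun c hc => ⟨(hd c hc).1, (hd c hc).2.1⟩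
    have hue : (u ++ e).getLast? ≠ some (quSym b) :=
      getLast?_append_ne (by simp [he]) fun h => (hd _ h).2.2.2 rfl
    have hrp : Delim ([rp] ++ z) := delim_cons.2 not_isDigit_rp
    have hlp : (u ++ e ++ [lp]).getLast? ≠ some (quSym b) := by simp [quSym]
    rw [h1, cur_append, cur_append, cur_append,
      cur_freeAt_varWords hrp _ hlp,
      bd_append_lp hvw hue, bd_append_balanced hvw hbe (delim_cons.2 not_isDigit_R)
        (by simp [he, quSym]) hu]
    have h2 : ∀ u z, ¬ Cur (FreeAt b (varWord j)) u e z :=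
      not_cur_of_forall fun c hc u y => not_freeAt_cons (hd c hc).2.2.1
    have h3 : ∀ u z, ¬ Cur (FreeAt b (varWord j)) u [lp] z :=
      not_cur_of_forall fun c hc u y => not_freeAt_cons (by simp at hc; simp [hc])
    have h4 : ∀ u z, ¬ Cur (FreeAt b (varWord j)) u [rp] z :=
      not_cur_of_forall fun c hc u y => not_freeAt_cons (by simp at hc; simp [hc])
    simp only [h2, h3, h4, false_or, or_false, vars]
    simp [List.mem_ofFn]
  | eq i k =>
    intro u z hz hu
    have h1 : varWord i ++ eqSym :: varWord k = varWord i ++ ([eqSym] ++ varWord k) := by simp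
    have h3 : ∀ u z, ¬ Cur (FreeAt b (varWord j)) u [eqSym] z :=
      not_cur_of_forall fun c hc u y => not_freeAt_cons (by simp at hc; simp [hc])
    have hu' : (u ++ varWord i).getLast? ≠ some (quSym b) :=
      getLast?_append_ne (by simp [varWord]) (quSym_notMem_varWord b i)
    have hu'' : (u ++ varWord i ++ [eqSym]).getLast? ≠ some (quSym b) := by
      cases b <;> simp [quSym, quLog]
    have hbe : Balanced [eqSym] := rfl
    rw [eq_word, h1, cur_append, cur_append,
      cur_freeAt_varWord (by simpa using delim_cons.2 (not_isDigit_inl _)),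
      cur_freeAt_varWord hz,
      bd_append_balanced hvw hbe (delim_cons.2 (not_isDigit_inl _))
        (by cases b <;> simp [quSym, quLog]) hu',
      bd_append_balanced hvw (balanced_varWord i) (by simpa using delim_varWord_append i [])
        (by simp [varWord, quSym]) hu]
    simp only [h3, hu, hu'', vars, Set.mem_insert_iff, Set.mem_singleton_iff, eq_comm (a := j),
      not_false_eq_true, false_or, true_and, ne_eq]
    tauto
  | bin φ ψ ihφ ihψ =>
    intro u z hz hu
    have h1 : (PosForm.bin φ ψ).word b =
      [lp] ++ (φ.word b ++ ([opSym b] ++ (ψ.word b ++ [rp]))) := by simp [word]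
    have h2 : ∀ c : Sym, c ≠ vSym → ∀ u z, ¬ Cur (FreeAt b (varWord j)) u [c] z :=
      fun c hc => not_cur_of_forall fun d hd u y => not_freeAt_cons (by simp at hd; simp [hd, hc])
    obtain ⟨c, l, hcl, hc, hc'⟩ := φ.word_eq_cons b
    have hop : opSym b ≠ quSym b := by cases b <;> simp [opSym, quSym, opLog, quLog]
    have hφl := φ.getLast?_append_word (b := b) (u ++ [lp])
    have hz1 : Delim ([opSym b] ++ (ψ.word b ++ [rp]) ++ z) := delim_cons.2 (not_isDigit_inl _)
    have hz2 : Delim ([rp] ++ z) := delim_cons.2 not_isDigit_rp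
    have hl : (u ++ [lp]).getLast? ≠ some (quSym b) := by simp [quSym]
    have ho : (u ++ [lp] ++ φ.word b ++ [opSym b]).getLast? ≠ some (quSym b) := by
      rw [List.getLast?_append_of_ne_nil _ (by simp)]
      simpa using hop
    have hbo : Balanced [opSym b] := by simp [Balanced, scan, scanStep, opSym]
    rw [h1, cur_append, cur_append, cur_append, cur_append,
      ihφ hz1 hl, ihψ hz2 ho, bd_append_balanced hvw hbo (delim_cons.2 (not_isDigit_inl _))
        (by simp [hop]) hφl,
      bd_append_balanced hvw φ.balanced_word φ.delim_word (by
        intro l' h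
        rw [hcl] at h
        exact hc' _ (List.cons.inj h).1) hl,
      bd_append_lp hvw hu]
    simp only [h2 lp (by simp), h2 rp (by simp), h2 (opSym b) (by simp [opSym]), vars,
      false_or, or_false, Set.mem_union]
    tauto
  | qu i φ ih =>
    intro u z hz hu
    have h1 : (PosForm.qu i φ).word b =
      [lp] ++ ([quSym b] ++ (varWord i ++ (φ.word b ++ [rp]))) := by simp [word]
    have h2 : ∀ c : Sym, c ≠ vSym → ∀ u z, ¬ Cur (FreeAt b (varWord j)) u [c] z :=
      fun c hc => not_cur_of_forall fun d hd u y => not_freeAt_cons (by simp at hd; simp [hd, hc])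
    have h3 : u ++ [lp] ++ [quSym b] ++ varWord i = u ++ lp :: quSym b :: varWord i := by simp
    have hz2 : Delim ([rp] ++ z) := delim_cons.2 not_isDigit_rp
    have hz1 : Delim (φ.word b ++ [rp] ++ z) := by
      rw [List.append_assoc]
      exact φ.delim_word.append hz2
    have hl : (u ++ lp :: quSym b :: varWord i).getLast? ≠ some (quSym b) := by
      rw [← h3]
      exact getLast?_append_ne (by simp [varWord]) (quSym_notMem_varWord b i)
    rw [h1, cur_append, cur_append, cur_append, cur_append,
      cur_freeAt_varWord hz1, h3, ih hz2 hl, bd_quantifier hu]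
    simp only [h2 lp (by simp), h2 rp (by simp), h2 (quSym b) (by simp [quSym]), vars]
    simp only [List.getLast?_append, false_or, or_false, Set.mem_sdiff, Set.mem_singleton_iff,
      eq_comm (a := j)]
    simp
    tauto

theorem freeIn_word {j : ℕ} (φ : PosForm σ) :
    FreeIn b (varWord j) (φ.word b) ↔ j ∈ φ.vars := by
  rw [freeIn_iff, cur_freeAt_word φ delim_nil (by simp), and_iff_left]
  rintro ⟨x₁, x₂, h, -⟩
  have := congrArg List.length h
  simp at this

end PosForm

end FOModelChecking

/-! ### Recognising formulas and sentences by conditions on factors -/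

namespace FOModelChecking

variable {σ : Signature} {b : Bool} {e : Prop}

/-- The word contains a logical symbol. -/
def HasLog (l : List Sym) : Prop := ∃ x, Sum.inl x ∈ l

variable (σ e) in
/-- Words for atoms. -/
def IsAtomWord (l : List Sym) : Prop :=
  (∃ (i : Fin σ.card) (t : Fin (σ.arity i) → ℕ), l = (Formula.rel i t).word) ∨
    (e ∧ ∃ j k, l = varWord j ++ eqSym :: varWord k)

variable (σ e) in
/-- Words that are atoms or have the outer form of a compound formula. -/
def Looks (l : List Sym) : Prop :=
  IsAtomWord σ e l ∨ ∃ m, l = lp :: (m ++ [rp]) ∧ Balanced m ∧ HasLog m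

variable (σ b e) in
/-- The text between the outer parentheses of a compound formula, without regard to the inner
structure of the immediate subformulas. -/
def OkBody (m : List Sym) : Prop :=
  (∃ l₁ l₂, m = l₁ ++ opSym b :: l₂ ∧ Looks σ e l₁ ∧ Looks σ e l₂) ∨
    ∃ vw l, m = quSym b :: (vw ++ l) ∧ IsVar vw ∧ Looks σ e l ∧ FreeIn b vw l

variable (σ b e) in
/-- At the beginning of `y` there is a parenthesis that does not enclose a compound formula. -/
def BadAt (y : List Sym) : Prop :=
  ∃ m z, y = lp :: (m ++ rp :: z) ∧ Balanced m ∧ HasLog m ∧ ¬ OkBody σ b e m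

theorem not_badAt_cons {c : Sym} (hc : c ≠ lp) (y : List Sym) : ¬ BadAt σ b e (c :: y) := by
  rintro ⟨m, z, h, -⟩
  exact hc (List.cons.inj h).1

/-- The opening parenthesis determines its partner, so `m` is the only candidate. -/
theorem badAt_iff {m z : List Sym} (hm : Balanced m) :
    BadAt σ b e (lp :: (m ++ rp :: z)) ↔ HasLog m ∧ ¬ OkBody σ b e m := by
  constructor
  · rintro ⟨m', z', h, hm', h'⟩
    obtain rfl := hm.eq_of_append hm' (List.cons.inj h).2
    exact h'
  · exact fun h => ⟨m, z, rfl, hm, h⟩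

namespace PosForm

theorem looks_word {φ : PosForm σ} (h : φ.EqOk e) : Looks σ e (φ.word b) := by
  cases φ with
  | rel i t => exact .inl (.inl ⟨i, t, rfl⟩)
  | eq j k => exact .inl (.inr ⟨h, j, k, eq_word j k⟩)
  | bin φ ψ =>
    exact .inr ⟨φ.word b ++ opSym b :: ψ.word b, by simp [word],
      balanced_bin_body φ ψ φ.balanced_word ψ.balanced_word, opLog b, by simp [opSym]⟩
  | qu j φ =>
    exact .inr ⟨quSym b :: (varWord j ++ φ.word b), by simp [word],
      balanced_qu_body j φ φ.balanced_word, quLog b, by simp [quSym]⟩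

/-- A `(` in the word of a formula either encloses the arguments of a relation symbol, where no
logical symbol occurs, or is the outer parenthesis of a compound subformula. `HasLog` separates the
two cases. -/
theorem not_cur_badAt_word {φ : PosForm σ} (hφ : φ.Wf) (he : φ.EqOk e) :
    ∀ u z, ¬ Cur (fun _ => BadAt σ b e) u (φ.word b) z := by
  have hc : ∀ c : Sym, c ≠ lp → ∀ u z, ¬ Cur (fun _ => BadAt σ b e) u [c] z :=
    fun c hc => not_cur_of_forall fun d hd u y => by
      simp only [List.mem_singleton] at hd
      exact not_badAt_cons (hd ▸ hc) y
  have hv : ∀ j u z, ¬ Cur (fun _ => BadAt σ b e) u (varWord j) z :=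
    fun j => not_cur_of_forall fun d hd u y => not_badAt_cons (by
      rintro rfl
      rcases mem_varWord hd with h | h
      · simp at h
      · exact not_isDigit_lp h) y
  induction φ with
  | rel i t =>
    intro u z
    have h1 : (rel i t).word b = [Sum.inr AuxSym.R] ++ (FOModelChecking.bin (i + 1) ++ ([lp] ++
        ((List.ofFn t).flatMap varWord ++ [rp]))) := by simp [rel_word]
    have h2 : ∀ u z, ¬ Cur (fun _ => BadAt σ b e) u (FOModelChecking.bin (i + 1)) z :=
      not_cur_of_forall fun d hd u y => not_badAt_cons ((isBin_bin _).isDigit d hd).ne.1 y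
    have h3 : ∀ u z, ¬ Cur (fun _ => BadAt σ b e) u ((List.ofFn t).flatMap varWord) z :=
      not_cur_of_forall fun d hd u y => not_badAt_cons (by
        rintro rfl
        obtain ⟨j, -, hd⟩ := List.mem_flatMap.1 hd
        rcases mem_varWord hd with h | h
        · simp at h
        · exact not_isDigit_lp h) y
    rw [h1]
    simp only [cur_append, hc (Sum.inr AuxSym.R) (by simp), h2, h3, hc rp (by simp), false_or,
      or_false]
    show ¬ (BadAt σ b e ([lp] ++ ((List.ofFn t).flatMap varWord ++ [rp] ++ z)) ∨ False)
    rw [or_false]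
    have h4 : [lp] ++ ((List.ofFn t).flatMap varWord ++ [rp] ++ z) =
      lp :: ((List.ofFn t).flatMap varWord ++ rp :: z) := by simp
    rw [h4, badAt_iff (balanced_varWords _)]
    rintro ⟨⟨x, hx⟩, -⟩
    obtain ⟨j, -, hd⟩ := List.mem_flatMap.1 hx
    rcases mem_varWord hd with h | h
    · simp at h
    · exact not_isDigit_inl _ h
  | eq j k =>
    intro u z
    have h1 : varWord j ++ eqSym :: varWord k = varWord j ++ ([eqSym] ++ varWord k) := by simp
    rw [eq_word, h1, cur_append, cur_append]
    simp only [hv, hc eqSym (by simp), or_false, not_false_eq_true]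
  | bin φ ψ ihφ ihψ =>
    intro u z
    have h1 : (PosForm.bin φ ψ).word b =
      [lp] ++ (φ.word b ++ ([opSym b] ++ (ψ.word b ++ [rp]))) := by simp [word]
    rw [h1]
    simp only [cur_append, ihφ hφ.1 he.1, ihψ hφ.2 he.2, hc rp (by simp),
      hc _ (opSym_ne b).1, or_false]
    show ¬ (BadAt σ b e ([lp] ++ (φ.word b ++ ([opSym b] ++ (ψ.word b ++ [rp])) ++ z)) ∨ False)
    have h4 : [lp] ++ (φ.word b ++ ([opSym b] ++ (ψ.word b ++ [rp])) ++ z) =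
      lp :: ((φ.word b ++ opSym b :: ψ.word b) ++ rp :: z) := by simp
    rw [or_false, h4, badAt_iff (balanced_bin_body φ ψ φ.balanced_word ψ.balanced_word)]
    exact fun h => h.2 (.inl ⟨_, _, rfl, looks_word he.1, looks_word he.2⟩)
  | qu j φ ih =>
    intro u z
    have h1 : (PosForm.qu j φ).word b =
      [lp] ++ ([quSym b] ++ (varWord j ++ (φ.word b ++ [rp]))) := by simp [word]
    rw [h1]
    simp only [cur_append, ih hφ.2 he, hc rp (by simp), hc _ (quSym_ne b).1, hv, or_false]
    show ¬ (BadAt σ b e ([lp] ++ ([quSym b] ++ (varWord j ++ (φ.word b ++ [rp])) ++ z)) ∨ False)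
    have h4 : [lp] ++ ([quSym b] ++ (varWord j ++ (φ.word b ++ [rp])) ++ z) =
      lp :: ((quSym b :: (varWord j ++ φ.word b)) ++ rp :: z) := by simp
    rw [or_false, h4, badAt_iff (balanced_qu_body j φ φ.balanced_word)]
    exact fun h => h.2 (.inr ⟨_, _, rfl, isVar_iff.2 ⟨j, rfl⟩, looks_word he,
      φ.freeIn_word.2 hφ.1⟩)

/-- Words whose parenthesised factors all have the right outer form are formulas. -/
theorem exists_word_eq (n : ℕ) : ∀ l : List Sym, l.length ≤ n → Looks σ e l →
    (∀ x y, l = x ++ y → ¬ BadAt σ b e y) → ∃ φ : PosForm σ, φ.Wf ∧ φ.EqOk e ∧ φ.word b = l := by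
  induction n with
  | zero =>
    intro l hl h
    obtain rfl := List.length_eq_zero_iff.1 (Nat.le_zero.1 hl)
    rcases h with (⟨i, t, h⟩ | ⟨-, j, k, h⟩) | ⟨m, h, -⟩ <;> simp [Formula.word, varWord] at h
  | succ n ih =>
    intro l hl h hbad
    rcases h with (⟨i, t, rfl⟩ | ⟨he, j, k, rfl⟩) | ⟨m, rfl, hm, hlog⟩
    · exact ⟨rel i t, trivial, trivial, rfl⟩
    · exact ⟨eq j k, trivial, he, eq_word j k⟩
    -- The whole word is itself one of its parenthesised factors.
    · have hok : OkBody σ b e m := by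
        have h := hbad [] _ rfl
        rw [badAt_iff hm] at h
        exact by_contra fun hn => h ⟨hlog, hn⟩
      -- Badness of a position does not depend on what follows the closing parenthesis, so a bad
      -- position in a part of `m` would be bad in the whole word.
      have hsub : ∀ u l v, m = u ++ l ++ v → ∀ x y, l = x ++ y → ¬ BadAt σ b e y := by
        rintro u l v rfl x y rfl ⟨m', z, rfl, hm', hlog', hok'⟩
        exact hbad (lp :: (u ++ x)) (lp :: (m' ++ rp :: (z ++ (v ++ [rp])))) (by simp)
          ⟨m', _, rfl, hm', hlog', hok'⟩
      rcases hok with ⟨l₁, l₂, rfl, h₁, h₂⟩ | ⟨vw, l, rfl, hvw, h₁, hfree⟩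
      · simp only [List.length_cons, List.length_append, List.length_nil] at hl
        obtain ⟨φ, hφ, hφe, rfl⟩ := ih l₁ (by omega) h₁ (hsub [] _ (opSym b :: l₂) (by simp))
        obtain ⟨ψ, hψ, hψe, rfl⟩ := ih l₂ (by omega) h₂
          (hsub (φ.word b ++ [opSym b]) _ [] (by simp))
        exact ⟨.bin φ ψ, ⟨hφ, hψ⟩, ⟨hφe, hψe⟩, by simp [word]⟩
      · obtain ⟨j, rfl⟩ := isVar_iff.1 hvw
        simp only [List.length_cons, List.length_append, List.length_nil] at hl
        obtain ⟨φ, hφ, hφe, rfl⟩ := ih l (by omega) h₁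
          (hsub (quSym b :: varWord j) _ [] (by simp))
        -- Now that `l` is known to be the word of `φ`, the textual notion of freeness can be turned
        -- into membership in `vars`.
        exact ⟨.qu j φ, ⟨φ.freeIn_word.1 hfree, hφ⟩, hφe, by simp [word]⟩

end PosForm

/-! ### Atoms in words -/

variable {G : (i : Fin σ.card) → (Fin (σ.arity i) → ℕ) → Prop} {H : ℕ → ℕ → Prop}

/-- The word begins with an atom that has a given property. -/
def AtomAt (G : (i : Fin σ.card) → (Fin (σ.arity i) → ℕ) → Prop) (H : ℕ → ℕ → Prop)
    (y : List Sym) : Prop :=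
  (∃ i t z, y = (Formula.rel i t : Formula σ).word ++ z ∧ G i t) ∨
    ∃ j k z, y = varWord j ++ eqSym :: (varWord k ++ z) ∧ Delim z ∧ H j k

theorem not_atomAt_cons {c : Sym} (hc : c ≠ Sum.inr AuxSym.R) (hc' : c ≠ vSym) (y : List Sym) :
    ¬ AtomAt G H (c :: y) := by
  rintro (⟨i, t, z, h, -⟩ | ⟨j, k, z, h, -⟩)
  · exact hc (List.cons.inj h).1
  · exact hc' (List.cons.inj h).1

theorem not_cur_atomAt_bin (n : ℕ) (u z : List Sym) :
    ¬ Cur (fun _ => AtomAt G H) u (bin n) z :=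
  not_cur_of_forall (fun c hc _ y => by
    have := ((isBin_bin n).isDigit c hc).ne
    exact not_atomAt_cons this.2.2.2.1 this.2.2.1 y) u z

/-- A variable begins an atom only as the left side of an equation. -/
theorem not_cur_atomAt_varWord {i : ℕ} {u z : List Sym} (hz : Delim z)
    (hz' : ∀ l, z ≠ eqSym :: l) : ¬ Cur (fun _ => AtomAt G H) u (varWord i) z := by
  show ¬ (AtomAt G H (varWord i ++ z) ∨ Cur _ (u ++ [vSym]) (bin i) z)
  rw [not_or]
  refine ⟨?_, not_cur_atomAt_bin _ _ _⟩
  rintro (⟨i, t, z, h, -⟩ | ⟨j, k, z, h, -⟩)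
  · simp [varWord, Formula.word] at h
  · exact hz' _ (varWord_append_inj hz (delim_cons.2 (not_isDigit_inl _)) h).2

theorem not_cur_atomAt_varWords (l : List ℕ) {z : List Sym} : ∀ u,
    ¬ Cur (fun _ => AtomAt G H) u (l.flatMap varWord) (rp :: z) := by
  induction l with
  | nil => simp [Cur]
  | cons i l ih =>
    intro u
    rw [List.flatMap_cons, cur_append, not_or]
    refine ⟨not_cur_atomAt_varWord ?_ ?_, ih _⟩
    · cases l with
      | nil => simpa using delim_cons.2 not_isDigit_rp
      | cons k l => simpa using delim_varWord_append _ _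
    · cases l <;> simp [varWord]

theorem flatMap_varWord_injective {l : List ℕ} : ∀ {l' : List ℕ},
    l.flatMap varWord = l'.flatMap varWord → l = l' := by
  have hD : ∀ l : List ℕ, Delim (l.flatMap varWord) := by
    intro l
    cases l with
    | nil => exact delim_nil
    | cons k l => exact delim_varWord_append _ _
  induction l with
  | nil =>
    intro l' h
    cases l' with
    | nil => rfl
    | cons k l' => simp [varWord] at h
  | cons i l ih =>
    intro l' h
    cases l' with
    | nil => simp [varWord] at h
    | cons k l' =>
      obtain ⟨rfl, h'⟩ := varWord_append_inj (hD l) (hD l') h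
      rw [ih h']

/-- Unique readability: the numeral fixes the relation symbol, the matching parenthesis fixes the
text of the arguments, and this text fixes the variables. -/
theorem atomAt_rel {i : Fin σ.card} {t : Fin (σ.arity i) → ℕ} {z : List Sym} :
    AtomAt G H ((Formula.rel i t : Formula σ).word ++ z) ↔ G i t := by
  constructor
  · rintro (⟨i', t', z', h, h'⟩ | ⟨j, k, z', h, -⟩)
    · have h1 : ∀ i (t : Fin (σ.arity i) → ℕ) z, (Formula.rel i t : Formula σ).word ++ z =
          Sum.inr AuxSym.R :: (bin (i + 1) ++ (lp :: ((List.ofFn t).flatMap varWord ++ rp :: z))) :=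
        fun i t z => by simp [Formula.word, paren]
      rw [h1, h1] at h
      obtain ⟨hi, h⟩ := bin_append_inj (delim_cons.2 not_isDigit_lp) (delim_cons.2 not_isDigit_lp)
        (List.cons.inj h).2
      obtain rfl : i = i' := Fin.ext (by omega)
      have h := (balanced_varWords _).eq_of_append (balanced_varWords _) (List.cons.inj h).2
      obtain rfl := List.ofFn_injective (flatMap_varWord_injective h)
      exact h'
    · simp [varWord, Formula.word] at h
  · exact fun h => .inl ⟨i, t, z, rfl, h⟩

/-- The `Delim` condition in `AtomAt` prevents the right-hand variable from being read as one with a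
shorter numeral. -/
theorem atomAt_eq {j k : ℕ} {z : List Sym} (hz : Delim z) :
    AtomAt G H (varWord j ++ eqSym :: (varWord k ++ z)) ↔ H j k := by
  constructor
  · rintro (⟨i', t', z', h, h'⟩ | ⟨j', k', z', h, hz', h'⟩)
    · simp [varWord, Formula.word] at h
    · obtain ⟨rfl, h2⟩ := varWord_append_inj (delim_cons.2 (not_isDigit_inl _))
        (delim_cons.2 (not_isDigit_inl _)) h
      obtain ⟨rfl, -⟩ := varWord_append_inj hz hz' (List.cons.inj h2).2
      exact h'
  · exact fun h => .inr ⟨j, k, z, rfl, hz, h⟩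

namespace PosForm

/-- No atom can be read at a position where the formula has none. The critical positions are
variables that are not the left side of an equation: a quantified variable is followed by a formula,
which does not begin with `=`, and for the right side of an equation the condition on `z` is needed.
-/
theorem cur_atomAt_word (φ : PosForm σ) : ∀ {u z : List Sym}, Delim z →
    (∀ l, z ≠ eqSym :: l) → (Cur (fun _ => AtomAt G H) u (φ.word b) z ↔ φ.AtomEx G H) := by
  have hc : ∀ c : Sym, c ≠ Sum.inr AuxSym.R → c ≠ vSym → ∀ u z,
      ¬ Cur (fun _ => AtomAt G H) u [c] z :=
    fun c hc hc' => not_cur_of_forall fun d hd u y => by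
      simp only [List.mem_singleton] at hd
      exact not_atomAt_cons (hd ▸ hc) (hd ▸ hc') y
  induction φ with
  | rel i t =>
    intro u z hz hz'
    have h1 : (rel i t).word b = Sum.inr AuxSym.R :: (FOModelChecking.bin (i + 1) ++ ([lp] ++
        ((List.ofFn t).flatMap varWord ++ [rp]))) := by simp [rel_word]
    rw [AtomEx, ← atomAt_rel (G := G) (H := H) (z := z)]
    change _ ↔ AtomAt G H ((rel i t).word b ++ z)
    rw [h1, Cur, cur_append, cur_append, cur_append]
    have h3 : ∀ u, ¬ Cur (fun _ => AtomAt G H) u ((List.ofFn t).flatMap varWord) ([rp] ++ z) :=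
      not_cur_atomAt_varWords _
    simp only [not_cur_atomAt_bin, hc lp (by simp) (by simp), hc rp (by simp) (by simp), h3,
      or_false]
  | eq j k =>
    intro u z hz hz'
    have h1 : varWord j ++ eqSym :: varWord k = varWord j ++ ([eqSym] ++ varWord k) := by simp
    rw [eq_word, h1, cur_append, cur_append]
    simp only [hc eqSym (by simp) (by simp), not_cur_atomAt_varWord hz hz', or_false]
    show AtomAt G H (varWord j ++ ([eqSym] ++ varWord k ++ z)) ∨
      Cur _ (u ++ [vSym]) (FOModelChecking.bin j) _ ↔ _
    rw [or_iff_left (not_cur_atomAt_bin _ _ _)]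
    simpa [AtomEx] using atomAt_eq (G := G) (H := H) (j := j) (k := k) hz
  | bin φ ψ ihφ ihψ =>
    intro u z hz hz'
    have h1 : (PosForm.bin φ ψ).word b =
      [lp] ++ (φ.word b ++ ([opSym b] ++ (ψ.word b ++ [rp]))) := by simp [word]
    have hz1 : Delim ([opSym b] ++ (ψ.word b ++ [rp]) ++ z) := delim_cons.2 (not_isDigit_inl _)
    have hz2 : Delim ([rp] ++ z) := delim_cons.2 not_isDigit_rp
    rw [h1, cur_append, cur_append, cur_append, cur_append,
      ihφ hz1 (by cases b <;> simp [opSym, opLog]), ihψ hz2 (by simp)]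
    simp [hc, opSym, AtomEx]
  | qu j φ ih =>
    intro u z hz hz'
    have h1 : (PosForm.qu j φ).word b =
      [lp] ++ ([quSym b] ++ (varWord j ++ (φ.word b ++ [rp]))) := by simp [word]
    have hz2 : Delim ([rp] ++ z) := delim_cons.2 not_isDigit_rp
    have hz1 : Delim (φ.word b ++ [rp] ++ z) := by
      rw [List.append_assoc]
      exact φ.delim_word.append hz2
    obtain ⟨c, l, hcl, -, hc'⟩ := φ.word_eq_cons b
    have hz1' : ∀ l', φ.word b ++ [rp] ++ z ≠ eqSym :: l' := by
      intro l' h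
      rw [hcl] at h
      exact hc' _ (List.cons.inj h).1
    rw [h1, cur_append, cur_append, cur_append, cur_append, ih hz2 (by simp)]
    simp only [hc lp (by simp) (by simp), hc rp (by simp) (by simp),
      hc (quSym b) (by simp [quSym]) (by simp [quSym]), not_cur_atomAt_varWord hz1 hz1', or_false,
      false_or, AtomEx]

theorem atomEx_iff (φ : PosForm σ) :
    φ.AtomEx G H ↔ ∃ x y, φ.word b = x ++ y ∧ AtomAt G H y := by
  rw [← cur_atomAt_word (b := b) (u := []) φ delim_nil (by simp), cur_iff]
  constructor
  · rintro ⟨x, y, h, -, h'⟩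
    exact ⟨x, y, h, by simpa using h'⟩
  · rintro ⟨x, y, h, h'⟩
    refine ⟨x, y, h, ?_, by simpa using h'⟩
    rintro rfl
    rcases h' with ⟨i, t, z, h, -⟩ | ⟨j, k, z, h, -⟩ <;> simp [Formula.word, varWord] at h

end PosForm

variable (σ b e) in
/-- The word is the written form of a sentence. -/
def IsSentenceWord (w : List Sym) : Prop :=
  Looks σ e w ∧ (∀ x y, w = x ++ y → ¬ BadAt σ b e y) ∧
    ∀ x y, w = x ++ y → ∀ vw z, y = vw ++ z → IsVar vw → ¬ FreeIn b vw w

/-- A free variable of the formula occurs in its word, so only the variables among the factors of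
`w` have to be tested. -/
theorem isSentenceWord_iff {w : List Sym} :
    IsSentenceWord σ b e w ↔
      ∃ φ : PosForm σ, φ.Wf ∧ φ.EqOk e ∧ φ.vars = ∅ ∧ φ.word b = w := by
  constructor
  · rintro ⟨h1, h2, h3⟩
    obtain ⟨φ, hφ, he, rfl⟩ := PosForm.exists_word_eq _ w le_rfl h1 h2
    refine ⟨φ, hφ, he, Set.eq_empty_iff_forall_notMem.2 fun j hj => ?_, rfl⟩
    have h := φ.freeIn_word (b := b).2 hj
    obtain ⟨x, y, hxy, z, rfl, -⟩ := id h
    exact h3 x _ hxy _ z rfl (isVar_iff.2 ⟨j, rfl⟩) h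
  · rintro ⟨φ, hφ, he, hv, rfl⟩
    refine ⟨PosForm.looks_word he, fun x y hxy hb => ?_, fun x y _ vw z _ hvw hf => ?_⟩
    · refine PosForm.not_cur_badAt_word (b := b) hφ he [] [] ?_
      rw [cur_iff]
      refine ⟨x, y, hxy, ?_, by simpa using hb⟩
      rintro rfl
      obtain ⟨m, z, h, -⟩ := hb
      simp at h
    · obtain ⟨j, rfl⟩ := isVar_iff.1 hvw
      have := φ.freeIn_word.1 hf
      rw [hv] at this
      exact this

/-! ### Truth of a sentence in terms of its atoms -/

section MC

variable {D : Type*} (A : σ.Struct D) {Γ : Set LogSym}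

theorem mem_MC_iff (ho : opLog b ∈ Γ) (hq : quLog b ∈ Γ)
    (hΓ : Γ ⊆ {opLog b, quLog b, LogSym.eq}) {w : List Sym} :
    w ∈ MC Γ A ↔ ∃ φ : PosForm σ, (φ.Wf ∧ φ.EqOk (LogSym.eq ∈ Γ) ∧ φ.vars = ∅ ∧ φ.word b = w) ∧
      (φ.toFormula b).Holds A := by
  constructor
  · rintro ⟨φ, ⟨hw, hf⟩, hl, hA, rfl⟩
    obtain ⟨ψ, rfl, hψ⟩ := PosForm.exists_toFormula_eq hΓ hl
    exact ⟨ψ, ⟨(ψ.wellFormed_toFormula b).1 hw, hψ, ψ.freeVars_toFormula b ▸ hf,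
      (ψ.word_toFormula b).symm⟩, hA⟩
  · rintro ⟨ψ, ⟨hw, he, hv, rfl⟩, hA⟩
    exact ⟨ψ.toFormula b, ⟨(ψ.wellFormed_toFormula b).2 hw, (ψ.freeVars_toFormula b).trans hv⟩,
      PosForm.logSyms_toFormula_subset ho hq he, hA, ψ.word_toFormula b⟩

/-- A sentence satisfied by one assignment is satisfied by all, and a non-empty domain ensures that
there is an assignment. -/
theorem mem_MC_iff_of_or [Nonempty D] (ho : LogSym.or ∈ Γ) (hq : LogSym.ex ∈ Γ)
    (hΓ : Γ ⊆ {LogSym.or, LogSym.ex, LogSym.eq}) {w : List Sym} :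
    w ∈ MC Γ A ↔ IsSentenceWord σ true (LogSym.eq ∈ Γ) w ∧ ∃ x y, w = x ++ y ∧
      AtomAt (σ := σ) (fun i t => ∃ s : ℕ → D, (fun m => s (t m)) ∈ A.rel i)
        (fun j k => ∃ s : ℕ → D, s j = s k) y := by
  rw [mem_MC_iff (b := true) A ho hq hΓ, isSentenceWord_iff, exists_and_right.symm]
  refine exists_congr fun φ => and_congr_right ?_
  rintro ⟨-, -, hv, rfl⟩
  rw [← PosForm.atomEx_iff, ← PosForm.exists_sat]
  refine ⟨fun h => ⟨fun _ => Classical.arbitrary D, h _⟩, ?_⟩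
  rintro ⟨s, hs⟩ s'
  refine (Formula.sat_congr A _ fun j hj => ?_).1 hs
  rw [PosForm.freeVars_toFormula, hv] at hj
  exact absurd hj (Set.notMem_empty j)

/-- To hold under all assignments is not to be falsifiable, so here the search for a falsifiable
atom is negated. -/
theorem mem_MC_iff_of_and (ho : LogSym.and ∈ Γ) (hq : LogSym.all ∈ Γ)
    (hΓ : Γ ⊆ {LogSym.and, LogSym.all, LogSym.eq}) {w : List Sym} :
    w ∈ MC Γ A ↔ IsSentenceWord σ false (LogSym.eq ∈ Γ) w ∧ ¬ ∃ x y, w = x ++ y ∧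
      AtomAt (σ := σ) (fun i t => ∃ s : ℕ → D, (fun m => s (t m)) ∈ (A.rel i)ᶜ)
        (fun j k => ∃ s : ℕ → D, s j ≠ s k) y := by
  rw [mem_MC_iff (b := false) A ho hq hΓ, isSentenceWord_iff, exists_and_right.symm]
  refine exists_congr fun φ => and_congr_right ?_
  rintro ⟨-, -, hv, rfl⟩
  rw [← PosForm.atomEx_iff, ← PosForm.exists_not_sat, not_exists]
  simp only [not_not]
  rfl

end MC

end FOModelChecking

/-! ### Deciding the syntactic relations by fragments -/

namespace FOModelChecking

namespace CompW

variable {α : Type} {m n a : ℕ}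

/-- Meant for parameters that are independent of the input, such as letters, relation symbols and
tuples over the fixed domain; the alternatives are built into the machine. -/
theorem exists_finite {ι : Type*} [Finite ι] {R : ι → (Fin m → List α) → Prop}
    (hR : ∀ x, CompW (R x)) : CompW fun s => ∃ x, R x s := by
  classical
  have := Fintype.ofFinite ι
  have h : ∀ S : Finset ι, CompW fun s => ∃ x ∈ S, R x s := by
    intro S
    induction S using Finset.induction_on with
    | empty => exact (const False).congr fun s => by simp
    | insert x S _ ih => exact ((hR x).or ih).congr fun s => by simp
  exact (h Finset.univ).congr fun s => by simp

theorem forall_finite {ι : Type*} [Finite ι] {R : ι → (Fin m → List α) → Prop}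
    (hR : ∀ x, CompW (R x)) : CompW fun s => ∀ x, R x s :=
  (exists_finite fun x => (hR x).not).not.congr fun s => by simp

variable [Finite α]

/-- Removing the first letter. -/
theorem cons {R : (Fin (m + 1) → List α) → Prop} (hR : CompW R) (i : Fin m) (c : α) :
    CompW fun s : Fin m → List α => ∃ l, s i = c :: l ∧ R (Fin.cons l s) := by
  refine (((singleton 0 c).and (hR.rename Fin.succ)).split i).congr fun s => ?_
  constructor
  · rintro ⟨l₁, l₂, h, h₁, h₂⟩
    simp only [Fin.cons_zero] at h₁
    exact ⟨l₂, by rw [h, h₁]; rfl, h₂⟩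
  · rintro ⟨l, h, h'⟩
    exact ⟨[c], l, h, rfl, h'⟩

/-- Removing a given prefix. -/
theorem removePrefix (u : List α) : ∀ {m : ℕ} {R : (Fin (m + 1) → List α) → Prop}, CompW R →
    ∀ i : Fin m, CompW fun s : Fin m → List α => ∃ l, s i = u ++ l ∧ R (Fin.cons l s) := by
  induction u with
  | nil =>
    intro m R hR i
    refine (hR.rename (Fin.cons i id)).congr fun s => ?_
    have : s ∘ (Fin.cons i id : Fin (m + 1) → Fin m) = Fin.cons (s i) s :=
      funext (Fin.cases rfl fun _ => rfl)
    rw [this]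
    simp
  | cons c u ih =>
    intro m R hR i
    have h1 : CompW fun s : Fin (m + 1) → List α => ∃ l, s 0 = u ++ l ∧
        R (Fin.cons l (Fin.tail s)) := by
      refine (ih (hR.rename (Fin.cons 0 fun j => j.succ.succ : Fin (m + 1) → Fin (m + 2))) 0).congr
        fun s => ?_
      refine exists_congr fun l => and_congr_right fun _ => iff_of_eq (congrArg R ?_)
      exact funext (Fin.cases rfl fun _ => rfl)
    refine (h1.cons i c).congr fun s => ?_
    simp only [Fin.cons_zero, Fin.tail_cons, List.cons_append]
    constructor
    · rintro ⟨l, h, l', rfl, h'⟩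
      exact ⟨l', h, h'⟩
    · rintro ⟨l', h, h'⟩
      exact ⟨_, h, l', rfl, h'⟩

/-- Splitting a word into a given number of words. -/
theorem splitVec : ∀ {a m : ℕ} {R : (Fin a → List α) → (Fin m → List α) → Prop},
    (CompW fun s : Fin (a + m) → List α =>
      R (fun j => s (Fin.castAdd m j)) (fun j => s (Fin.natAdd a j))) → ∀ i : Fin m,
    CompW fun s : Fin m → List α => ∃ v : Fin a → List α, s i = (List.ofFn v).flatten ∧ R v s := by
  intro a
  induction a with
  | zero =>
    intro m R hR i
    refine ((nil i).and (hR.rename (Fin.cast (Nat.zero_add m)))).congr fun s => ?_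
    have h : (fun j => (s ∘ Fin.cast (Nat.zero_add m)) (Fin.natAdd 0 j)) = s := by
      funext j
      simp
    simp only [h]
    constructor
    · rintro ⟨h, h'⟩
      exact ⟨_, by simpa using h, h'⟩
    · rintro ⟨v, h, h'⟩
      refine ⟨by simpa using h, ?_⟩
      convert h'
  | succ a ih =>
    intro m R hR i
    let τ : Fin (a + 1 + m) → Fin (a + (m + 2)) :=
      Fin.addCases (Fin.cons (Fin.natAdd a 0) (Fin.castAdd (m + 2)))
        fun j => Fin.natAdd a j.succ.succ
    -- A split puts the first word at index 0 and the rest at index 1, which is then split further.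
    -- `τ` makes the word at index 0 the first entry of the vector.
    have h1 := ih (R := fun v (s : Fin (m + 2) → List α) =>
      R (Fin.cons (s 0) v) fun j => s j.succ.succ) (m := m + 2) (by
        refine (hR.rename τ).congr fun s => ?_
        refine iff_of_eq (congrArg₂ R (funext fun j => ?_) (funext fun j => ?_))
        · simp only [Function.comp_apply, τ, Fin.addCases_left]
          refine Fin.cases rfl (fun j => rfl) j
        · simp only [Function.comp_apply, τ, Fin.addCases_right]) 1
    refine (h1.split i).congr fun s => ?_
    constructor
    · rintro ⟨l₁, l₂, h, v, hv, h'⟩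
      refine ⟨Fin.cons l₁ v, ?_, h'⟩
      rw [h, show l₂ = _ from hv]
      simp [List.ofFn_succ]
    · rintro ⟨v, h, h'⟩
      refine ⟨v 0, (List.ofFn (Fin.tail v)).flatten, ?_, Fin.tail v, rfl, ?_⟩
      · rw [h, List.ofFn_succ]
        rfl
      · show R (Fin.cons (v 0) (Fin.tail v)) s
        rwa [Fin.cons_self_tail]

/-- The alphabet is finite, so the letter is a finite parameter and its place is given by a split.
-/
theorem exists_mem (q : α → Prop) : CompW fun s : Fin 1 → List α => ∃ c ∈ s 0, q c := by
  have h : ∀ c, CompW fun s : Fin 1 → List α =>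
      q c ∧ ∃ l₁ l₂, s 0 = l₁ ++ l₂ ∧ ∃ l, l₂ = c :: l ∧ True :=
    fun c => (const (q c)).and (((const (m := 4) True).cons 1 c).split 0)
  refine (exists_finite h).congr fun s => exists_congr fun c => ?_
  rw [and_comm]
  refine and_congr_left fun _ => ?_
  rw [List.mem_iff_append]
  constructor
  · rintro ⟨l₁, _, h, l₂, rfl, -⟩
    exact ⟨l₁, l₂, h⟩
  · rintro ⟨l₁, l₂, h⟩
    exact ⟨l₁, _, h, l₂, rfl, trivial⟩

end CompW

section Recognition

variable {σ : Signature} {b : Bool} {e : Prop} {m : ℕ}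

theorem compW_hasLog : CompW fun s : Fin 1 → List Sym => HasLog (s 0) :=
  (CompW.exists_mem fun c => ∃ x, c = Sum.inl x).congr fun s => by
    constructor
    · rintro ⟨_, h, x, rfl⟩
      exact ⟨x, h⟩
    · rintro ⟨x, h⟩
      exact ⟨_, h, x, rfl⟩

theorem compW_delim : CompW fun s : Fin 1 → List Sym => Delim (s 0) := by
  have h : ∀ c : Sym, CompW fun s : Fin 1 → List Sym => IsDigit c ∧ ∃ l, s 0 = c :: l ∧ True :=
    fun c => (CompW.const (IsDigit c)).and ((CompW.const (m := 2) True).cons 0 c)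
  refine (CompW.exists_finite h).not.congr fun s => ?_
  simp only [Delim, and_true, not_exists, not_and]
  exact ⟨fun h c l h1 h2 => h c h2 l h1, fun h c h2 l h1 => h c l h1 h2⟩

theorem compW_isBin : CompW fun s : Fin 1 → List Sym => IsBin (s 0) := by
  have h1 : CompW fun s : Fin 2 → List Sym => ∀ c ∈ s 0, IsDigit c :=
    ((CompW.exists_mem fun c => ¬ IsDigit c).not.rename ![0]).congr fun s => by simp
  exact (CompW.singleton 0 _).or (h1.cons 0 (Sum.inr AuxSym.one))

theorem compW_isVar : CompW fun s : Fin 1 → List Sym => IsVar (s 0) :=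
  (compW_isBin.rename (m := 2) ![0]).cons 0 vSym

theorem compW_getLast? (c : Sym) :
    CompW fun s : Fin 1 → List Sym => (s 0).getLast? = some c := by
  have h : CompW fun s : Fin 1 → List Sym => ∃ l₁ l₂, s 0 = l₁ ++ l₂ ∧ l₂ = [c] :=
    (CompW.singleton 1 c).split 0
  refine h.congr fun s => ?_
  rw [List.getLast?_eq_some_iff]
  constructor
  · rintro ⟨l, _, h, rfl⟩
    exact ⟨l, h⟩
  · rintro ⟨l, h⟩
    exact ⟨l, _, h, rfl⟩

theorem compW_bd : CompW fun s : Fin 2 → List Sym => Bd b (s 0) (s 1) := by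
  -- The order of the words is `v`, `x₂`, `l`, `x₁`, `y`, followed by the two arguments.
  have h1 : CompW fun s : Fin 7 → List Sym => s 0 = s 5 ∧ Delim (s 1) ∧ Alive (s 1) :=
    (CompW.eq 0 5).and ((compW_delim.rename ![1]).and (CompW.alive 1))
  have h2 : CompW fun s : Fin 2 → List Sym => ∃ x₁ y, s 1 = x₁ ++ y ∧ ∃ l,
      y = [lp, quSym b] ++ l ∧ ∃ v x₂, l = v ++ x₂ ∧ v = s 0 ∧ Delim x₂ ∧ Alive x₂ :=
    (((h1.split 0).removePrefix [lp, quSym b] 1).split 1)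
  refine h2.congr fun s => ?_
  constructor
  · rintro ⟨x₁, _, h, _, rfl, _, x₂, rfl, rfl, hd, ha⟩
    exact ⟨x₁, x₂, h, hd, ha⟩
  · rintro ⟨x₁, x₂, h, hd, ha⟩
    exact ⟨x₁, _, h, _, rfl, _, x₂, rfl, rfl, hd, ha⟩

theorem compW_freeIn : CompW fun s : Fin 2 → List Sym => FreeIn b (s 0) (s 1) := by
  -- The order of the words is `v`, `y`, `x`, `y'`, followed by the two arguments.
  have h1 : CompW fun s : Fin 6 → List Sym => s 0 = s 4 ∧ Delim (s 1) ∧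
      (s 2).getLast? ≠ some (quSym b) ∧ ¬ Bd b (s 4) (s 2) :=
    (CompW.eq 0 4).and ((compW_delim.rename ![1]).and
      (((compW_getLast? (quSym b)).rename ![2]).not.and (compW_bd.rename ![4, 2]).not))
  have h2 : CompW fun s : Fin 2 → List Sym => ∃ x y', s 1 = x ++ y' ∧ ∃ v y, y' = v ++ y ∧
      v = s 0 ∧ Delim y ∧ x.getLast? ≠ some (quSym b) ∧ ¬ Bd b (s 0) x :=
    (h1.split 1).split 1
  refine h2.congr fun s => ?_
  constructor
  · rintro ⟨x, _, h, _, y, rfl, rfl, h'⟩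
    exact ⟨x, _, h, y, rfl, h'⟩
  · rintro ⟨x, _, h, y, rfl, h'⟩
    exact ⟨x, _, h, _, y, rfl, rfl, h'⟩

theorem isVar_flatten_iff {a : ℕ} {l : List Sym} {K : (Fin a → List Sym) → Prop} :
    (∃ v : Fin a → List Sym, l = (List.ofFn v).flatten ∧ (∀ j, IsVar (v j)) ∧ K v) ↔
      ∃ t : Fin a → ℕ, l = (List.ofFn t).flatMap varWord ∧ K fun j => varWord (t j) := by
  have h : ∀ t : Fin a → ℕ, (List.ofFn t).flatMap varWord =
      (List.ofFn fun j => varWord (t j)).flatten := by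
    intro t
    rw [List.flatMap_def, List.map_ofFn]
    rfl
  constructor
  · rintro ⟨v, rfl, hv, hK⟩
    choose t ht using fun j => isVar_iff.1 (hv j)
    obtain rfl : v = fun j => varWord (t j) := funext ht
    exact ⟨t, (h t).symm, hK⟩
  · rintro ⟨t, rfl, hK⟩
    exact ⟨_, h t, fun j => isVar_iff.2 ⟨_, rfl⟩, hK⟩

/-- The values `x` define an assignment on the variables `t` iff they are consistent; elsewhere a
default value does. Variables are compared as words because this is the comparison that a fragment
can make. -/
theorem forall_eq_iff_exists_comp {a : ℕ} {D : Type*} [Nonempty D] (t : Fin a → ℕ)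
    (x : Fin a → D) : (∀ j k, varWord (t j) = varWord (t k) → x j = x k) ↔
      ∃ s : ℕ → D, (fun j => s (t j)) = x := by
  constructor
  · intro h
    refine ⟨Function.extend t x fun _ => Classical.arbitrary D, funext fun j => ?_⟩
    exact Function.FactorsThrough.extend_apply (fun j k hjk => h j k (by rw [hjk])) _ j
  · rintro ⟨s, rfl⟩ j k h
    simp only [varWord_injective h]

/-- Words that start with an atom for the relation symbol `i`, whose arguments satisfy a condition
that depends only on which of them are equal, followed by a word with a given property. -/
theorem compW_relAtom {D : Type*} [Finite D] [Nonempty D] (i : Fin σ.card)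
    (S : Set (Fin (σ.arity i) → D)) {T : List Sym → Prop}
    (hT : CompW fun s : Fin 1 → List Sym => T (s 0)) : CompW fun s : Fin 1 → List Sym =>
      ∃ t z, s 0 = (Formula.rel i t : Formula σ).word ++ z ∧ T z ∧
        ∃ s : ℕ → D, (fun j => s (t j)) ∈ S := by
  have h1 : ∀ x : Fin (σ.arity i) → D, CompW fun s : Fin 4 → List Sym => ∃ v : Fin (σ.arity i) → List Sym,
      s 0 = (List.ofFn v).flatten ∧ (∀ j, IsVar (v j)) ∧ ∀ j k, v j = v k → x j = x k := by
    intro x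
    refine CompW.splitVec (R := fun v _ => (∀ j, IsVar (v j)) ∧ ∀ j k, v j = v k → x j = x k) ?_ 0
    exact (CompW.forall_finite fun j => compW_isVar.rename fun _ => Fin.castAdd 4 j).and
      (CompW.forall_finite fun j => CompW.forall_finite fun k =>
        (CompW.eq (Fin.castAdd 4 j) (Fin.castAdd 4 k)).imp (CompW.const _))
  have h2 : ∀ x : Fin (σ.arity i) → D, CompW fun s : Fin 1 → List Sym => x ∈ S ∧ ∃ l, s 0 =
      (Sum.inr AuxSym.R :: bin (i + 1) ++ [lp]) ++ l ∧ ∃ l₁ l₂, l = l₁ ++ l₂ ∧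
        (∃ v : Fin (σ.arity i) → List Sym, l₁ = (List.ofFn v).flatten ∧ (∀ j, IsVar (v j)) ∧
          ∀ j k, v j = v k → x j = x k) ∧ ∃ z, l₂ = rp :: z ∧ T z := fun x =>
    (CompW.const _).and ((((h1 x).and ((hT.rename (m := 5) ![0]).cons 1 rp)).split
      (m := 2) 0).removePrefix (Sum.inr AuxSym.R :: bin (i + 1) ++ [lp]) 0)
  -- The assignment matters only through the tuple `x` of values of the arguments, for which there
  -- are finitely many choices.
  refine (CompW.exists_finite h2).congr fun s => ?_
  have hw : ∀ (t : Fin (σ.arity i) → ℕ) (z : List Sym), (Formula.rel i t : Formula σ).word ++ z =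
      (Sum.inr AuxSym.R :: bin (i + 1) ++ [lp]) ++ ((List.ofFn t).flatMap varWord ++ rp :: z) :=
    fun t z => by simp [Formula.word, paren]
  simp only [isVar_flatten_iff (K := fun v => ∀ j k, v j = v k → _), forall_eq_iff_exists_comp, hw]
  constructor
  · rintro ⟨x, hx, _, h, _, _, rfl, ⟨t, rfl, s, rfl⟩, z, rfl, hz⟩
    exact ⟨t, z, h, hz, s, hx⟩
  · rintro ⟨t, z, h, hz, s, hs⟩
    exact ⟨_, hs, _, h, _, _, rfl, ⟨t, rfl, s, rfl⟩, z, rfl, hz⟩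

theorem compW_isAtomWord : CompW fun s : Fin 1 → List Sym => IsAtomWord σ e (s 0) := by
  have hrel : ∀ i : Fin σ.card, CompW fun s : Fin 1 → List Sym =>
      ∃ t, s 0 = (Formula.rel i t : Formula σ).word := fun i =>
    -- With a one-element domain and the full relation, the condition on the arguments is vacuous
    -- and only the form of the atom is tested.
    (compW_relAtom (D := Unit) i Set.univ (T := (· = [])) (CompW.nil 0)).congr fun s => by simp
  have h1 : CompW fun s : Fin 4 → List Sym => IsVar (s 0) := compW_isVar.rename ![0]
  have h2 : CompW fun s : Fin 1 → List Sym => ∃ l₁ l₂, s 0 = l₁ ++ l₂ ∧ IsVar l₁ ∧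
      ∃ l₃, l₂ = eqSym :: l₃ ∧ IsVar l₃ :=
    ((compW_isVar.rename ![0]).and (h1.cons 1 eqSym)).split 0
  refine ((CompW.exists_finite hrel).or ((CompW.const e).and h2)).congr fun s => ?_
  refine or_congr_right (and_congr_right fun _ => ?_)
  simp only [isVar_iff]
  constructor
  · rintro ⟨_, _, h, ⟨j, rfl⟩, _, rfl, k, rfl⟩
    exact ⟨j, k, h⟩
  · rintro ⟨j, k, h⟩
    exact ⟨_, _, h, ⟨j, rfl⟩, _, rfl, k, rfl⟩

theorem compW_looks : CompW fun s : Fin 1 → List Sym => Looks σ e (s 0) := by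
  have h1 : CompW fun s : Fin 4 → List Sym => s 1 = [rp] ∧ Balanced (s 0) ∧ HasLog (s 0) :=
    (CompW.singleton 1 rp).and ((CompW.balanced 0).and (compW_hasLog.rename ![0]))
  have h2 : CompW fun s : Fin 1 → List Sym => ∃ l, s 0 = lp :: l ∧ ∃ m r, l = m ++ r ∧ r = [rp] ∧
      Balanced m ∧ HasLog m :=
    (h1.split (m := 2) 0).cons 0 lp
  refine (compW_isAtomWord.or h2).congr fun s => or_congr_right ?_
  constructor
  · rintro ⟨_, h, m, _, rfl, rfl, h'⟩
    exact ⟨m, h, h'⟩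
  · rintro ⟨m, h, h'⟩
    exact ⟨_, h, m, _, rfl, rfl, h'⟩

theorem compW_okBody : CompW fun s : Fin 1 → List Sym => OkBody σ b e (s 0) := by
  have h1 : CompW fun s : Fin 1 → List Sym => ∃ l₁ l, s 0 = l₁ ++ l ∧ ∃ l₂, l = opSym b :: l₂ ∧
      Looks σ e l₁ ∧ Looks σ e l₂ :=
    (((compW_looks.rename (m := 4) ![1]).and (compW_looks.rename ![0])).cons 1 (opSym b)).split 0
  have h2 : CompW fun s : Fin 1 → List Sym => ∃ l', s 0 = quSym b :: l' ∧ ∃ vw l, l' = vw ++ l ∧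
      IsVar vw ∧ Looks σ e l ∧ FreeIn b vw l :=
    (((compW_isVar.rename (m := 4) ![0]).and ((compW_looks.rename ![1]).and
      (compW_freeIn.rename ![0, 1]))).split 0).cons 0 (quSym b)
  refine (h1.or h2).congr fun s => or_congr ?_ ?_
  · constructor
    · rintro ⟨l₁, _, h, l₂, rfl, h'⟩
      exact ⟨l₁, l₂, h, h'⟩
    · rintro ⟨l₁, l₂, h, h'⟩
      exact ⟨l₁, _, h, l₂, rfl, h'⟩
  · constructor
    · rintro ⟨_, h, vw, l, rfl, h'⟩
      exact ⟨vw, l, h, h'⟩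
    · rintro ⟨vw, l, h, h'⟩
      exact ⟨_, h, vw, l, rfl, h'⟩

theorem compW_badAt : CompW fun s : Fin 1 → List Sym => BadAt σ b e (s 0) := by
  have h1 : CompW fun s : Fin 4 → List Sym => (∃ z, s 1 = rp :: z ∧ True) ∧ Balanced (s 0) ∧
      HasLog (s 0) ∧ ¬ OkBody σ b e (s 0) :=
    ((CompW.const (m := 5) True).cons 1 rp).and ((CompW.balanced 0).and
      ((compW_hasLog.rename ![0]).and (compW_okBody.rename ![0]).not))
  have h2 : CompW fun s : Fin 1 → List Sym => ∃ l, s 0 = lp :: l ∧ ∃ m r, l = m ++ r ∧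
      (∃ z, r = rp :: z ∧ True) ∧ Balanced m ∧ HasLog m ∧ ¬ OkBody σ b e m :=
    (h1.split (m := 2) 0).cons 0 lp
  refine h2.congr fun s => ?_
  constructor
  · rintro ⟨_, h, m, _, rfl, ⟨z, rfl, -⟩, h'⟩
    exact ⟨m, z, h, h'⟩
  · rintro ⟨m, z, h, h'⟩
    exact ⟨_, h, m, _, rfl, ⟨z, rfl, trivial⟩, h'⟩

theorem compW_isSentenceWord : CompW fun s : Fin 1 → List Sym => IsSentenceWord σ b e (s 0) := by
  have h1 : CompW fun s : Fin 1 → List Sym => ∃ x y, s 0 = x ++ y ∧ BadAt σ b e y :=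
    (compW_badAt.rename ![1]).split 0
  have h2 : CompW fun s : Fin 1 → List Sym => ∃ x y, s 0 = x ++ y ∧ ∃ vw z, y = vw ++ z ∧
      IsVar vw ∧ FreeIn b vw (s 0) :=
    -- Index 4 is the whole word: freeness is judged there and not in a factor.
    (((compW_isVar.rename ![0]).and (compW_freeIn.rename ![0, 4])).split (m := 3) 1).split 0
  refine ((compW_looks (σ := σ) (e := e)).and (h1.not.and h2.not)).congr fun s => ?_
  simp only [IsSentenceWord, not_exists, not_and]

theorem compW_eqAtom {D : Type*} [Finite D] [Nonempty D] (H : D → D → Prop) :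
    CompW fun s : Fin 1 → List Sym => ∃ j k z, s 0 = varWord j ++ eqSym :: (varWord k ++ z) ∧
      Delim z ∧ ∃ s : ℕ → D, H (s j) (s k) := by
  have h1 : ∀ x : D × D, CompW fun s : Fin 1 → List Sym => H x.1 x.2 ∧ ∃ l₁ l₂, s 0 = l₁ ++ l₂ ∧
      IsVar l₁ ∧ ∃ l₃, l₂ = eqSym :: l₃ ∧ ∃ l₄ l₅, l₃ = l₄ ++ l₅ ∧ IsVar l₄ ∧ Delim l₅ ∧
        (l₁ = l₄ → x.1 = x.2) := fun x =>
    (CompW.const _).and (((compW_isVar.rename ![0]).and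
      ((((compW_isVar.rename ![0]).and ((compW_delim.rename ![1]).and
        ((CompW.eq 3 0).imp (CompW.const _)))).split (m := 4) 0).cons 1 eqSym)).split 0)
  refine (CompW.exists_finite h1).congr fun s => ?_
  simp only [isVar_iff]
  constructor
  · rintro ⟨x, hx, _, _, h, ⟨j, rfl⟩, _, rfl, _, z, rfl, ⟨k, rfl⟩, hz, hjk⟩
    -- If `k = j`, then `hjk` gives `x.1 = x.2`, so this assignment yields the pair `x` in either
    -- case.
    refine ⟨j, k, z, h, hz, fun n => if n = j then x.1 else x.2, ?_⟩
    rcases eq_or_ne k j with rfl | hne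
    · simpa [hjk rfl] using hx
    · simpa [hne] using hx
  · rintro ⟨j, k, z, h, hz, s, hs⟩
    exact ⟨(s j, s k), hs, _, _, h, ⟨j, rfl⟩, _, rfl, _, z, rfl, ⟨k, rfl⟩, hz,
      fun hjk => by rw [varWord_injective hjk]⟩

theorem compW_atomAt {D : Type*} [Finite D] [Nonempty D]
    (S : (i : Fin σ.card) → Set (Fin (σ.arity i) → D)) (H : D → D → Prop) :
    CompW fun s : Fin 1 → List Sym => ∃ x y, s 0 = x ++ y ∧ AtomAt (σ := σ)
      (fun i t => ∃ s : ℕ → D, (fun j => s (t j)) ∈ S i)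
      (fun j k => ∃ s : ℕ → D, H (s j) (s k)) y :=
  (((CompW.exists_finite fun i => (compW_relAtom i (S i) (T := fun _ => True)
    (CompW.const True)).congr (S := fun s => ∃ t z, s 0 = (Formula.rel i t : Formula σ).word ++ z ∧
      ∃ s : ℕ → D, (fun j => s (t j)) ∈ S i) fun s => by simp only [true_and]).or (compW_eqAtom H)).rename ![1]).split 0

end Recognition

end FOModelChecking

open FOModelChecking in
theorem mainTheorem8 (σ : FOModelChecking.Signature) {D : Type*} [Finite D] [Nonempty D]
    (A : σ.Struct D) (Γ : Set FOModelChecking.LogSym) (hΓ : Γ ∈ FOModelChecking.ClassI) :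
    FOModelChecking.InLogspace (FOModelChecking.MC Γ A) := by
  have hor : LogSym.or ∈ Γ → LogSym.ex ∈ Γ → Γ ⊆ {LogSym.or, LogSym.ex, LogSym.eq} →
      InLogspace (MC Γ A) := fun ho hq hs =>
    CompW.inLogspace (compW_isSentenceWord.and (compW_atomAt A.rel (· = ·)))
      fun w => (mem_MC_iff_of_or A ho hq hs).symm
  have hand : LogSym.and ∈ Γ → LogSym.all ∈ Γ → Γ ⊆ {LogSym.and, LogSym.all, LogSym.eq} →
      InLogspace (MC Γ A) := fun ho hq hs =>
    CompW.inLogspace (compW_isSentenceWord.and (compW_atomAt (fun i => (A.rel i)ᶜ) (· ≠ ·)).not)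
      fun w => (mem_MC_iff_of_and A ho hq hs).symm
  rcases hΓ with rfl | rfl | rfl | rfl
  · exact hor (by simp) (by simp) (by simp [Set.insert_subset_iff])
  · exact hor (by simp) (by simp) (by simp)
  · exact hand (by simp) (by simp) (by simp [Set.insert_subset_iff])
  · exact hand (by simp) (by simp) (by simp)
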